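/- **Model.** Fix $m\in\mathbb N$ and a finite set $G$ of register values. Let $\Sigma_C=\{\bar r_i(g),\bar w_i(g)\}$ and $\Sigma_D=\{r_i(g),w_i(g)\}$, where $1\le i\le m$ and $g\in G$, be the (disjoint) alphabets of reads and writes of the contributors and of the leader. A $(\mathcal C,\mathcal D)$-system with $m$ registers consists of a transition system $\mathcal C$ over $\Sigma_C$ with states $S$ and initial state $s_{init}$, a transition system $\mathcal D$ over $\Sigma_D$ with states $T$ and initial state $t_{init}$ (both possibly infinite; silent $\varepsilon$-transitions are allowed), and initial register contents in $G^m$. A configuration $(M,t,\rho)$ consists of a finite multiset $M$ over $S$, a state $t\in T$ and $\rho\in G^m$. In one step either the leader or one contributor takes one of its transitions; a write of $g$ to register $i$ sets $\rho_i:=g$, a read of $g$ from register $i$ requires $\rho_i=g$, and an $\varepsilon$-transition does not affect the registers. A run is initial if it starts with $t_{init}$, the initial register contents and $n$ contributors in state $s_{init}$, for some $n\in\mathbb N$. A maximal run is an initial run that is infinite or ends in a configuration without outgoing steps. A maximal trace is the finite or infinite word over $\Sigma_C\cup\Sigma_D$ labelling a maximal run, with $\varepsilon$ erased. The system is a pushdown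 system if $\mathcal C$ and $\mathcal D$ are the transition systems of pushdown automata $\mathcal A_C$, $\mathcal A_D$ (finite sets of control states and stack symbols, finitely many transitions $qA\xrightarrow{a}q'\alpha'$ with $a$ a letter or $\varepsilon$, one initial stack symbol). **Properties.** For an alphabet $\Sigma$ let $\Sigma^\infty$ be the set of finite and infinite words over $\Sigma$. A property $\mathcal P\subseteq\Sigma^\infty$ is regular if it is the language of a finite automaton that accepts finite words by final states and infinite words by the Büchi condition; it is an LTL property if it is the set of words satisfying a formula of linear-time temporal logic (with next and until) whose atomic propositions are the letters. A property $\mathcal P\subseteq(\Sigma_C\cup\Sigma_D)^\infty$ is $\mathcal C$-expanding if it is closed under replacing every occurrence of a letter of $\Sigma_C$ by a positive number of copies, chosen separately for each occurrence. **Theorem.** Let $m$ be fixed. For every $(\mathcal C,\mathcal D)$-system with $m$ registers and every $\mathcal C$-expanding regular (resp. LTL) property $\mathcal P\subseteq(\Sigma_C\cup\Sigma_D)^\infty$ there exist a $(\tilde{\mathcal C},\tilde{\mathcal D})$-system with one register and a regular (resp. LTL) property $\tilde{\mathcal P}\subseteq(\tilde\Sigma_D)^\infty$, where $\tilde\Sigma_D$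 is the alphabet of $\tilde{\mathcal D}$, such that the $(\mathcal C,\mathcal D)$-system has a maximal trace $u\in\mathcal P$ if and only if the $(\tilde{\mathcal C},\tilde{\mathcal D})$-system has a maximal trace $u'$ whose projection on $\tilde\Sigma_D$ is in $\tilde{\mathcal P}$. Moreover, for pushdown systems and for properties given by an automaton (resp. by a formula), such a pushdown $(\tilde{\mathcal C},\tilde{\mathcal D})$-system with one register and an automaton (resp. a formula) for such a $\tilde{\mathcal P}$ are computable from the given system and the given automaton (resp. formula) in polynomial time, by an algorithm that depends only on $m$. -/

import Mathlib

namespace ParamSys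

/-! ### Finite and infinite words -/

/-- `Word A` is the set of all finite and infinite words over `A`. -/
inductive Word (A : Type*) where
  | fin (l : List A) : Word A
  | inf (f : ℕ → A) : Word A

namespace Word

variable {A B : Type*}

/-- The letter at position `i`, if there is one. -/
def get? : Word A → ℕ → Option A
  | fin l, i => l[i]?
  | inf f, i => some (f i)

/-- The prefix of length `n` (the whole word if it is shorter). -/
def take : Word A → ℕ → List A
  | fin l, n => l.take n
  | inf f, n => (List.range n).map f

/-- `IsConcat h w v`: the word `v` is the finite or infinite concatenation
`h 0 w₀ ++ h 1 w₁ ++ h 2 w₂ ++ ⋯`, that is, the limit of the images of the finite prefixes of `w`.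
For given `h` and `w` there is exactly one such `v`. -/
def IsConcat (h : ℕ → A → List B) (w : Word A) (v : Word B) : Prop :=
  ∀ (k : ℕ) (b : B), v.get? k = some b ↔
    ∃ n : ℕ, ((w.take n).zipIdx.flatMap fun p => h p.2 p.1)[k]? = some b

end Word

/-! ### Actions, transition systems and systems with shared registers -/

/-- Operations on `m` registers with values in `V`: `read i g` and `write i g` stand for
`r_i(g)` and `w_i(g)`. -/
inductive RegOp (m : ℕ) (V : Type*) where
  | read (i : Fin m) (g : V) : RegOp m V
  | write (i : Fin m) (g : V) : RegOp m V

/-- The joint alphabet `Σ_C ∪ Σ_D` (a disjoint union): `Sum.inl a` is the operation `a` performed by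
a contributor, `Sum.inr a` is the operation `a` performed by the leader. -/
abbrev Act (m : ℕ) (V : Type*) := RegOp m V ⊕ RegOp m V

/-- A transition system with labels in `A`; the label `none` is the silent label `ε`. -/
structure TransSys (A : Type*) (S : Type*) where
  step : S → Option A → S → Prop
  init : S

/-- A `(C,D)`-system with `m` shared registers with values in `V`; `S` and `T` are the (possibly
infinite) sets of states of the contributors and of the leader. -/
structure CDSystem (m : ℕ) (V : Type*) (S : Type*) (T : Type*) where
  contrib : TransSys (RegOp m V) S
  leader : TransSys (RegOp m V) T
  regInit : Fin m → V

/-- The effect of an operation on the register contents; a silent move does not change them. -/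
def RegStep {m : ℕ} {V : Type*} : Option (RegOp m V) → (Fin m → V) → (Fin m → V) → Prop
  | none, ρ, ρ' => ρ' = ρ
  | some (.read i g), ρ, ρ' => ρ i = g ∧ ρ' = ρ
  | some (.write i g), ρ, ρ' => ρ' = Function.update ρ i g

/-- Configurations: the multiset of contributor states, the leader state, the registers. -/
structure Config (m : ℕ) (V : Type*) (S : Type*) (T : Type*) where
  pop : Multiset S
  lead : T
  regs : Fin m → V

namespace CDSystem

variable {m : ℕ} {V : Type*} {S : Type*} {T : Type*}

/-- The transitions of a `(C,D)`-system: one contributor moves, or the leader moves. -/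
inductive Step (sys : CDSystem m V S T) :
    Config m V S T → Option (Act m V) → Config m V S T → Prop
  | contrib {s s' : S} {a : Option (RegOp m V)} {M : Multiset S} {t : T} {ρ ρ' : Fin m → V} :
      sys.contrib.step s a s' → RegStep a ρ ρ' →
      Step sys ⟨s ::ₘ M, t, ρ⟩ (a.map Sum.inl) ⟨s' ::ₘ M, t, ρ'⟩
  | leader {t t' : T} {a : Option (RegOp m V)} {M : Multiset S} {ρ ρ' : Fin m → V} :
      sys.leader.step t a t' → RegStep a ρ ρ' →
      Step sys ⟨M, t, ρ⟩ (a.map Sum.inr) ⟨M, t', ρ'⟩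

/-- The initial configuration with `n` contributors. -/
def initConfig (sys : CDSystem m V S T) (n : ℕ) : Config m V S T :=
  ⟨Multiset.replicate n sys.contrib.init, sys.leader.init, sys.regInit⟩

/-- `w` labels a maximal initial run: the run starts in an initial configuration with some number of
contributors, and if it is finite then no transition is possible from its last configuration. -/
def IsMaximalRunLabel (sys : CDSystem m V S T) (w : Word (Option (Act m V))) : Prop :=
  ∃ (n : ℕ) (γ : ℕ → Config m V S T),
    γ 0 = sys.initConfig n ∧
    (∀ i a, w.get? i = some a → sys.Step (γ i) a (γ (i + 1))) ∧
    (∀ l, w = .fin l → ∀ a c, ¬ sys.Step (γ l.length) a c)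

/-- Maximal traces: the labels of maximal initial runs, with the silent label erased. -/
def IsMaximalTrace (sys : CDSystem m V S T) (u : Word (Act m V)) : Prop :=
  ∃ w, sys.IsMaximalRunLabel w ∧ Word.IsConcat (fun _ a => a.toList) w u

/-- The system has a maximal trace in `P`. -/
def HasMaximalTraceIn (sys : CDSystem m V S T) (P : Set (Word (Act m V))) : Prop :=
  ∃ u, sys.IsMaximalTrace u ∧ u ∈ P

/-- The system has a maximal trace whose projection on the leader alphabet is in `P`. -/
def HasMaximalTraceWithLeaderProjIn (sys : CDSystem m V S T) (P : Set (Word (RegOp m V))) : Prop :=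
  ∃ u, sys.IsMaximalTrace u ∧
    ∃ v, Word.IsConcat (fun _ a => a.getRight?.toList) u v ∧ v ∈ P

end CDSystem

/-- `C`-expanding properties: closed under replacing each occurrence of a contributor action by any
positive number of copies, the number being chosen separately for every occurrence. -/
def CExpanding {m : ℕ} {V : Type*} (P : Set (Word (Act m V))) : Prop :=
  ∀ u ∈ P, ∀ f : ℕ → ℕ, (∀ i, 0 < f i) → ∀ v,
    Word.IsConcat (fun i a => List.replicate (if a.isLeft then f i else 1) a) u v → v ∈ P

/-! ### Finite descriptions

Data are binary trees. They serve as names of states, stack symbols and register values, and as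
inputs and outputs of programs. -/

inductive Data where
  | nil : Data
  | cons (x y : Data) : Data
  deriving DecidableEq

namespace Data

/-- The number of nodes. -/
def size : Data → ℕ
  | nil => 1
  | cons x y => x.size + y.size + 1

/-- The left subtree (`nil` for the tree `nil`). -/
def fst : Data → Data
  | nil => nil
  | cons x _ => x

/-- The right subtree (`nil` for the tree `nil`). -/
def snd : Data → Data
  | nil => nil
  | cons _ y => y

end Data

/-- The pushdown transition that, in control state `src` with `pop` on top of the stack, reads `lab`
(`none` is `ε`), goes to control state `tgt` and replaces `pop` by `push`. -/
structure PDRule (A : Type*) where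
  src : Data
  pop : Data
  lab : Option A
  tgt : Data
  push : List Data

/-- Pushdown systems over the alphabet `A`, given by the initial control state, the initial stack
symbol and the finite list of transitions. The finite sets of control states and of stack symbols
are those of the names that occur. -/
structure Pushdown (A : Type*) where
  init : Data
  stackInit : Data
  rules : List (PDRule A)

/-- The transition system of a pushdown system. States are pairs of a control state and a stack
content, top symbol first. -/
def Pushdown.toTransSys {A : Type*} (𝒜 : Pushdown A) : TransSys A (Data × List Data) where
  step s a s' := ∃ r ∈ 𝒜.rules, ∃ α : List Data,
    s = (r.src, r.pop :: α) ∧ r.lab = a ∧ s' = (r.tgt, r.push ++ α)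
  init := (𝒜.init, [𝒜.stackInit])

/-- Büchi automata: `final` is used to accept finite words and `rep` to accept infinite words. -/
structure Buchi (A : Type*) where
  init : Data
  trans : List (Data × A × Data)
  final : List Data
  rep : List Data

/-- The language of finite and infinite words accepted by a Büchi automaton. -/
def Buchi.lang {A : Type*} (ℬ : Buchi A) : Set (Word A) :=
  { w | ∃ q : ℕ → Data, q 0 = ℬ.init ∧
      (∀ i a, w.get? i = some a → (q i, a, q (i + 1)) ∈ ℬ.trans) ∧
      (∀ l, w = .fin l → q l.length ∈ ℬ.final) ∧
      (∀ f, w = .inf f → ∀ N, ∃ i ≥ N, q i ∈ ℬ.rep) }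

/-- Formulas of linear-time temporal logic whose atomic propositions are the letters. -/
inductive LTL (A : Type*) where
  | tt : LTL A
  | atom (a : A) : LTL A
  | neg (φ : LTL A) : LTL A
  | and (φ ψ : LTL A) : LTL A
  | next (φ : LTL A) : LTL A
  | until (φ ψ : LTL A) : LTL A

/-- `φ.Sat w i`: the formula `φ` holds in the finite or infinite word `w` at position `i`. -/
def LTL.Sat {A : Type*} (w : Word A) : LTL A → ℕ → Prop
  | .tt, _ => True
  | .atom a, i => w.get? i = some a
  | .neg φ, i => ¬ LTL.Sat w φ i
  | .and φ ψ, i => LTL.Sat w φ i ∧ LTL.Sat w ψ i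
  | .next φ, i => (w.get? (i + 1)).isSome ∧ LTL.Sat w φ (i + 1)
  | .until φ ψ, i => ∃ j, i ≤ j ∧ (w.get? j).isSome ∧ LTL.Sat w ψ j ∧
      ∀ k, i ≤ k → k < j → LTL.Sat w φ k

/-- The language of finite and infinite words that satisfy a formula. -/
def LTL.lang {A : Type*} (φ : LTL A) : Set (Word A) := { w | LTL.Sat w φ 0 }

/-- The finite set of register values listed by `G`. -/
abbrev Val (G : List Data) := { g : Data // g ∈ G }

/-- A pushdown `(C,D)`-system with `m` registers, as a finite object. -/
structure PDSystem (m : ℕ) where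
  vals : List Data
  regInit : Fin m → Val vals
  contrib : Pushdown (RegOp m (Val vals))
  leader : Pushdown (RegOp m (Val vals))

/-- The `(C,D)`-system described by a pushdown `(C,D)`-system. -/
def PDSystem.toCD {m : ℕ} (sys : PDSystem m) :
    CDSystem m (Val sys.vals) (Data × List Data) (Data × List Data) where
  contrib := sys.contrib.toTransSys
  leader := sys.leader.toTransSys
  regInit := sys.regInit

/-! ### Encodings as trees -/

/-- An encoding of the elements of a type as binary trees. -/
class Enc (α : Type*) where
  enc : α → Data

open Enc

instance : Enc Data := ⟨id⟩

/-- Numbers in unary. -/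
def encNat : ℕ → Data
  | 0 => .nil
  | n + 1 => .cons .nil (encNat n)

instance {n : ℕ} : Enc (Fin n) := ⟨fun i => encNat i.val⟩

instance {α β : Type*} [Enc α] [Enc β] : Enc (α × β) := ⟨fun p => .cons (enc p.1) (enc p.2)⟩

/-- Lists as right combs. -/
def encList {α : Type*} [Enc α] : List α → Data
  | [] => .nil
  | a :: l => .cons (enc a) (encList l)

instance {α : Type*} [Enc α] : Enc (List α) := ⟨encList⟩

/-- `none` as `nil` and `some a` as a nonempty tree. -/
def encOption {α : Type*} [Enc α] : Option α → Data
  | none => .nil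
  | some a => .cons .nil (enc a)

instance {α : Type*} [Enc α] : Enc (Option α) := ⟨encOption⟩

/-- Disjoint unions by a tag in the left subtree. -/
def encSum {α β : Type*} [Enc α] [Enc β] : α ⊕ β → Data
  | .inl a => .cons .nil (enc a)
  | .inr b => .cons (.cons .nil .nil) (enc b)

instance {α β : Type*} [Enc α] [Enc β] : Enc (α ⊕ β) := ⟨encSum⟩

instance {G : List Data} : Enc (Val G) := ⟨fun g => g.val⟩

/-- Operations as a tag, the number of the register and the value. -/
def encRegOp {m : ℕ} {V : Type*} [Enc V] : RegOp m V → Data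
  | .read i g => .cons .nil (enc (i, g))
  | .write i g => .cons (.cons .nil .nil) (enc (i, g))

instance {m : ℕ} {V : Type*} [Enc V] : Enc (RegOp m V) := ⟨encRegOp⟩

instance {A : Type*} [Enc A] : Enc (PDRule A) :=
  ⟨fun r => enc (r.src, r.pop, r.lab, r.tgt, r.push)⟩

instance {A : Type*} [Enc A] : Enc (Pushdown A) :=
  ⟨fun 𝒜 => enc (𝒜.init, 𝒜.stackInit, 𝒜.rules)⟩

instance {A : Type*} [Enc A] : Enc (Buchi A) :=
  ⟨fun ℬ => enc (ℬ.init, ℬ.trans, ℬ.final, ℬ.rep)⟩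

/-- Formulas as syntax trees; the constructor is given by a unary tag. -/
def encLTL {A : Type*} [Enc A] : LTL A → Data
  | .tt => .cons (encNat 0) .nil
  | .atom a => .cons (encNat 1) (enc a)
  | .neg φ => .cons (encNat 2) (encLTL φ)
  | .and φ ψ => .cons (encNat 3) (.cons (encLTL φ) (encLTL ψ))
  | .next φ => .cons (encNat 4) (encLTL φ)
  | .until φ ψ => .cons (encNat 5) (.cons (encLTL φ) (encLTL ψ))

instance {A : Type*} [Enc A] : Enc (LTL A) := ⟨encLTL⟩

instance {m : ℕ} : Enc (PDSystem m) :=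
  ⟨fun sys => enc (sys.vals, List.ofFn sys.regInit, sys.contrib, sys.leader)⟩

instance {α : Type*} {β : α → Type*} [Enc α] [∀ a, Enc (β a)] : Enc (Sigma β) :=
  ⟨fun p => .cons (enc p.1) (enc p.2)⟩

/-! ### Polynomial time -/

/-- Programs: a while language on binary trees, in combinator form. A program transforms a tree. -/
inductive Prog where
  | id : Prog
  | nil : Prog
  | fst : Prog
  | snd : Prog
  | eq : Prog
  | pair (p q : Prog) : Prog
  | seq (p q : Prog) : Prog
  | ite (c p q : Prog) : Prog
  | while (c p : Prog) : Prog

/-- `p.Eval x y n`: the program `p`, started on the tree `x`, stops with the tree `y` and the running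
time is `n`. Every executed instruction (and every test of a loop) is charged the size of the tree
on which it is executed, so a Turing machine can simulate a program with polynomial overhead.
The result `nil` of a test means `false`. -/
inductive Prog.Eval : Prog → Data → Data → ℕ → Prop
  | id (x : Data) : Eval .id x x x.size
  | nil (x : Data) : Eval .nil x .nil x.size
  | fst (x : Data) : Eval .fst x x.fst x.size
  | snd (x : Data) : Eval .snd x x.snd x.size
  | eq (x : Data) : Eval .eq x (if x.fst = x.snd then .cons .nil .nil else .nil) x.size
  | pair {p q : Prog} {x y z : Data} {n k : ℕ} :
      Eval p x y n → Eval q x z k → Eval (.pair p q) x (.cons y z) (x.size + n + k)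
  | seq {p q : Prog} {x y z : Data} {n k : ℕ} :
      Eval p x y n → Eval q y z k → Eval (.seq p q) x z (x.size + n + k)
  | ite_true {c p q : Prog} {x b y : Data} {n k : ℕ} :
      Eval c x b n → b ≠ .nil → Eval p x y k → Eval (.ite c p q) x y (x.size + n + k)
  | ite_false {c p q : Prog} {x y : Data} {n k : ℕ} :
      Eval c x .nil n → Eval q x y k → Eval (.ite c p q) x y (x.size + n + k)
  | while_true {c p : Prog} {x b y z : Data} {n k l : ℕ} :
      Eval c x b n → b ≠ .nil → Eval p x y k → Eval (.while c p) y z l →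
      Eval (.while c p) x z (x.size + n + k + l)
  | while_false {c p : Prog} {x : Data} {n : ℕ} :
      Eval c x .nil n → Eval (.while c p) x x (x.size + n)

/-- `f` is computable in time polynomial in the size of the encoded input. -/
def PolyTime {α β : Type*} [Enc α] [Enc β] (f : α → β) : Prop :=
  ∃ (p : Prog) (b : Polynomial ℕ), ∀ a : α,
    ∃ n ≤ b.eval (enc a).size, p.Eval (enc a) (enc (f a)) n

end ParamSys

open ParamSys

universe u

/-!
Maximal traces of a system with `m` registers are simulated with a single register whose values are
messages (`Msg`). The leader keeps the contents of the original registers in its own state. A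
contributor that wants to perform `a` writes `req a`; if `a` is possible, the leader answers with
`ack a`, and one of the contributors waiting for this answer performs `a`. The leader announces an
action `b` of its own by writing `exec b`. The leader's letters that write `ack a` and `exec b`
record the simulated trace (`mark`, `unmark`).

An answer may be read by several contributors. As long as `ack a` stays in the register, no other
action is recorded and `a` does not change the registers again, so every further reader performs
another copy of `a` in the simulated run. These copies are not recorded, and this is where
expansion is used: the recorded word is in the property, and the simulated trace arises from it by
repeating letters of contributors (`CExpanding.mem_of_copies`). Only finitely many copies can follow
the last recorded letter, as each reader has to be waiting already (`GConfig.copies`). Messages can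
be overwritten and lost; this only blocks contributors that have not moved in the simulated run, or
whose move has been recorded already.

Deadlocks need care, since the leader cannot see the states of the contributors. The leader may
write `halt ρ` at any time and then claims that no process can move. A contributor that can move, or
that still waits for an answer, is able to refute the claim by the message `bad`, and the leader
itself refutes it if it has a possible move, finds a request or reads `bad`; a refutation ends with
the leader's letter that writes `bad`, which the property of the traces forbids. Hence an allowed
finite run ends in a configuration that stands for a deadlock (`GConfig.dead_abs`). A weight that
decreases in every step that simulates nothing shows that infinite runs simulate infinite runs. The
two directions of the equivalence are `hasMaximalTraceIn_of_oneReg` and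
`oneReg_of_hasMaximalTraceIn`.

The property of the leader's traces says that `bad` does not occur and that the recorded word has
the given property. For automata (`Buchi.record`) the letters that record nothing are skipped, and
states entered by recorded letters are distinguished, because only these may count for the Büchi
condition. For formulas (`LTL.record`) each operator is relativized to the recorded letters; the
next step, for example, leads from the next recorded letter to the one after it.

If the given system is a pushdown system, then so is the simulating one (`contribPD`, `leaderPD`): a
waiting contributor keeps the requested transition in its control state, and the leader has a bottom
symbol that is never removed, so that it can still answer requests when the simulated stack is
empty. The translation of states is a functional bisimulation (`oneReg_iff_pushdown`). All parts of
the construction enumerate register contents and rules, and there are polynomially many of them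
because `m` is fixed. Polynomial time is proved with combinators for the predicate `FP e f`, which
says that a program computes `f c` from an encoding `e c` of an environment `c`; variables are added
to the environment by `FP.lift` and `FP.var`, and loops over lists are given by `FP.foldl` and
`FP.flatMap`. Formulas are translated without recursion, in one pass over the list of their
subformulas with a stack of translations (`LTL.foldl_evalStep`).
-/


namespace ParamSys

/-! ### Limits of chains of lists -/

section Lim

variable {A B : Type*}

/-- The word `v` is the limit of the lists `E 0, E 1, …`, which are thought of as its prefixes. -/
def Lim (E : ℕ → List B) (v : Word B) : Prop :=
  ∀ (k : ℕ) (b : B), v.get? k = some b ↔ ∃ n : ℕ, (E n)[k]? = some b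

/-- Two chains of lists are cofinal if every list of one is a prefix of some list of the other. -/
def Cofinal (E F : ℕ → List B) : Prop :=
  (∀ n, ∃ m, E n <+: F m) ∧ ∀ n, ∃ m, F n <+: E m

/-- The concatenation of the first `n` lists. -/
def pre (L : ℕ → List B) (n : ℕ) : List B := (List.range n).flatMap L

@[simp] theorem pre_zero (L : ℕ → List B) : pre L 0 = [] := rfl

theorem pre_succ (L : ℕ → List B) (n : ℕ) : pre L (n + 1) = pre L n ++ L n := by
  simp [pre, List.range_succ]

theorem pre_prefix (L : ℕ → List B) {n k : ℕ} (h : n ≤ k) : pre L n <+: pre L k := by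
  induction k, h using Nat.le_induction with
  | base => exact List.prefix_refl _
  | succ k _ ih => rw [pre_succ]; exact ih.trans (List.prefix_append _ _)

theorem pre_eq_of_forall_nil {L : ℕ → List B} {n k : ℕ} (h : n ≤ k)
    (hL : ∀ i, n ≤ i → i < k → L i = []) : pre L k = pre L n := by
  induction k, h using Nat.le_induction with
  | base => rfl
  | succ k hk ih =>
    rw [pre_succ, ih fun i h1 h2 => hL i h1 (by omega), hL k hk (by omega), List.append_nil]

theorem pre_flatMap (L : ℕ → List A) (g : A → List B) (n : ℕ) :
    pre (fun i => (L i).flatMap g) n = (pre L n).flatMap g := by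
  induction n with
  | zero => rfl
  | succ n ih => rw [pre_succ, pre_succ, ih, List.flatMap_append]

theorem getElem?_of_prefix {l l' : List B} (h : l <+: l') {k : ℕ} {b : B} (hk : l[k]? = some b) :
    l'[k]? = some b := by
  obtain ⟨t, rfl⟩ := h
  rw [List.getElem?_append_left, hk]
  exact (List.getElem?_eq_some_iff.mp hk).1

theorem prefix_flatMap {l l' : List A} (h : l <+: l') (g : A → List B) :
    l.flatMap g <+: l'.flatMap g := by
  obtain ⟨t, rfl⟩ := h
  rw [List.flatMap_append]; exact List.prefix_append _ _

theorem Cofinal.symm {E F : ℕ → List B} (h : Cofinal E F) : Cofinal F E := ⟨h.2, h.1⟩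

theorem Cofinal.trans {E F G : ℕ → List B} (h : Cofinal E F) (h' : Cofinal F G) :
    Cofinal E G := by
  refine ⟨fun n => ?_, fun n => ?_⟩
  · obtain ⟨m, hm⟩ := h.1 n
    obtain ⟨k, hk⟩ := h'.1 m
    exact ⟨k, hm.trans hk⟩
  · obtain ⟨m, hm⟩ := h'.2 n
    obtain ⟨k, hk⟩ := h.2 m
    exact ⟨k, hm.trans hk⟩

theorem Cofinal.flatMap {E F : ℕ → List A} (h : Cofinal E F) (g : A → List B) :
    Cofinal (fun n => (E n).flatMap g) (fun n => (F n).flatMap g) :=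
  ⟨fun n => (h.1 n).imp fun _ hm => prefix_flatMap hm g,
    fun n => (h.2 n).imp fun _ hm => prefix_flatMap hm g⟩

theorem Cofinal.pre_flatMap {L K : ℕ → List A} (h : Cofinal (pre L) (pre K)) (g : A → List B) :
    Cofinal (pre fun i => (L i).flatMap g) (pre fun i => (K i).flatMap g) := by
  have := h.flatMap g
  simpa only [← ParamSys.pre_flatMap] using this

theorem Cofinal.lim {E F : ℕ → List B} (h : Cofinal E F) {v : Word B} (hv : Lim E v) :
    Lim F v := by
  intro k b
  rw [hv k b]
  constructor
  · rintro ⟨n, hn⟩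
    obtain ⟨m, hm⟩ := h.1 n
    exact ⟨m, getElem?_of_prefix hm hn⟩
  · rintro ⟨n, hn⟩
    obtain ⟨m, hm⟩ := h.2 n
    exact ⟨m, getElem?_of_prefix hm hn⟩

/-- Cofinal chains are both bounded or both unbounded. -/
theorem Cofinal.unbounded {E F : ℕ → List B} (h : Cofinal E F)
    (hE : ∀ N, ∃ n, N ≤ (E n).length) : ∀ N, ∃ n, N ≤ (F n).length := by
  intro N
  obtain ⟨n, hn⟩ := hE N
  obtain ⟨m, hm⟩ := h.1 n
  exact ⟨m, hn.trans hm.length_le⟩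

theorem Word.take_succ' (w : Word A) (n : ℕ) : w.take (n + 1) = w.take n ++ (w.get? n).toList := by
  cases w with
  | fin l => simp [Word.take, Word.get?, List.take_add_one]
  | inf f => simp [Word.take, Word.get?, List.range_succ]

theorem Word.length_take_le (w : Word A) (n : ℕ) : (w.take n).length ≤ n := by
  cases w <;> simp [Word.take]

theorem Word.length_take_of_get? {w : Word A} {n : ℕ} {a : A} (h : w.get? n = some a) :
    (w.take n).length = n := by
  cases w with
  | fin l =>
    have : n < l.length := by
      simp only [Word.get?] at h
      exact (List.getElem?_eq_some_iff.mp h).1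
    simp only [Word.take, List.length_take]; omega
  | inf f => simp [Word.take]

theorem Word.getElem?_take (w : Word A) (n k : ℕ) (h : k < n) : (w.take n)[k]? = w.get? k := by
  cases w with
  | fin l => simp [Word.take, Word.get?, h]
  | inf f => simp [Word.take, Word.get?, h]

theorem Word.get?_eq_none_mono {w : Word A} {i j : ℕ} (h : i ≤ j) (hi : w.get? i = none) :
    w.get? j = none := by
  cases w with
  | fin l => simp only [Word.get?, List.getElem?_eq_none_iff] at hi ⊢; omega
  | inf f => simp [Word.get?] at hi

/-- The prefixes of a limit are cofinal with any increasing chain that it is the limit of. -/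
theorem Lim.cofinal {E : ℕ → List A} {u : Word A} (hE : ∀ {n k}, n ≤ k → E n <+: E k)
    (h : Lim E u) : Cofinal E u.take := by
  refine ⟨fun n => ⟨(E n).length, ?_⟩, fun n => ?_⟩
  · rw [List.prefix_iff_getElem?]
    intro i hi
    rw [Word.getElem?_take u _ i hi, h i]
    exact ⟨n, List.getElem?_eq_getElem hi⟩
  · rcases Nat.eq_zero_or_pos (u.take n).length with h0 | h0
    · exact ⟨0, by rw [List.length_eq_zero_iff.mp h0]; exact List.nil_prefix⟩
    · set p := (u.take n).length - 1 with hp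
      have hpn : p < n := by have := u.length_take_le n; omega
      have hlast : (u.take n)[p]? = some ((u.take n)[p]'(by omega)) :=
        List.getElem?_eq_getElem (by omega)
      rw [Word.getElem?_take u n p hpn, h] at hlast
      obtain ⟨m, hm⟩ := hlast
      have hlen : p < (E m).length := (List.getElem?_eq_some_iff.mp hm).1
      refine ⟨m, ?_⟩
      rw [List.prefix_iff_getElem?]
      intro i hi
      have hi' : (u.take n)[i]? = some ((u.take n)[i]) := List.getElem?_eq_getElem hi
      have hu := u.length_take_le n
      rw [Word.getElem?_take u n i (by omega), h] at hi'
      obtain ⟨k, hk⟩ := hi'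
      rcases le_total k m with hkm | hkm
      · exact getElem?_of_prefix (hE hkm) hk
      · obtain ⟨t, ht⟩ := hE hkm
        rw [← ht, List.getElem?_append_left (by omega)] at hk
        exact hk

/-- Every increasing chain of lists has a limit. -/
theorem exists_lim (L : ℕ → List B) : ∃ v, Lim (pre L) v := by
  classical
  by_cases hb : ∃ N, ∀ n, N ≤ n → L n = []
  · obtain ⟨N, hN⟩ := hb
    refine ⟨.fin (pre L N), fun k b => ⟨fun h => ⟨N, h⟩, ?_⟩⟩
    rintro ⟨n, hn⟩
    rcases le_total n N with h | h
    · exact getElem?_of_prefix (pre_prefix L h) hn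
    · rwa [pre_eq_of_forall_nil h fun i hi _ => hN i hi] at hn
  · push Not at hb
    have hunb : ∀ k, ∃ n, k < (pre L n).length := by
      intro k
      induction k with
      | zero =>
        obtain ⟨n, _, hn⟩ := hb 0
        refine ⟨n + 1, ?_⟩
        rw [pre_succ, List.length_append]
        have := List.length_pos_iff.mpr hn
        omega
      | succ k ih =>
        obtain ⟨m, hm⟩ := ih
        obtain ⟨n, hmn, hn⟩ := hb m
        refine ⟨n + 1, ?_⟩
        rw [pre_succ, List.length_append]
        have := List.length_pos_iff.mpr hn
        have := (pre_prefix L hmn).length_le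
        omega
    choose m hm using hunb
    refine ⟨.inf fun k => (pre L (m k))[k]'(hm k), fun k b => ?_⟩
    have h1 : (pre L (m k))[k]? = some ((pre L (m k))[k]'(hm k)) := List.getElem?_eq_getElem _
    simp only [Word.get?, ← h1]
    refine ⟨fun h => ⟨_, h⟩, ?_⟩
    rintro ⟨n, hn⟩
    rcases le_total n (m k) with h | h
    · exact getElem?_of_prefix (pre_prefix L h) hn
    · rw [← hn]
      exact (h1.trans (getElem?_of_prefix (pre_prefix L h) h1).symm)

theorem zipIdx_flatMap_take_succ (h : ℕ → A → List B) (w : Word A) (n : ℕ) :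
    ((w.take (n + 1)).zipIdx.flatMap fun p => h p.2 p.1) =
      ((w.take n).zipIdx.flatMap fun p => h p.2 p.1) ++ (w.get? n).elim [] (h n) := by
  rw [Word.take_succ', List.zipIdx_append, List.flatMap_append]
  congr 1
  cases hg : w.get? n with
  | none => simp
  | some a => simp [Word.length_take_of_get? hg]

theorem isConcat_iff (h : ℕ → A → List B) (w : Word A) (v : Word B) :
    Word.IsConcat h w v ↔ Lim (pre fun i => (w.get? i).elim [] (h i)) v := by
  have : (fun n => (w.take n).zipIdx.flatMap fun p => h p.2 p.1) =
      pre fun i => (w.get? i).elim [] (h i) := by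
    funext n
    induction n with
    | zero => cases w <;> simp [Word.take]
    | succ n ih => rw [zipIdx_flatMap_take_succ, ih, pre_succ]
  rw [← this]
  rfl

theorem pre_elim_eq (w : Word A) (g : A → List B) (n : ℕ) :
    (pre fun i => (w.get? i).elim [] g) n = (w.take n).flatMap g := by
  induction n with
  | zero => cases w <;> simp [Word.take]
  | succ n ih => rw [pre_succ, ih, Word.take_succ']; cases w.get? n <;> simp

/-- Concatenation along a limit, with images that do not depend on the position. -/
theorem isConcat_iff_of_lim {L : ℕ → List A} {u : Word A} (hu : Lim (pre L) u)
    (g : A → List B) (v : Word B) :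
    Word.IsConcat (fun _ => g) u v ↔ Lim (pre fun i => (L i).flatMap g) v := by
  rw [isConcat_iff]
  have hc : Cofinal (pre fun i => (u.get? i).elim [] g) (pre fun i => (L i).flatMap g) := by
    have := (hu.cofinal (pre_prefix L)).symm.flatMap g
    simpa only [← pre_flatMap, ← pre_elim_eq] using this
  exact ⟨hc.lim, hc.symm.lim⟩

theorem Lim.mem_of_get? {L : ℕ → List B} {v : Word B} (h : Lim (pre L) v) {k : ℕ} {b : B}
    (hk : v.get? k = some b) : ∃ i, b ∈ L i := by
  obtain ⟨n, hn⟩ := (h k b).mp hk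
  have := List.mem_of_getElem? hn
  simp only [pre, List.mem_flatMap] at this
  obtain ⟨i, _, hi⟩ := this
  exact ⟨i, hi⟩

theorem Lim.get?_of_mem {L : ℕ → List B} {v : Word B} (h : Lim (pre L) v) {i : ℕ} {b : B}
    (hi : b ∈ L i) : ∃ k, v.get? k = some b := by
  have : b ∈ pre L (i + 1) := by
    rw [pre_succ]; exact List.mem_append_right _ hi
  obtain ⟨k, hk⟩ := List.mem_iff_getElem?.mp this
  exact ⟨k, (h k b).mpr ⟨_, hk⟩⟩

/-- The limit of a chain is infinite exactly if infinitely many pieces are nonempty. -/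
theorem Lim.infinite_iff {L : ℕ → List B} {v : Word B} (h : Lim (pre L) v) :
    (∃ f, v = .inf f) ↔ ∀ N, ∃ i, N ≤ i ∧ L i ≠ [] := by
  constructor
  · rintro ⟨f, rfl⟩ N
    by_contra! hcon
    obtain ⟨n, hn⟩ := (h (pre L N).length (f (pre L N).length)).mp rfl
    have hlt := (List.getElem?_eq_some_iff.mp hn).1
    rcases le_total n N with h1 | h1
    · have := (pre_prefix L h1).length_le; omega
    · rw [pre_eq_of_forall_nil h1 fun i hi _ => hcon i hi] at hlt
      omega
  · intro hinf
    cases v with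
    | inf f => exact ⟨f, rfl⟩
    | fin l =>
      exfalso
      have hb : ∀ n, (pre L n).length ≤ l.length := by
        intro n
        by_contra! hn
        have := (h l.length ((pre L n)[l.length])).mpr ⟨n, List.getElem?_eq_getElem hn⟩
        simp [Word.get?] at this
      have hu : ∀ N, ∃ n, N ≤ (pre L n).length := by
        intro N
        induction N with
        | zero => exact ⟨0, Nat.zero_le _⟩
        | succ N ih =>
          obtain ⟨n, hn⟩ := ih
          obtain ⟨i, hi, hne⟩ := hinf n
          refine ⟨i + 1, ?_⟩
          rw [pre_succ, List.length_append]
          have := (pre_prefix L hi).length_le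
          have := List.length_pos_iff.mpr hne
          omega
      obtain ⟨n, hn⟩ := hu (l.length + 1)
      have := hb n
      omega

end Lim

/-! ### Runs -/

/-- Dependent choice along the natural numbers, for an invariant `I` and a relation `R` between
consecutive elements. -/
theorem exists_seq {G : Type*} (I : ℕ → G → Prop) (R : ℕ → G → G → Prop) {g₀ : G} (h0 : I 0 g₀)
    (h : ∀ i g, I i g → ∃ g', I (i + 1) g' ∧ R i g g') :
    ∃ s : ℕ → G, s 0 = g₀ ∧ ∀ i, I i (s i) ∧ R i (s i) (s (i + 1)) := by
  choose f hf using h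
  let s : (i : ℕ) → { g // I i g } := fun i =>
    Nat.rec ⟨g₀, h0⟩ (fun i g => ⟨f i g.1 g.2, (hf i g.1 g.2).1⟩) i
  exact ⟨fun i => (s i).1, rfl, fun i => ⟨(s i).2, (hf i (s i).1 (s i).2).2⟩⟩

section Run

variable {X : Type*} {A : Type*}

/-- There is no step from `x`. -/
def Dead (step : X → A → X → Prop) (x : X) : Prop := ∀ a y, ¬ step x a y

/-- Maximal runs, uniformly for finite and infinite ones: a run that reaches a configuration without
outgoing steps stays there forever, with label `none`. -/
def Run (step : X → A → X → Prop) (γ : ℕ → X) (lab : ℕ → Option A) : Prop :=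
  ∀ i, (∃ a, lab i = some a ∧ step (γ i) a (γ (i + 1))) ∨
    (lab i = none ∧ γ (i + 1) = γ i ∧ Dead step (γ i))

/-- Finite paths with their lists of labels. -/
inductive Path (step : X → A → X → Prop) : X → List A → X → Prop
  | nil (x : X) : Path step x [] x
  | cons {x y z : X} {a : A} {l : List A} : step x a y → Path step y l z → Path step x (a :: l) z

theorem Path.eq_of_nil {step : X → A → X → Prop} {x y : X} (h : Path step x [] y) : x = y := by
  cases h; rfl

theorem Path.single {step : X → A → X → Prop} {x y : X} {a : A} (h : step x a y) :
    Path step x [a] y := .cons h (.nil _)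

/-- Silent positions can be removed from a run if what remains is maximal. -/
theorem exists_run_of_stuttering (step : X → A → X → Prop) (y : ℕ → X) (ℓ : ℕ → Option A)
    (h : ∀ i, (∃ a, ℓ i = some a ∧ step (y i) a (y (i + 1))) ∨ (ℓ i = none ∧ y (i + 1) = y i))
    (hmax : (∀ N, ∃ n, N ≤ (pre (fun i => (ℓ i).toList) n).length) ∨ ∃ n, Dead step (y n)) :
    ∃ γ lab, γ 0 = y 0 ∧ Run step γ lab ∧
      Cofinal (pre fun i => (ℓ i).toList) (pre fun i => (lab i).toList) := by
  classical
  have hconst : ∀ i j, i ≤ j → (∀ k, i ≤ k → k < j → ℓ k = none) → y j = y i := by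
    intro i j hij
    induction j, hij using Nat.le_induction with
    | base => intro _; rfl
    | succ j hj ih =>
      intro hn
      rcases h j with ⟨a, ha, _⟩ | ⟨_, h2⟩
      · rw [hn j hj (by omega)] at ha; cases ha
      · rw [h2]; exact ih fun k h1 h2 => hn k h1 (by omega)
  -- `σ i` is the first position from `i` on that is not silent
  have hσ : ∀ i, ∃ j, i ≤ j ∧ (∀ k, i ≤ k → k < j → ℓ k = none) ∧
      (ℓ j ≠ none ∨ ∀ k, j ≤ k → ℓ k = none) := by
    intro i
    by_cases hex : ∃ j, i ≤ j ∧ ℓ j ≠ none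
    · refine ⟨Nat.find hex, (Nat.find_spec hex).1, fun k h1 h2 => ?_, .inl (Nat.find_spec hex).2⟩
      have := Nat.find_min hex h2
      by_contra hk
      exact this ⟨h1, hk⟩
    · push Not at hex
      exact ⟨i, le_rfl, fun k h1 h2 => absurd h2 (by omega), .inr hex⟩
  choose σ h1 h2 h3 using hσ
  let p : ℕ → ℕ := fun k => Nat.rec (σ 0) (fun _ i => σ (i + 1)) k
  have hp0 : p 0 = σ 0 := rfl
  have hps : ∀ k, p (k + 1) = σ (p k + 1) := fun k => rfl
  have hp3 : ∀ k, ℓ (p k) ≠ none ∨ ∀ j, p k ≤ j → ℓ j = none := by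
    intro k; cases k with
    | zero => exact h3 0
    | succ k => exact h3 _
  have hpk : ∀ k, k ≤ p k := by
    intro k
    induction k with
    | zero => exact Nat.zero_le _
    | succ k ih => rw [hps]; have := h1 (p k + 1); omega
  have hpre : ∀ k, pre (fun i => (ℓ (p i)).toList) k = pre (fun i => (ℓ i).toList) (p k) := by
    intro k
    induction k with
    | zero =>
      rw [hp0, pre_eq_of_forall_nil (n := 0) (k := σ 0) (Nat.zero_le _), pre_zero, pre_zero]
      intro i hi hi'; simp [h2 0 i hi hi']
    | succ k ih =>
      rw [pre_succ, ih, hps, pre_eq_of_forall_nil (h1 (p k + 1)), pre_succ]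
      intro i hi hi'; simp [h2 _ i hi hi']
  have hstep : ∀ k, y (p (k + 1)) = y (p k + 1) := fun k => by
    rw [hps]; exact hconst _ _ (h1 _) (h2 _)
  refine ⟨fun k => y (p k), fun k => ℓ (p k), ?_, fun k => ?_, ?_, ?_⟩
  · exact hconst _ _ (Nat.zero_le _) (h2 0)
  · rcases h (p k) with ⟨a, ha, hs⟩ | ⟨hn, hs⟩
    · exact .inl ⟨a, ha, by beta_reduce; rw [hstep]; exact hs⟩
    · refine .inr ⟨hn, (hstep k).trans hs, ?_⟩
      have hall : ∀ j, p k ≤ j → ℓ j = none := (hp3 k).resolve_left (not_not.mpr hn)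
      rcases hmax with hu | ⟨N, hN⟩
      · exfalso
        obtain ⟨n, hn⟩ := hu ((pre (fun i => (ℓ i).toList) (p k)).length + 1)
        rcases le_total n (p k) with hle | hle
        · have := (pre_prefix (fun i => (ℓ i).toList) hle).length_le; omega
        · rw [pre_eq_of_forall_nil hle fun i hi _ => by simp [hall i hi]] at hn
          omega
      · have hdead : ∀ j, N ≤ j → ℓ j = none ∧ y j = y N := by
          intro j hj
          induction j, hj using Nat.le_induction with
          | base =>
            refine ⟨?_, rfl⟩
            rcases h N with ⟨a, _, hs⟩ | h
            · exact absurd hs (hN a _)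
            · exact h.1
          | succ j hj ih =>
            have hyj : y (j + 1) = y N := by
              rcases h j with ⟨a, ha, _⟩ | h
              · rw [ih.1] at ha; cases ha
              · rw [h.2, ih.2]
            refine ⟨?_, hyj⟩
            rcases h (j + 1) with ⟨a, _, hs⟩ | h
            · rw [hyj] at hs; exact absurd hs (hN a _)
            · exact h.1
        have : y (p k) = y N := by
          rcases le_total N (p k) with hle | hle
          · exact (hdead _ hle).2
          · exact (hconst _ _ hle fun j hj _ => hall j hj).symm
        beta_reduce; rw [this]; exact hN
  · intro n
    exact ⟨n, by rw [hpre]; exact pre_prefix _ (hpk n)⟩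
  · intro n
    exact ⟨p n, by rw [hpre]⟩

/-- Concatenating finite paths gives a maximal run, provided that there are infinitely many steps or
a configuration without outgoing steps is reached. -/
theorem exists_run_of_paths (step : X → A → X → Prop) (xs : ℕ → X) (ls : ℕ → List A)
    (h : ∀ i, Path step (xs i) (ls i) (xs (i + 1)))
    (hmax : (∀ N, ∃ n, N ≤ (pre ls n).length) ∨ ∃ n, Dead step (xs n)) :
    ∃ γ lab, γ 0 = xs 0 ∧ Run step γ lab ∧ Cofinal (pre ls) (pre fun i => (lab i).toList) := by
  -- the state of the traversal: the number of the current path, a point on it, what is left of it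
  obtain ⟨s, hs0, hs⟩ := exists_seq (G := ℕ × X × List A)
    (fun _ z => Path step z.2.1 z.2.2 (xs (z.1 + 1)))
    (fun _ z z' => (z.2.2 = [] ∧ z' = (z.1 + 1, z.2.1, ls (z.1 + 1))) ∨
      ∃ a, z.2.2 = a :: z'.2.2 ∧ z'.1 = z.1 ∧ step z.2.1 a z'.2.1)
    (g₀ := (0, xs 0, ls 0)) (h 0) (by
      rintro - ⟨i, x, l⟩ hz
      cases l with
      | nil =>
        refine ⟨(i + 1, x, ls (i + 1)), ?_, .inl ⟨rfl, rfl⟩⟩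
        have hx : x = xs (i + 1) := hz.eq_of_nil
        have := h (i + 1)
        rw [hx]
        exact this
      | cons a l =>
        cases hz with
        | cons h1 h2 => exact ⟨(i, _, l), h2, .inr ⟨a, rfl, rfl, h1⟩⟩)
  let ℓ : ℕ → Option A := fun k => (s k).2.2.head?
  have hinv : ∀ k, pre (fun i => (ℓ i).toList) k ++ (s k).2.2 = pre ls ((s k).1 + 1) := by
    intro k
    induction k with
    | zero => rw [hs0]; simp [pre]
    | succ k ih =>
      rcases (hs k).2 with ⟨h1, h2⟩ | ⟨a, h1, h2, _⟩
      · rw [pre_succ, h2]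
        simp only [ℓ]
        rw [h1] at ih ⊢
        simp only [List.append_nil] at ih
        simp only [List.head?_nil, Option.toList_none, List.append_nil]
        rw [ih, pre_succ ls ((s k).1 + 1)]
      · rw [pre_succ, h2, ← ih]
        simp only [ℓ]
        rw [h1]
        simp
  have hdrain : ∀ n k, (s k).1 = n → ∃ k', (s k').1 = n ∧ (s k').2.2 = [] := by
    intro n k
    induction hl : (s k).2.2.length generalizing k with
    | zero => intro hk; exact ⟨k, hk, List.length_eq_zero_iff.mp hl⟩
    | succ m ih =>
      intro hk
      rcases (hs k).2 with ⟨h1, _⟩ | ⟨a, h1, h2, _⟩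
      · rw [h1] at hl; cases hl
      · refine ih (k + 1) ?_ (h2.trans hk)
        rw [h1] at hl
        simpa using hl
  have hreach : ∀ n, ∃ k, (s k).1 = n ∧ (s k).2.2 = [] := by
    intro n
    induction n with
    | zero => exact hdrain 0 0 (by rw [hs0])
    | succ n ih =>
      obtain ⟨k, hk, hk'⟩ := ih
      rcases (hs k).2 with ⟨_, h2⟩ | ⟨a, h1, _⟩
      · exact hdrain (n + 1) (k + 1) (by rw [h2, hk])
      · rw [hk'] at h1; cases h1
  have hcof : Cofinal (pre ls) (pre fun i => (ℓ i).toList) := by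
    refine ⟨fun n => ?_, fun k => ⟨(s k).1 + 1, by rw [← hinv]; exact List.prefix_append _ _⟩⟩
    obtain ⟨k, hk, hk'⟩ := hreach n
    refine ⟨k, ?_⟩
    have := hinv k
    rw [hk', List.append_nil, hk] at this
    rw [this]
    exact pre_prefix _ (Nat.le_succ n)
  obtain ⟨γ, lab, h0, hrun, hc⟩ := exists_run_of_stuttering step (fun k => (s k).2.1) ℓ (by
      intro k
      rcases (hs k).2 with ⟨h1, h2⟩ | ⟨a, h1, _, h3⟩
      · exact .inr ⟨by simp [ℓ, h1], by rw [h2]⟩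
      · exact .inl ⟨a, by simp [ℓ, h1], h3⟩) (by
      rcases hmax with hu | ⟨n, hn⟩
      · exact .inl (hcof.unbounded hu)
      · right
        cases n with
        | zero => exact ⟨0, by rw [hs0]; exact hn⟩
        | succ n =>
          obtain ⟨k, hk, hk'⟩ := hreach n
          have hP := (hs k).1
          rw [hk', hk] at hP
          refine ⟨k, ?_⟩
          have hx : (s k).2.1 = xs (n + 1) := hP.eq_of_nil
          show Dead step (s k).2.1
          rw [hx]
          exact hn)
  exact ⟨γ, lab, by rw [h0, hs0], hrun, hcof.trans hc⟩

end Run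

/-! ### Maximal traces in terms of runs -/

section Traces

variable {m : ℕ} {V : Type*} {S : Type*} {T : Type*} {B : Type*}

theorem Run.none_mono {X A : Type*} {step : X → A → X → Prop} {γ : ℕ → X} {lab : ℕ → Option A}
    (h : Run step γ lab) {i j : ℕ} (hij : i ≤ j) (hi : lab i = none) :
    lab j = none ∧ γ j = γ i := by
  induction j, hij using Nat.le_induction with
  | base => exact ⟨hi, rfl⟩
  | succ j _ ih =>
    have hd : Dead step (γ j) ∧ γ (j + 1) = γ j := by
      rcases h j with ⟨a, ha, _⟩ | ⟨_, h1, h2⟩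
      · rw [ih.1] at ha; cases ha
      · exact ⟨h2, h1⟩
    refine ⟨?_, hd.2.trans ih.2⟩
    rcases h (j + 1) with ⟨a, _, hs⟩ | ⟨h1, _⟩
    · rw [hd.2] at hs; exact absurd hs (hd.1 _ _)
    · exact h1

/-- Labels of maximal initial runs, finite or infinite, are the label sequences of the infinite
sequences of `Run`. -/
theorem exists_isMaximalRunLabel_iff (sys : CDSystem m V S T)
    (Q : (ℕ → Option (Option (Act m V))) → Prop) :
    (∃ w, sys.IsMaximalRunLabel w ∧ Q w.get?) ↔
      ∃ n γ lab, γ 0 = sys.initConfig n ∧ Run sys.Step γ lab ∧ Q lab := by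
  constructor
  · rintro ⟨w, ⟨n, γ, h0, hstep, hdead⟩, hQ⟩
    cases w with
    | inf f =>
      exact ⟨n, γ, _, h0, fun i => .inl ⟨f i, rfl, hstep i _ rfl⟩, hQ⟩
    | fin l =>
      refine ⟨n, fun i => γ (min i l.length), _, by simpa using h0, fun i => ?_, hQ⟩
      rcases lt_or_ge i l.length with hi | hi
      · have hg : (Word.fin l).get? i = some l[i] := List.getElem?_eq_getElem hi
        refine .inl ⟨l[i], hg, ?_⟩
        have := hstep i _ hg
        beta_reduce
        rwa [min_eq_left hi.le, min_eq_left (by omega)]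
      · refine .inr ⟨List.getElem?_eq_none hi, ?_, ?_⟩
        · show γ _ = γ _
          rw [min_eq_right hi, min_eq_right (by omega)]
        · intro a c
          beta_reduce
          rw [min_eq_right hi]
          exact hdead l rfl a c
  · rintro ⟨n, γ, lab, h0, hrun, hQ⟩
    by_cases hex : ∃ N, lab N = none
    · classical
      have hN := Nat.find_spec hex
      have hlt : ∀ i, i < Nat.find hex → ∃ a, lab i = some a := fun i hi =>
        Option.ne_none_iff_exists'.mp (Nat.find_min hex hi)
      set N := Nat.find hex
      have hget : ((List.range N).map lab).reduceOption.length = N ∧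
          (Word.fin ((List.range N).map lab).reduceOption).get? = lab := by
        have key : ∀ k, k ≤ N → ((List.range k).map lab).reduceOption.length = k ∧
            ∀ i, i < k → ((List.range k).map lab).reduceOption[i]? = lab i := by
          intro k
          induction k with
          | zero => intro _; exact ⟨rfl, fun i hi => absurd hi (by omega)⟩
          | succ k ih =>
            intro hk
            obtain ⟨hl, hi⟩ := ih (by omega)
            obtain ⟨a, ha⟩ := hlt k (by omega)
            have : ((List.range (k + 1)).map lab).reduceOption =
                ((List.range k).map lab).reduceOption ++ [a] := by
              rw [List.range_succ, List.map_append, List.reduceOption_append]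
              simp [ha, List.reduceOption]
            rw [this]
            refine ⟨by simp [hl], fun i hik => ?_⟩
            rcases lt_or_eq_of_le (Nat.lt_succ_iff.mp hik) with h | h
            · rw [List.getElem?_append_left (by omega), hi i h]
            · subst h
              rw [List.getElem?_append_right (by omega), hl, ha]
              simp
        obtain ⟨hl, hi⟩ := key N le_rfl
        refine ⟨hl, funext fun i => ?_⟩
        rcases lt_or_ge i N with h | h
        · exact hi i h
        · rw [(hrun.none_mono h hN).1]
          exact List.getElem?_eq_none (by omega)
      refine ⟨_, ⟨n, γ, h0, fun i a hi => ?_, fun l hl a c => ?_⟩, by rw [hget.2]; exact hQ⟩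
      · rw [hget.2] at hi
        rcases hrun i with ⟨b, hb, hs⟩ | ⟨hn, _⟩
        · rw [hi] at hb; cases hb; exact hs
        · rw [hi] at hn; cases hn
      · cases hl
        rw [hget.1]
        rcases hrun N with ⟨b, hb, _⟩ | ⟨_, _, hd⟩
        · rw [hN] at hb; cases hb
        · exact hd a c
    · push Not at hex
      choose f hf using fun i => Option.ne_none_iff_exists'.mp (hex i)
      have hget : (Word.inf f).get? = lab := funext fun i => (hf i).symm
      refine ⟨.inf f, ⟨n, γ, h0, fun i a hi => ?_, fun l hl => by cases hl⟩,
        by rw [hget]; exact hQ⟩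
      rw [hget] at hi
      rcases hrun i with ⟨b, hb, hs⟩ | ⟨hn, _⟩
      · rw [hi] at hb; cases hb; exact hs
      · rw [hi] at hn; cases hn

/-- The letters of a label: the action, unless the label is silent. -/
def letters (o : Option (Option (Act m V))) : List (Act m V) := o.toList.flatMap Option.toList

/-- The letters of a label that belong to the leader. -/
def leaderLetters (o : Option (Option (Act m V))) : List (RegOp m V) :=
  o.toList.flatMap fun a => a.toList.flatMap fun x => x.getRight?.toList

theorem hasMaximalTraceIn_iff (sys : CDSystem m V S T) (P : Set (Word (Act m V))) :
    sys.HasMaximalTraceIn P ↔ ∃ n γ lab, γ 0 = sys.initConfig n ∧ Run sys.Step γ lab ∧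
      ∃ u ∈ P, Lim (pre fun i => letters (lab i)) u := by
  rw [← exists_isMaximalRunLabel_iff sys
    (fun lab => ∃ u ∈ P, Lim (pre fun i => letters (lab i)) u)]
  have hc : ∀ (w : Word (Option (Act m V))) u, Word.IsConcat (fun _ a => a.toList) w u ↔
      Lim (pre fun i => letters (w.get? i)) u := by
    intro w u
    rw [isConcat_iff]
    have : (fun i => (w.get? i).elim [] fun a => a.toList) = fun i => letters (w.get? i) := by
      funext i; cases w.get? i <;> simp [letters]
    rw [this]
  constructor
  · rintro ⟨u, ⟨w, hw, hwu⟩, hu⟩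
    exact ⟨w, hw, u, hu, (hc w u).mp hwu⟩
  · rintro ⟨w, hw, u, hu, hwu⟩
    exact ⟨u, ⟨w, hw, (hc w u).mpr hwu⟩, hu⟩

theorem hasMaximalTraceWithLeaderProjIn_iff (sys : CDSystem m V S T) (P : Set (Word (RegOp m V))) :
    sys.HasMaximalTraceWithLeaderProjIn P ↔
      ∃ n γ lab, γ 0 = sys.initConfig n ∧ Run sys.Step γ lab ∧
        ∃ v ∈ P, Lim (pre fun i => leaderLetters (lab i)) v := by
  have h1 : sys.HasMaximalTraceWithLeaderProjIn P ↔
      sys.HasMaximalTraceIn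
        { u | ∃ v, Word.IsConcat (fun _ a => a.getRight?.toList) u v ∧ v ∈ P } :=
    Iff.rfl
  rw [h1, hasMaximalTraceIn_iff]
  have h2 : ∀ lab : ℕ → Option (Option (Act m V)),
      (fun i => (letters (lab i)).flatMap fun a => a.getRight?.toList) =
        fun i => leaderLetters (lab i) := by
    intro lab; funext i
    simp only [letters, leaderLetters, List.flatMap_assoc]
  constructor
  · rintro ⟨n, γ, lab, h0, hr, u, ⟨v, huv, hv⟩, hu⟩
    rw [isConcat_iff_of_lim hu, h2] at huv
    exact ⟨n, γ, lab, h0, hr, v, hv, huv⟩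
  · rintro ⟨n, γ, lab, h0, hr, v, hv, hlim⟩
    obtain ⟨u, hu⟩ := exists_lim fun i => letters (lab i)
    refine ⟨n, γ, lab, h0, hr, u, ⟨v, ?_, hv⟩, hu⟩
    rw [isConcat_iff_of_lim hu, h2]
    exact hlim

end Traces
end ParamSys

namespace ParamSys

/-! ### Repeated contributor actions -/

section Expansion

variable {m : ℕ} {V : Type*}

/-- If `L` arises from `D` by inserting, at some places, another copy of the last letter before that
place, which has to be a contributor action, and if only finitely many copies follow the last letter
of `D`, then an expanding property that holds for the limit of `D` holds for the limit of `L`. -/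
theorem CExpanding.mem_of_copies {P : Set (Word (Act m V))} (hP : CExpanding P)
    {D L : ℕ → List (Act m V)}
    (h : ∀ i, (D i = [] ∧ L i = []) ∨ (∃ x, D i = [x] ∧ L i = [x]) ∨
      ∃ a, D i = [] ∧ L i = [.inl a] ∧ (pre D i).getLast? = some (.inl a))
    (hfin : ∀ N, (∀ i, N ≤ i → D i = []) → ∃ M, ∀ i, M ≤ i → L i = [])
    {d u : Word (Act m V)} (hd : Lim (pre D) d) (hdP : d ∈ P) (hu : Lim (pre L) u) : u ∈ P := by
  classical
  have hinit : ∀ i, pre D i = [] → pre L i = [] := by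
    intro i
    induction i with
    | zero => intro _; rfl
    | succ i ih =>
      intro hi
      rw [pre_succ, List.append_eq_nil_iff] at hi
      rw [pre_succ, ih hi.1]
      rcases h i with ⟨_, h2⟩ | ⟨x, h1, _⟩ | ⟨a, _, _, h3⟩
      · rw [h2]; rfl
      · rw [h1] at hi; cases hi.2
      · rw [hi.1] at h3; cases h3
  have hblock : ∀ i x, D i = [x] → ∀ j, i < j → (∀ k, i < k → k < j → D k = []) →
      pre D j = pre D i ++ [x] ∧ ∃ c, 0 < c ∧ (x.isLeft = false → c = 1) ∧
        pre L j = pre L i ++ List.replicate c x := by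
    intro i x hx j hij
    induction j, hij using Nat.le_induction with
    | base =>
      intro _
      refine ⟨by rw [pre_succ, hx], 1, Nat.one_pos, fun _ => rfl, ?_⟩
      rw [pre_succ]
      rcases h i with ⟨h1, _⟩ | ⟨y, h1, h2⟩ | ⟨a, h1, _⟩
      · rw [h1] at hx; cases hx
      · rw [hx] at h1; cases h1; rw [h2]; rfl
      · rw [h1] at hx; cases hx
    | succ j hj ih =>
      intro hD
      obtain ⟨h1, c, hc, hc1, h2⟩ := ih fun k hk hk' => hD k hk (by omega)
      have hDj := hD j hj (by omega)
      refine ⟨by rw [pre_succ, hDj, h1, List.append_nil], ?_⟩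
      rcases h j with ⟨_, hL⟩ | ⟨y, hy, _⟩ | ⟨a, _, hL, hlast⟩
      · exact ⟨c, hc, hc1, by rw [pre_succ, hL, h2, List.append_nil]⟩
      · rw [hDj] at hy; cases hy
      · rw [h1] at hlast
        simp only [List.getLast?_append, List.getLast?_singleton, Option.some_or,
          Option.some.injEq] at hlast
        subst hlast
        refine ⟨c + 1, by omega, fun hf => by simp at hf, ?_⟩
        rw [pre_succ, hL, h2, List.append_assoc, List.replicate_succ']
  -- `Fin i`: nothing happens from position `i` on
  let Fin : ℕ → Prop := fun i => ∀ j, i ≤ j → D j = [] ∧ L j = []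
  have hnext : ∀ i, ∃ j, i ≤ j ∧ (∀ k, i ≤ k → k < j → D k = []) ∧ (D j ≠ [] ∨ Fin j) := by
    intro i
    by_cases hex : ∃ j, i ≤ j ∧ D j ≠ []
    · refine ⟨Nat.find hex, (Nat.find_spec hex).1, fun k h1 h2 => ?_, .inl (Nat.find_spec hex).2⟩
      have := Nat.find_min hex h2
      by_contra hk
      exact this ⟨h1, hk⟩
    · push Not at hex
      obtain ⟨M, hM⟩ := hfin i hex
      exact ⟨max i M, le_max_left _ _, fun k hk _ => hex k hk,
        .inr fun j hj => ⟨hex j ((le_max_left _ _).trans hj), hM j ((le_max_right _ _).trans hj)⟩⟩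
  have hsing : ∀ i, D i ≠ [] → ∃ x, D i = [x] := by
    intro i hi
    rcases h i with ⟨h1, _⟩ | ⟨y, h1, _⟩ | ⟨a, h1, _⟩
    · exact absurd h1 hi
    · exact ⟨y, h1⟩
    · exact absurd h1 hi
  obtain ⟨i₀, _, hi₀, hi₀'⟩ := hnext 0
  have hD₀ : pre D i₀ = [] := pre_eq_of_forall_nil (n := 0) (Nat.zero_le _) hi₀
  -- `s k` is the position of the `k`-th letter of `d`
  obtain ⟨s, hs0, hs⟩ := exists_seq (G := ℕ)
    (fun k i => (D i ≠ [] ∧ (pre D i).length = k ∧ k ≤ i) ∨ (Fin i ∧ (pre D i).length ≤ k))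
    (fun k i i' => (∃ x c, D i = [x] ∧ 0 < c ∧ (x.isLeft = false → c = 1) ∧
        pre L i' = pre L i ++ List.replicate c x) ∨ (Fin i ∧ i' = i))
    (g₀ := i₀) (by
      rcases hi₀' with h1 | h1
      · exact .inl ⟨h1, by rw [hD₀]; rfl, Nat.zero_le _⟩
      · exact .inr ⟨h1, by rw [hD₀]; rfl⟩) (by
      rintro k i (⟨h1, h2, h3⟩ | ⟨h1, h2⟩)
      · obtain ⟨x, hx⟩ := hsing i h1
        obtain ⟨j, hj, hj1, hj2⟩ := hnext (i + 1)
        obtain ⟨hb1, c, hc, hc1, hb2⟩ := hblock i x hx j hj hj1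
        have hlen : (pre D j).length = k + 1 := by rw [hb1]; simp [h2]
        refine ⟨j, ?_, .inl ⟨x, c, hx, hc, hc1, hb2⟩⟩
        rcases hj2 with h4 | h4
        · exact .inl ⟨h4, hlen, by omega⟩
        · exact .inr ⟨h4, hlen.le⟩
      · exact ⟨i, .inr ⟨h1, by omega⟩, .inr ⟨h1, rfl⟩⟩)
  have hget : ∀ k, (D (s k)).head? = d.get? k := by
    intro k
    rcases (hs k).1 with ⟨h1, h2, h3⟩ | ⟨h1, h2⟩
    · obtain ⟨x, hx⟩ := hsing _ h1
      have : d.get? k = some x := by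
        rw [hd k x]
        refine ⟨s k + 1, ?_⟩
        rw [pre_succ, hx, List.getElem?_append_right (by omega), h2]
        simp
      rw [this, hx]; rfl
    · rw [(h1 _ le_rfl).1]
      symm
      rw [List.head?_nil]
      by_contra hne
      obtain ⟨x, hx⟩ := Option.ne_none_iff_exists'.mp hne
      obtain ⟨n, hn⟩ := (hd k x).mp hx
      have hlt := (List.getElem?_eq_some_iff.mp hn).1
      rcases le_total n (s k) with hle | hle
      · have := (pre_prefix D hle).length_le; omega
      · rw [pre_eq_of_forall_nil hle fun i hi _ => (h1 i hi).1] at hlt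
        omega
  have hf : ∀ k, ∃ c, 0 < c ∧ pre L (s (k + 1)) = pre L (s k) ++
      (d.get? k).elim [] fun x => List.replicate (if x.isLeft then c else 1) x := by
    intro k
    rcases (hs k).2 with ⟨x, c, hx, hc, hc1, hL⟩ | ⟨h1, h2⟩
    · refine ⟨c, hc, ?_⟩
      rw [← hget, hx, hL]
      cases hxl : x.isLeft with
      | true => simp [hxl]
      | false => simp [hc1 hxl]
    · refine ⟨1, Nat.one_pos, ?_⟩
      rw [← hget, h2, (h1 _ le_rfl).1]
      simp
  choose f hf0 hf1 using hf
  refine hP d hdP f hf0 u ?_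
  rw [isConcat_iff]
  refine Cofinal.lim (E := pre L) ?_ hu
  have hE : ∀ k, pre (fun i => (d.get? i).elim [] fun x =>
      List.replicate (if x.isLeft then f i else 1) x) k = pre L (s k) := by
    intro k
    induction k with
    | zero => rw [hs0, hinit _ hD₀]; rfl
    | succ k ih => rw [pre_succ, ih, hf1]
  refine ⟨fun n => ⟨n, ?_⟩, fun n => ⟨s n, by rw [hE]⟩⟩
  rw [hE]
  rcases (hs n).1 with ⟨_, _, h3⟩ | ⟨h1, _⟩
  · exact pre_prefix L h3
  · rcases le_total n (s n) with hle | hle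
    · exact pre_prefix L hle
    · rw [pre_eq_of_forall_nil hle fun i hi _ => (h1 i hi).2]

end Expansion
end ParamSys

namespace ParamSys

/-! ### The system with one register -/

/-- The contents of the single register. A contributor writes `req a` to ask for permission to
perform `a`, the leader answers `ack a`; `exec b` records that the leader has performed `b`;
`halt ρ` claims that a deadlock with register contents `ρ` is reached; `bad` refutes this claim. -/
inductive Msg (m : ℕ) (V : Type*) where
  | init : Msg m V
  | req (a : RegOp m V) : Msg m V
  | ack (a : RegOp m V) : Msg m V
  | exec (a : RegOp m V) : Msg m V
  | halt (ρ : Fin m → V) : Msg m V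
  | bad : Msg m V

/-- States of the simulating contributors: `nrm s` is in state `s` and has no request open;
`wait s a s'` has asked for permission to move from `s` to `s'` by `a`; `chk s ρ` has seen the claim
`halt ρ` and has some transition, which refutes the claim if the contents `ρ` permit it; `err s` was
waiting when it saw such a claim; `sink s` has refuted a claim. -/
inductive CState (m : ℕ) (V : Type*) (S : Type*) where
  | nrm (s : S) : CState m V S
  | wait (s : S) (a : RegOp m V) (s' : S) : CState m V S
  | chk (s : S) (ρ : Fin m → V) : CState m V S
  | err (s : S) : CState m V S
  | sink (s : S) : CState m V S

/-- States of the simulating leader, which knows the contents `ρ` of the original registers.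
`ackp t ρ a` is about to answer the request `a`; `ended t ρ` has written `halt ρ`; `loud t ρ` has
learned that this was wrong, by a transition of its own or from the register; `sink t ρ` has put the
letter `bad` into its own trace. Only the latter is excluded by the property of the traces. -/
inductive LState (m : ℕ) (V : Type*) (T : Type*) where
  | boot : LState m V T
  | run (t : T) (ρ : Fin m → V) : LState m V T
  | ackp (t : T) (ρ : Fin m → V) (a : RegOp m V) : LState m V T
  | ended (t : T) (ρ : Fin m → V) : LState m V T
  | loud (t : T) (ρ : Fin m → V) : LState m V T
  | sink (t : T) (ρ : Fin m → V) : LState m V T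

section OneReg

variable {m : ℕ} {V V' S T : Type*}

/-- Reading the message `x`, where `ι` encodes messages as values. -/
abbrev rd (ι : Msg m V → V') (x : Msg m V) : RegOp 1 V' := .read 0 (ι x)

/-- Writing the message `x`, where `ι` encodes messages as values. -/
abbrev wr (ι : Msg m V → V') (x : Msg m V) : RegOp 1 V' := .write 0 (ι x)

/-- The transitions of the simulating contributors. An answer of the leader is not addressed to
anyone: it may be read by any number of contributors waiting for it. In the rule `halt` the
transition from `s` need not be possible with the contents `ρ`; the rule `chk` tests this. -/
inductive CStep (ι : Msg m V → V') (C : TransSys (RegOp m V) S) :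
    CState m V S → Option (RegOp 1 V') → CState m V S → Prop
  | eps {s s' : S} : C.step s none s' → CStep ι C (.nrm s) none (.nrm s')
  | ask {s s' : S} {a : RegOp m V} : C.step s (some a) s' →
      CStep ι C (.nrm s) (some (wr ι (.req a))) (.wait s a s')
  | done {s s' : S} {a : RegOp m V} :
      CStep ι C (.wait s a s') (some (rd ι (.ack a))) (.nrm s')
  | waitHalt {s s' : S} {a : RegOp m V} {ρ : Fin m → V} :
      CStep ι C (.wait s a s') (some (rd ι (.halt ρ))) (.err s)
  | err {s : S} : CStep ι C (.err s) (some (wr ι .bad)) (.sink s)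
  | halt {s s' : S} {o : Option (RegOp m V)} {ρ : Fin m → V} : C.step s o s' →
      CStep ι C (.nrm s) (some (rd ι (.halt ρ))) (.chk s ρ)
  | chk {s s' : S} {o : Option (RegOp m V)} {ρ ρ' : Fin m → V} : C.step s o s' → RegStep o ρ ρ' →
      CStep ι C (.chk s ρ) (some (wr ι .bad)) (.sink s)

/-- The transitions of the simulating leader. It answers a request only if the requested action is
possible, and updates its copy of the registers with the answer. It may claim a deadlock at any
time; afterwards a move that it could have made, an open request or the message `bad` refutes the
claim. -/
inductive LStep (ι : Msg m V → V') (D : TransSys (RegOp m V) T) (ρ₀ : Fin m → V) :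
    LState m V T → Option (RegOp 1 V') → LState m V T → Prop
  | boot : LStep ι D ρ₀ .boot none (.run D.init ρ₀)
  | eps {t t' : T} {ρ : Fin m → V} : D.step t none t' →
      LStep ι D ρ₀ (.run t ρ) none (.run t' ρ)
  | exec {t t' : T} {b : RegOp m V} {ρ ρ' : Fin m → V} : D.step t (some b) t' →
      RegStep (some b) ρ ρ' → LStep ι D ρ₀ (.run t ρ) (some (wr ι (.exec b))) (.run t' ρ')
  | hear {t : T} {a : RegOp m V} {ρ ρ' : Fin m → V} : RegStep (some a) ρ ρ' →
      LStep ι D ρ₀ (.run t ρ) (some (rd ι (.req a))) (.ackp t ρ a)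
  | ack {t : T} {a : RegOp m V} {ρ ρ' : Fin m → V} : RegStep (some a) ρ ρ' →
      LStep ι D ρ₀ (.ackp t ρ a) (some (wr ι (.ack a))) (.run t ρ')
  | halt {t : T} {ρ : Fin m → V} :
      LStep ι D ρ₀ (.run t ρ) (some (wr ι (.halt ρ))) (.ended t ρ)
  | alive {t t' : T} {o : Option (RegOp m V)} {ρ ρ' : Fin m → V} : D.step t o t' →
      RegStep o ρ ρ' → LStep ι D ρ₀ (.ended t ρ) none (.loud t ρ)
  | hearReq {t : T} {a : RegOp m V} {ρ : Fin m → V} :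
      LStep ι D ρ₀ (.ended t ρ) (some (rd ι (.req a))) (.loud t ρ)
  | hearBad {t : T} {ρ : Fin m → V} :
      LStep ι D ρ₀ (.ended t ρ) (some (rd ι .bad)) (.loud t ρ)
  | bad {t : T} {ρ : Fin m → V} : LStep ι D ρ₀ (.loud t ρ) (some (wr ι .bad)) (.sink t ρ)

/-- The system with one register that simulates `sys`. -/
def oneReg (ι : Msg m V → V') (sys : CDSystem m V S T) :
    CDSystem 1 V' (CState m V S) (LState m V T) where
  contrib := ⟨CStep ι sys.contrib, .nrm sys.contrib.init⟩
  leader := ⟨LStep ι sys.leader sys.regInit, .boot⟩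
  regInit := fun _ => ι .init

/-- The letter of the leader that records an action of the simulated system. -/
def mark (ι : Msg m V → V') : Act m V → RegOp 1 V'
  | .inl a => wr ι (.ack a)
  | .inr b => wr ι (.exec b)

open Classical in
/-- The action recorded by a letter of the leader, if any. -/
noncomputable def unmark (ι : Msg m V → V') (y : RegOp 1 V') : List (Act m V) :=
  if h : ∃ x, mark ι x = y then [h.choose] else []

theorem mark_injective {ι : Msg m V → V'} (hι : Function.Injective ι) :
    Function.Injective (mark ι) := by
  intro x y h
  cases x <;> cases y <;> simp only [mark, RegOp.write.injEq, true_and] at h <;>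
    cases hι h <;> rfl

theorem unmark_mark {ι : Msg m V → V'} (hι : Function.Injective ι) (x : Act m V) :
    unmark ι (mark ι x) = [x] := by
  have h : ∃ z, mark ι z = mark ι x := ⟨x, rfl⟩
  rw [unmark, dif_pos h, mark_injective hι h.choose_spec]

theorem unmark_eq_nil {ι : Msg m V → V'} {y : RegOp 1 V'} (h : ∀ x, mark ι x ≠ y) :
    unmark ι y = [] := by
  rw [unmark, dif_neg]
  rintro ⟨x, hx⟩
  exact h x hx

theorem unmark_rd (ι : Msg m V → V') (x : Msg m V) : unmark ι (rd ι x) = [] :=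
  unmark_eq_nil fun x => by cases x <;> simp [mark]

theorem unmark_wr {ι : Msg m V → V'} (hι : Function.Injective ι) {x : Msg m V}
    (h1 : ∀ a, x ≠ .ack a) (h2 : ∀ a, x ≠ .exec a) : unmark ι (wr ι x) = [] := by
  refine unmark_eq_nil fun z h => ?_
  cases z <;> simp only [mark, RegOp.write.injEq, true_and] at h
  · exact h1 _ (hι h).symm
  · exact h2 _ (hι h).symm

/-- The actions recorded by a label of the system with one register. -/
noncomputable def recorded (ι : Msg m V → V') (o : Option (Option (Act 1 V'))) : List (Act m V) :=
  (leaderLetters o).flatMap (unmark ι)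

@[simp] theorem recorded_none (ι : Msg m V → V') : recorded ι none = [] := rfl
@[simp] theorem recorded_eps (ι : Msg m V → V') : recorded ι (some none) = [] := rfl
@[simp] theorem recorded_inl (ι : Msg m V → V') (a : RegOp 1 V') :
    recorded ι (some (some (.inl a))) = [] := rfl
@[simp] theorem recorded_inr (ι : Msg m V → V') (a : RegOp 1 V') :
    recorded ι (some (some (.inr a))) = unmark ι a := by
  simp [recorded, leaderLetters]

theorem regStep_const_rd {ι : Msg m V → V'} (hι : Function.Injective ι) {x z : Msg m V}
    {ρ' : Fin 1 → V'} :
    RegStep (some (rd ι z)) (fun _ => ι x) ρ' ↔ x = z ∧ ρ' = fun _ => ι x := by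
  simp only [RegStep, hι.eq_iff]

theorem regStep_const_wr {ι : Msg m V → V'} {x : Fin 1 → V'} {z : Msg m V} {ρ' : Fin 1 → V'} :
    RegStep (some (wr ι z)) x ρ' ↔ ρ' = fun _ => ι z := by
  have : Function.update x 0 (ι z) = fun _ => ι z := by
    funext i; rw [Subsingleton.elim i 0, Function.update_self]
  simp only [RegStep, this]

theorem RegStep.idem {a : RegOp m V} {ρ ρ' : Fin m → V} (h : RegStep (some a) ρ ρ') :
    RegStep (some a) ρ' ρ' := by
  cases a with
  | read i g => obtain ⟨h1, rfl⟩ := h; exact ⟨h1, rfl⟩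
  | write i g => cases h; simp [RegStep]

theorem CDSystem.step_iff (sys : CDSystem m V S T) {M : Multiset S} {t : T} {ρ : Fin m → V}
    {o : Option (Act m V)} {c : Config m V S T} :
    sys.Step ⟨M, t, ρ⟩ o c ↔
      (∃ s s' a N ρ', M = s ::ₘ N ∧ sys.contrib.step s a s' ∧ RegStep a ρ ρ' ∧
        o = a.map .inl ∧ c = ⟨s' ::ₘ N, t, ρ'⟩) ∨
      ∃ t' a ρ', sys.leader.step t a t' ∧ RegStep a ρ ρ' ∧ o = a.map .inr ∧ c = ⟨M, t', ρ'⟩ := by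
  constructor
  · intro h
    generalize hc : Config.mk M t ρ = c₀ at h
    cases h with
    | contrib h1 h2 => cases hc; exact .inl ⟨_, _, _, _, _, rfl, h1, h2, rfl, rfl⟩
    | leader h1 h2 => cases hc; exact .inr ⟨_, _, _, h1, h2, rfl, rfl⟩
  · rintro (⟨s, s', a, N, ρ', rfl, h1, h2, rfl, rfl⟩ | ⟨t', a, ρ', h1, h2, rfl, rfl⟩)
    · exact .contrib h1 h2
    · exact .leader h1 h2

/-! ### From runs with one register to runs of the original system -/

/-- States of a simulating contributor together with the state of the contributor it stands for.
`todo s a s'` and `did s a s'` both belong to the state `wait s a s'`; in the former the simulated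
contributor has not moved yet, in the latter it has been moved to `s'`, at the moment when the
leader answered a request. A contributor in `err s y` or `sink s y` stands for one in state `y`. -/
inductive Ghost (m : ℕ) (V : Type*) (S : Type*) where
  | nrm (s : S) : Ghost m V S
  | todo (s : S) (a : RegOp m V) (s' : S) : Ghost m V S
  | did (s : S) (a : RegOp m V) (s' : S) : Ghost m V S
  | chk (s : S) (ρ : Fin m → V) : Ghost m V S
  | err (s y : S) : Ghost m V S
  | sink (s y : S) : Ghost m V S

namespace Ghost

/-- The state of the simulating contributor. -/
def conc : Ghost m V S → CState m V S
  | nrm s => .nrm s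
  | todo s a s' => .wait s a s'
  | did s a s' => .wait s a s'
  | chk s ρ => .chk s ρ
  | err s _ => .err s
  | sink s _ => .sink s

/-- The state of the simulated contributor. -/
def abs : Ghost m V S → S
  | nrm s => s
  | todo s _ _ => s
  | did _ _ s' => s'
  | chk s _ => s
  | err _ y => y
  | sink _ y => y

/-- A weight that decreases in every step of a contributor that simulates no step. The step from
`todo` to `did`, where it increases, is simulated. -/
def weight : Ghost m V S → ℕ
  | nrm _ => 3
  | todo _ _ _ => 2
  | did _ _ _ => 4
  | chk _ _ => 1
  | err _ _ => 1
  | sink _ _ => 0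

/-- The indicator of `todo`. -/
def pending : Ghost m V S → ℕ
  | todo _ _ _ => 1
  | _ => 0

/-- The states that are possible as long as the leader has not claimed a deadlock. -/
def Early : Ghost m V S → Prop
  | nrm _ => True
  | todo _ _ _ => True
  | did _ _ _ => True
  | _ => False

end Ghost

namespace LState

/-- A weight that decreases in every step of the leader that simulates no step. -/
def weight : LState m V T → ℕ
  | boot => 4
  | run _ _ => 3
  | ackp _ _ _ => 2
  | ended _ _ => 2
  | loud _ _ => 1
  | sink _ _ => 0

/-- The state of the simulated leader. -/
def state (t₀ : T) : LState m V T → T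
  | boot => t₀
  | run t _ => t
  | ackp t _ _ => t
  | ended t _ => t
  | loud t _ => t
  | sink t _ => t

/-- The contents of the simulated registers. -/
def regs (ρ₀ : Fin m → V) : LState m V T → Fin m → V
  | boot => ρ₀
  | run _ ρ => ρ
  | ackp _ ρ _ => ρ
  | ended _ ρ => ρ
  | loud _ ρ => ρ
  | sink _ ρ => ρ

end LState

/-- Configurations of the system with one register, annotated by simulated states. -/
structure GConfig (m : ℕ) (V S T : Type*) where
  pop : Multiset (Ghost m V S)
  lead : LState m V T
  reg : Msg m V

namespace GConfig

/-- The configuration of the system with one register. -/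
def conc (ι : Msg m V → V') (g : GConfig m V S T) : Config 1 V' (CState m V S) (LState m V T) :=
  ⟨g.pop.map Ghost.conc, g.lead, fun _ => ι g.reg⟩

/-- The simulated configuration. -/
def abs (sys : CDSystem m V S T) (g : GConfig m V S T) : Config m V S T :=
  ⟨g.pop.map Ghost.abs, g.lead.state sys.leader.init, g.lead.regs sys.regInit⟩

/-- A measure that decreases in every step that simulates no step. -/
def weight (g : GConfig m V S T) : ℕ := (g.pop.map Ghost.weight).sum + g.lead.weight

/-- The number of further contributors that can make use of the present answer of the leader. -/
def copies (g : GConfig m V S T) : ℕ :=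
  match g.reg with
  | .ack _ => (g.pop.map Ghost.pending).sum
  | _ => 0

/-- The part of the invariant that depends on the phase of the leader; `last` is the last recorded
action. While `ack a` is in the register, `last` is `a`, so that a contributor that reads this
answer after another one has been moved performs a further copy of `a`. In the phases `ended` and
`loud` the claim is no longer in the register once a contributor has refuted it. -/
def LeadInv (K : Multiset (Ghost m V S)) (x : Msg m V) (last : Option (Act m V)) :
    LState m V T → Prop
  | .boot => (∀ g ∈ K, g.Early) ∧ (x = .init ∨ ∃ a, x = .req a)
  | .run _ ρ => (∀ g ∈ K, g.Early) ∧ x ≠ .bad ∧ (∀ ρ, x ≠ .halt ρ) ∧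
      ∀ a, x = .ack a → last = some (.inl a) ∧ RegStep (some a) ρ ρ
  | .ackp _ ρ a => (∀ g ∈ K, g.Early) ∧ (∃ b, x = .req b) ∧ (∃ s s', Ghost.todo s a s' ∈ K) ∧
      ∃ ρ', RegStep (some a) ρ ρ'
  | .ended _ ρ => (∀ s ρ', Ghost.chk s ρ' ∈ K → ρ' = ρ) ∧
      (x = .bad ∨ (∃ a, x = .req a) ∨ (x = .halt ρ ∧ ∀ s y, Ghost.sink s y ∉ K))
  | .loud _ ρ => (∀ s ρ', Ghost.chk s ρ' ∈ K → ρ' = ρ) ∧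
      (x = .bad ∨ (∃ a, x = .req a) ∨ (x = .halt ρ ∧ ∀ s y, Ghost.sink s y ∉ K))
  | .sink _ _ => False

/-- The invariant of the simulation; a request in the register comes from a contributor that has not
been served yet. -/
structure Inv (sys : CDSystem m V S T) (last : Option (Act m V)) (g : GConfig m V S T) : Prop where
  step : ∀ s a s', Ghost.todo s a s' ∈ g.pop → sys.contrib.step s (some a) s'
  req : ∀ a, g.reg = .req a → ∃ s s', Ghost.todo s a s' ∈ g.pop
  lead : LeadInv g.pop g.reg last g.lead

/-- The effect on the simulated system of a step with one register with label `o`. The last argument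
is the label of the simulated step, if any. In the case `copy` the simulated action is not recorded,
but repeats the last recorded action. -/
inductive Effect (ι : Msg m V → V') (sys : CDSystem m V S T) (last : Option (Act m V))
    (g : GConfig m V S T) (o : Option (Act 1 V')) (g' : GConfig m V S T) :
    Option (Option (Act m V)) → Prop
  | silent : g'.abs sys = g.abs sys → recorded ι (some o) = [] → g'.weight < g.weight →
      g'.copies ≤ g.copies → Effect ι sys last g o g' none
  | eps : sys.Step (g.abs sys) none (g'.abs sys) → recorded ι (some o) = [] →
      g'.copies ≤ g.copies → Effect ι sys last g o g' (some none)
  | mark {x : Act m V} : sys.Step (g.abs sys) (some x) (g'.abs sys) →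
      recorded ι (some o) = [x] → Effect ι sys last g o g' (some (some x))
  | copy {a : RegOp m V} : sys.Step (g.abs sys) (some (.inl a)) (g'.abs sys) →
      recorded ι (some o) = [] → last = some (.inl a) → g'.copies < g.copies →
      Effect ι sys last g o g' (some (some (.inl a)))

end GConfig

end OneReg
end ParamSys

namespace ParamSys
section OneReg
variable {m : ℕ} {V V' S T : Type*}
open GConfig in
/-- Every step of a contributor has a simulated effect. Reading `ack a` in the state `did` completes
a step that has already been simulated, reading it in the state `todo` is a further copy of `a`. -/
theorem GConfig.contrib_step {ι : Msg m V → V'} (hι : Function.Injective ι)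
    (sys : CDSystem m V S T) {last : Option (Act m V)} {g : Ghost m V S}
    {K : Multiset (Ghost m V S)} {l : LState m V T} {x : Msg m V}
    (hinv : Inv sys last ⟨g ::ₘ K, l, x⟩) {o : Option (RegOp 1 V')} {s' : CState m V S}
    {ρ' : Fin 1 → V'} (hs : CStep ι sys.contrib g.conc o s') (hr : RegStep o (fun _ => ι x) ρ') :
    ∃ (g' : Ghost m V S) (x' : Msg m V) (ℓ : Option (Option (Act m V))),
      g'.conc = s' ∧ ρ' = (fun _ => ι x') ∧ Inv sys last ⟨g' ::ₘ K, l, x'⟩ ∧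
      Effect ι sys last ⟨g ::ₘ K, l, x⟩ (o.map .inl) ⟨g' ::ₘ K, l, x'⟩ ℓ := by
  obtain ⟨i1, i2, i3⟩ := hinv
  simp only at i1 i2 i3
  cases g with
  | nrm s =>
    cases hs with
    | eps h =>
      cases hr
      refine ⟨.nrm _, x, _, rfl, rfl, ⟨?_, ?_, ?_⟩, .eps ?_ rfl ?_⟩
      · simpa using i1
      · simpa using i2
      · cases l <;> simp only [LeadInv] at i3 ⊢ <;> grind [Ghost.Early]
      · simp only [GConfig.abs, Multiset.map_cons]
        exact .contrib (a := none) h rfl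
      · cases x <;> simp [copies, Ghost.pending]
    | @ask _ s' a h =>
      rw [regStep_const_wr] at hr
      refine ⟨.todo s a s', .req a, _, rfl, hr, ⟨?_, ?_, ?_⟩, .silent ?_ rfl ?_ ?_⟩
      · grind
      · grind
      · cases l <;> simp only [LeadInv] at i3 ⊢ <;> grind [Ghost.Early]
      · simp [GConfig.abs, Ghost.abs]
      · simp [GConfig.weight, Ghost.weight]
      · simp [copies]
    | @halt _ s' o ρ h =>
      rw [regStep_const_rd hι] at hr
      obtain ⟨rfl, hr⟩ := hr
      refine ⟨.chk s ρ, .halt ρ, _, rfl, hr, ⟨?_, ?_, ?_⟩, .silent ?_ rfl ?_ ?_⟩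
      · grind
      · grind
      · cases l <;> simp only [LeadInv] at i3 ⊢ <;> grind [Ghost.Early]
      · simp [GConfig.abs, Ghost.abs]
      · simp [GConfig.weight, Ghost.weight]
      · simp [copies]
  | todo s a s' =>
    have hst := i1 s a s' (Multiset.mem_cons_self _ _)
    cases hs with
    | done =>
      rw [regStep_const_rd hι] at hr
      obtain ⟨rfl, hr⟩ := hr
      have h3 : last = some (.inl a) ∧
          RegStep (some a) (l.regs sys.regInit) (l.regs sys.regInit) := by
        cases l <;> simp only [LeadInv] at i3 ⊢ <;> grind [Ghost.Early, LState.regs]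
      refine ⟨.nrm s', .ack a, _, rfl, hr, ⟨?_, ?_, ?_⟩, .copy ?_ rfl h3.1 ?_⟩
      · grind
      · grind
      · cases l <;> simp only [LeadInv] at i3 ⊢ <;> grind [Ghost.Early]
      · simp only [GConfig.abs, Multiset.map_cons]
        exact .contrib (a := some a) hst h3.2
      · simp [copies, Ghost.pending]
    | @waitHalt _ _ _ ρ =>
      rw [regStep_const_rd hι] at hr
      obtain ⟨rfl, hr⟩ := hr
      refine ⟨.err s s, .halt ρ, _, rfl, hr, ⟨?_, ?_, ?_⟩, .silent ?_ rfl ?_ ?_⟩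
      · grind
      · grind
      · cases l <;> simp only [LeadInv] at i3 ⊢ <;> grind [Ghost.Early]
      · simp [GConfig.abs, Ghost.abs]
      · simp [GConfig.weight, Ghost.weight]
      · simp [copies]
  | did s a s' =>
    cases hs with
    | done =>
      rw [regStep_const_rd hι] at hr
      obtain ⟨rfl, hr⟩ := hr
      refine ⟨.nrm s', .ack a, _, rfl, hr, ⟨?_, ?_, ?_⟩, .silent ?_ rfl ?_ ?_⟩
      · grind
      · grind
      · cases l <;> simp only [LeadInv] at i3 ⊢ <;> grind [Ghost.Early]
      · simp [GConfig.abs, Ghost.abs]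
      · simp [GConfig.weight, Ghost.weight]
      · simp [copies, Ghost.pending]
    | @waitHalt _ _ _ ρ =>
      rw [regStep_const_rd hι] at hr
      obtain ⟨rfl, hr⟩ := hr
      refine ⟨.err s s', .halt ρ, _, rfl, hr, ⟨?_, ?_, ?_⟩, .silent ?_ rfl ?_ ?_⟩
      · grind
      · grind
      · cases l <;> simp only [LeadInv] at i3 ⊢ <;> grind [Ghost.Early]
      · simp [GConfig.abs, Ghost.abs]
      · simp [GConfig.weight, Ghost.weight]
      · simp [copies]
  | chk s ρ =>
    cases hs with
    | chk h h' =>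
      rw [regStep_const_wr] at hr
      refine ⟨.sink s s, .bad, _, rfl, hr, ⟨?_, ?_, ?_⟩, .silent ?_ rfl ?_ ?_⟩
      · grind
      · grind
      · cases l <;> simp [LeadInv, Ghost.Early] at i3 ⊢ <;> grind
      · simp [GConfig.abs, Ghost.abs]
      · simp [GConfig.weight, Ghost.weight]
      · simp [copies]
  | err s y =>
    cases hs with
    | err =>
      rw [regStep_const_wr] at hr
      refine ⟨.sink s y, .bad, _, rfl, hr, ⟨?_, ?_, ?_⟩, .silent ?_ rfl ?_ ?_⟩
      · grind
      · grind
      · cases l <;> simp [LeadInv, Ghost.Early] at i3 ⊢ <;> grind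
      · simp [GConfig.abs, Ghost.abs]
      · simp [GConfig.weight, Ghost.weight]
      · simp [copies]
  | sink s y => cases hs

open GConfig in
/-- Every step of the leader has a simulated effect, unless it puts `bad` into its trace. When the
leader answers a request, one of the contributors that wait for the answer is moved. -/
theorem GConfig.leader_step {ι : Msg m V → V'} (hι : Function.Injective ι)
    (sys : CDSystem m V S T) {last : Option (Act m V)}
    {K : Multiset (Ghost m V S)} {l l' : LState m V T} {x : Msg m V}
    (hinv : Inv sys last ⟨K, l, x⟩) {o : Option (RegOp 1 V')}
    {ρ' : Fin 1 → V'} (hs : LStep ι sys.leader sys.regInit l o l')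
    (hr : RegStep o (fun _ => ι x) ρ') (hbad : o ≠ some (wr ι .bad)) :
    ∃ (K' : Multiset (Ghost m V S)) (x' : Msg m V) (ℓ : Option (Option (Act m V))),
      K'.map Ghost.conc = K.map Ghost.conc ∧ ρ' = (fun _ => ι x') ∧
      Inv sys ((recorded ι (some (o.map .inr))).getLast?.or last) ⟨K', l', x'⟩ ∧
      Effect ι sys last ⟨K, l, x⟩ (o.map .inr) ⟨K', l', x'⟩ ℓ := by
  obtain ⟨i1, i2, i3⟩ := hinv
  simp only at i1 i2 i3
  cases hs with
  | boot =>
    cases hr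
    refine ⟨K, x, _, rfl, rfl, ⟨i1, i2, ?_⟩, .silent rfl rfl ?_ le_rfl⟩
    · simp [LeadInv] at i3 ⊢; grind
    · simp [GConfig.weight, LState.weight]
  | eps h =>
    cases hr
    refine ⟨K, x, _, rfl, rfl, ⟨i1, i2, i3⟩, .eps ?_ rfl le_rfl⟩
    exact .leader (a := none) h rfl
  | @exec t t' b ρ ρ'' h h' =>
    rw [regStep_const_wr] at hr
    have hm : recorded ι (some ((some (wr ι (.exec b))).map .inr)) = [.inr b] := by
      rw [Option.map_some, recorded_inr]; exact unmark_mark hι (.inr b)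
    refine ⟨K, .exec b, _, rfl, hr, ⟨i1, ?_, ?_⟩, .mark ?_ hm⟩
    · simp
    · simp [LeadInv] at i3 ⊢; grind
    · exact .leader (a := some b) h h'
  | @hear t a ρ ρ'' h =>
    rw [regStep_const_rd hι] at hr
    obtain ⟨rfl, hr⟩ := hr
    have hm : recorded ι (some ((some (rd ι (.req a))).map .inr)) = [] := by
      rw [Option.map_some, recorded_inr]; exact unmark_rd _ _
    refine ⟨K, .req a, _, rfl, hr, ⟨i1, i2, ?_⟩, .silent rfl hm ?_ ?_⟩
    · simp [LeadInv] at i3 ⊢; grind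
    · simp [GConfig.weight, LState.weight]
    · simp [copies]
  | @ack t a ρ ρ'' h =>
    rw [regStep_const_wr] at hr
    have hm : recorded ι (some ((some (wr ι (.ack a))).map .inr)) = [.inl a] := by
      rw [Option.map_some, recorded_inr]; exact unmark_mark hι (.inl a)
    obtain ⟨j1, j2, ⟨s, s', hK⟩, -⟩ := i3
    have hst := i1 s a s' hK
    obtain ⟨K₀, rfl⟩ := Multiset.exists_cons_of_mem hK
    refine ⟨.did s a s' ::ₘ K₀, .ack a, _, ?_, hr, ⟨?_, ?_, ?_⟩, .mark ?_ hm⟩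
    · simp [Ghost.conc]
    · grind
    · simp
    · rw [hm]
      simp [LeadInv, Ghost.Early] at j1 ⊢
      exact ⟨j1, h.idem⟩
    · simp only [GConfig.abs, Multiset.map_cons]
      exact .contrib (a := some a) hst h
  | halt =>
    rw [regStep_const_wr] at hr
    have hm : recorded ι (some ((some (wr ι (.halt ‹_›))).map .inr)) = [] := by
      rw [Option.map_some, recorded_inr]; exact unmark_wr hι (by simp) (by simp)
    refine ⟨K, .halt _, _, rfl, hr, ⟨i1, ?_, ?_⟩, .silent rfl hm ?_ ?_⟩
    · simp
    · simp only [LeadInv] at i3 ⊢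
      refine ⟨fun s ρ' h => (i3.1 _ h).elim, .inr (.inr ⟨by trivial, fun s y h => (i3.1 _ h).elim⟩)⟩
    · simp [GConfig.weight, LState.weight]
    · simp [copies]
  | alive h h' =>
    cases hr
    refine ⟨K, x, _, rfl, rfl, ⟨i1, i2, i3⟩, .silent rfl rfl ?_ le_rfl⟩
    simp [GConfig.weight, LState.weight]
  | @hearReq t a ρ =>
    rw [regStep_const_rd hι] at hr
    obtain ⟨rfl, hr⟩ := hr
    have hm : recorded ι (some ((some (rd ι (.req a))).map .inr)) = [] := by
      rw [Option.map_some, recorded_inr]; exact unmark_rd _ _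
    refine ⟨K, .req a, _, rfl, hr, ⟨i1, i2, i3⟩, .silent rfl hm ?_ le_rfl⟩
    simp [GConfig.weight, LState.weight]
  | hearBad =>
    rw [regStep_const_rd hι] at hr
    obtain ⟨rfl, hr⟩ := hr
    have hm : recorded ι (some ((some (rd ι .bad)).map .inr)) = [] := by
      rw [Option.map_some, recorded_inr]; exact unmark_rd _ _
    refine ⟨K, .bad, _, rfl, hr, ⟨i1, i2, i3⟩, .silent rfl hm ?_ le_rfl⟩
    simp [GConfig.weight, LState.weight]
  | bad => exact absurd rfl hbad

open GConfig in
/-- Every step of the system with one register has a simulated effect, as long as no claim of a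
deadlock is refuted. -/
theorem GConfig.exists_effect {ι : Msg m V → V'} (hι : Function.Injective ι)
    (sys : CDSystem m V S T) {last : Option (Act m V)} {g : GConfig m V S T}
    (hinv : Inv sys last g) {o : Option (Act 1 V')}
    {c : Config 1 V' (CState m V S) (LState m V T)} (hs : (oneReg ι sys).Step (g.conc ι) o c)
    (hbad : o ≠ some (.inr (wr ι .bad))) :
    ∃ (g' : GConfig m V S T) (ℓ : Option (Option (Act m V))), g'.conc ι = c ∧
      Inv sys ((recorded ι (some o)).getLast?.or last) g' ∧ Effect ι sys last g o g' ℓ := by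
  obtain ⟨K, l, x⟩ := g
  rw [GConfig.conc, CDSystem.step_iff] at hs
  rcases hs with ⟨s, s', a, N, ρ', hK, h1, h2, rfl, rfl⟩ | ⟨t', a, ρ', h1, h2, rfl, rfl⟩
  · classical
    obtain ⟨g, hg, rfl, rfl⟩ := (Multiset.map_eq_cons _ _ _ _).mpr hK
    change g ∈ K at hg
    obtain ⟨g', x', ℓ, rfl, rfl, e2, e3⟩ := contrib_step (K := K.erase g) hι sys
      (by rwa [Multiset.cons_erase hg]) h1 h2
    rw [Multiset.cons_erase hg] at e3
    refine ⟨⟨g' ::ₘ K.erase g, l, x'⟩, ℓ, by simp [GConfig.conc], ?_, e3⟩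
    have : recorded ι (some (a.map .inl)) = [] := by cases a <;> rfl
    rw [this]
    exact e2
  · obtain ⟨K', x', ℓ, e1, rfl, e2, e3⟩ := leader_step hι sys hinv h1 h2
      (by rintro rfl; exact hbad rfl)
    exact ⟨⟨K', t', x'⟩, ℓ, by rw [GConfig.conc, e1], e2, e3⟩

open GConfig in
/-- A deadlock of the system with one register stands for a deadlock of the original system: the
leader must have claimed it (before that, it can always do so), and every contributor or leader with
a possible move would refute the claim. -/
theorem GConfig.dead_abs {ι : Msg m V → V'} (hι : Function.Injective ι)
    (sys : CDSystem m V S T) {last : Option (Act m V)} {g : GConfig m V S T}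
    (hinv : Inv sys last g) (hd : Dead (oneReg ι sys).Step (g.conc ι)) :
    Dead sys.Step (g.abs sys) := by
  obtain ⟨K, l, x⟩ := g
  obtain ⟨-, -, i3⟩ := hinv
  simp only at i3
  have hl : ∀ o l' ρ', LStep ι sys.leader sys.regInit l o l' →
      ¬ RegStep o (fun _ => ι x) ρ' := fun o l' ρ' h1 h2 => hd _ _ (.leader h1 h2)
  have hc : ∀ g ∈ K, ∀ o s' ρ', CStep ι sys.contrib g.conc o s' →
      ¬ RegStep o (fun _ => ι x) ρ' := by
    intro g hg o s' ρ' h1 h2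
    obtain ⟨K₀, rfl⟩ := Multiset.exists_cons_of_mem hg
    refine hd (o.map .inl) ⟨s' ::ₘ K₀.map Ghost.conc, l, ρ'⟩ ?_
    rw [GConfig.conc, Multiset.map_cons]
    exact .contrib h1 h2
  cases l with
  | boot => exact absurd rfl (hl _ _ _ .boot)
  | run t ρ => exact absurd (regStep_const_wr.mpr rfl) (hl _ _ _ .halt)
  | ackp t ρ a =>
    obtain ⟨-, -, -, ρ', h⟩ := i3
    exact absurd (regStep_const_wr.mpr rfl) (hl _ _ _ (.ack h))
  | loud t ρ => exact absurd (regStep_const_wr.mpr rfl) (hl _ _ _ .bad)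
  | sink t ρ => exact i3.elim
  | ended t ρ =>
    obtain ⟨j1, j2⟩ := i3
    rcases j2 with rfl | ⟨a, rfl⟩ | ⟨rfl, j2⟩
    · exact absurd ((regStep_const_rd hι).mpr ⟨rfl, rfl⟩) (hl _ _ _ .hearBad)
    · exact absurd ((regStep_const_rd hι).mpr ⟨rfl, rfl⟩) (hl _ _ _ .hearReq)
    · intro o c hs
      rw [GConfig.abs, CDSystem.step_iff] at hs
      rcases hs with ⟨s, s', a, N, ρ', hK, h1, h2, -, -⟩ | ⟨t', a, ρ', h1, h2, -, -⟩
      · obtain ⟨g, hg, rfl⟩ : ∃ g ∈ K, g.abs = s := by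
          rw [← Multiset.mem_map, hK]; exact Multiset.mem_cons_self _ _
        have hcg := hc g hg
        cases g with
        | nrm s => exact hcg _ _ _ (.halt h1) ((regStep_const_rd hι).mpr ⟨rfl, rfl⟩)
        | todo s b s' => exact hcg _ _ _ .waitHalt ((regStep_const_rd hι).mpr ⟨rfl, rfl⟩)
        | did s b s' => exact hcg _ _ _ .waitHalt ((regStep_const_rd hι).mpr ⟨rfl, rfl⟩)
        | chk s ρ₁ =>
          obtain rfl := j1 _ _ hg
          exact hcg _ _ _ (.chk h1 h2) (regStep_const_wr.mpr rfl)
        | err s y => exact hcg _ _ _ .err (regStep_const_wr.mpr rfl)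
        | sink s y => exact j2 _ _ hg
      · exact absurd rfl (hl _ _ _ (.alive h1 h2))

/-- A sequence of natural numbers does not decrease forever. -/
theorem not_forall_lt {f : ℕ → ℕ} (N : ℕ) : ¬ ∀ i, N ≤ i → f (i + 1) < f i := by
  intro h
  have : ∀ k, f (N + k) + k ≤ f N := by
    intro k
    induction k with
    | zero => rfl
    | succ k ih => have := h (N + k) (by omega); rw [show N + (k + 1) = N + k + 1 from rfl]; omega
  have := this (f N + 1)
  omega

/-- A sequence of natural numbers that does not increase is eventually constant. -/
theorem eventually_not_lt {f : ℕ → ℕ} (N : ℕ) (h : ∀ i, N ≤ i → f (i + 1) ≤ f i) :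
    ∃ M, N ≤ M ∧ ∀ i, M ≤ i → ¬ f (i + 1) < f i := by
  have hmono : ∀ i j, N ≤ i → i ≤ j → f j ≤ f i := by
    intro i j hi hij
    induction j, hij using Nat.le_induction with
    | base => rfl
    | succ j hj ih => exact (h j (by omega)).trans ih
  have hex : ∃ v, ∃ i, N ≤ i ∧ f i = v := ⟨_, N, le_rfl, rfl⟩
  classical
  obtain ⟨M, hM, hv⟩ := Nat.find_spec hex
  refine ⟨M, hM, fun i hi hlt => ?_⟩
  have h1 := hmono M i hM hi
  exact Nat.find_min hex (m := f (i + 1)) (by omega) ⟨i + 1, by omega, rfl⟩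

open GConfig in
/-- A trace of the system with one register in whose leader part no claim of a deadlock is refuted
records a word that belongs to `P` only if the original system has a maximal trace in `P`. -/
theorem hasMaximalTraceIn_of_oneReg {ι : Msg m V → V'} (hι : Function.Injective ι)
    (sys : CDSystem m V S T) {P : Set (Word (Act m V))} (hP : CExpanding P)
    {Q : Set (Word (RegOp 1 V'))}
    (hQ : ∀ v ∈ Q, ∀ d, Word.IsConcat (fun _ => unmark ι) v d →
      d ∈ P ∧ ∀ k, v.get? k ≠ some (wr ι .bad))
    (h : (oneReg ι sys).HasMaximalTraceWithLeaderProjIn Q) : sys.HasMaximalTraceIn P := by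
  rw [hasMaximalTraceWithLeaderProjIn_iff] at h
  obtain ⟨n, γ, lab, h0, hrun, v, hv, hlim⟩ := h
  let D : ℕ → List (Act m V) := fun i => recorded ι (lab i)
  obtain ⟨d, hd⟩ := exists_lim D
  obtain ⟨hdP, hnb⟩ := hQ v hv d ((isConcat_iff_of_lim hlim _ d).mpr hd)
  have hbad : ∀ i, lab i ≠ some (some (.inr (wr ι .bad))) := by
    intro i hi
    obtain ⟨k, hk⟩ := hlim.get?_of_mem (i := i) (b := wr ι .bad) (by
      rw [hi]; simp [leaderLetters])
    exact hnb k hk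
  obtain ⟨g, hg0, hg⟩ := exists_seq (G := GConfig m V S T)
    (fun i g => g.conc ι = γ i ∧ Inv sys (pre D i).getLast? g)
    (fun i g g' => (lab i = none ∧ g' = g) ∨ ∃ o, lab i = some o ∧
      ∃ ℓ, Effect ι sys (pre D i).getLast? g o g' ℓ)
    (g₀ := ⟨Multiset.replicate n (.nrm sys.contrib.init), .boot, .init⟩) (by
      refine ⟨?_, ?_, ?_, ?_⟩
      · rw [h0]; simp [GConfig.conc, CDSystem.initConfig, oneReg, Ghost.conc]
      · intro s a s' hm
        cases Multiset.eq_of_mem_replicate hm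
      · intro a ha; cases ha
      · refine ⟨fun g hg => ?_, .inl rfl⟩
        rw [Multiset.eq_of_mem_replicate hg]; trivial) (by
      rintro i g ⟨hc, hi⟩
      rcases hrun i with ⟨o, ho, hs⟩ | ⟨hn, hγ, _⟩
      · rw [← hc] at hs
        obtain ⟨g', ℓ, h1, h2, h3⟩ := exists_effect hι sys hi hs (by
          rintro rfl; exact hbad i ho)
        refine ⟨g', ⟨h1, ?_⟩, .inr ⟨o, ho, ℓ, h3⟩⟩
        rw [pre_succ, List.getLast?_append]
        simp only [D, ho]
        exact h2
      · refine ⟨g, ⟨hc.trans hγ.symm, ?_⟩, .inl ⟨hn, rfl⟩⟩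
        rw [pre_succ]
        simp only [D, hn, recorded_none, List.append_nil]
        exact hi)
  have hℓ : ∀ i, ∃ ℓ, (lab i = none ∧ g (i + 1) = g i ∧ ℓ = none) ∨ ∃ o, lab i = some o ∧
      Effect ι sys (pre D i).getLast? (g i) o (g (i + 1)) ℓ := by
    intro i
    rcases (hg i).2 with ⟨h1, h2⟩ | ⟨o, h1, ℓ, h2⟩
    · exact ⟨none, .inl ⟨h1, h2, rfl⟩⟩
    · exact ⟨ℓ, .inr ⟨o, h1, h2⟩⟩
  choose ℓ hℓ using hℓ
  obtain ⟨δ, lab', hδ0, hδrun, hcof⟩ := exists_run_of_stuttering sys.Step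
    (fun i => (g i).abs sys) ℓ (by
      intro i
      rcases hℓ i with ⟨_, h2, h3⟩ | ⟨o, _, h2⟩
      · exact .inr ⟨h3, by rw [h2]⟩
      · generalize ℓ i = l at h2
        cases h2 with
        | silent h1 => exact .inr ⟨rfl, h1⟩
        | eps h1 => exact .inl ⟨_, rfl, h1⟩
        | mark h1 => exact .inl ⟨_, rfl, h1⟩
        | copy h1 => exact .inl ⟨_, rfl, h1⟩) (by
      by_cases hex : ∃ i, lab i = none
      · obtain ⟨i, hi⟩ := hex
        right
        rcases hrun i with ⟨o, ho, _⟩ | ⟨_, _, hdead⟩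
        · rw [hi] at ho; cases ho
        · exact ⟨i, dead_abs hι sys (hg i).1.2 (by rw [(hg i).1.1]; exact hdead)⟩
      · push Not at hex
        left
        have hinf : ∀ N, ∃ i, N ≤ i ∧ ℓ i ≠ none := by
          intro N
          by_contra! hcon
          refine not_forall_lt (f := fun i => (g i).weight) N fun i hi => ?_
          rcases hℓ i with ⟨h1, _⟩ | ⟨o, _, h2⟩
          · exact absurd h1 (hex i)
          · rw [hcon i hi] at h2
            cases h2
            assumption
        intro N
        induction N with
        | zero => exact ⟨0, Nat.zero_le _⟩
        | succ N ih =>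
          obtain ⟨n, hn⟩ := ih
          obtain ⟨i, hi, hne⟩ := hinf n
          obtain ⟨a, ha⟩ := Option.ne_none_iff_exists'.mp hne
          refine ⟨i + 1, ?_⟩
          rw [pre_succ, List.length_append, ha]
          have := (pre_prefix (fun i => (ℓ i).toList) hi).length_le
          simp only [Option.toList_some, List.length_singleton]
          omega)
  rw [hasMaximalTraceIn_iff]
  obtain ⟨u, hu⟩ := exists_lim fun i => letters (ℓ i)
  refine ⟨n, δ, lab', ?_, hδrun, u, ?_, ?_⟩
  · rw [hδ0, hg0]
    simp [GConfig.abs, CDSystem.initConfig, Ghost.abs, LState.state, LState.regs]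
  · refine hP.mem_of_copies (D := D) (L := fun i => letters (ℓ i)) (fun i => ?_) (fun N hN => ?_)
      hd hdP hu
    · rcases hℓ i with ⟨h1, _, h3⟩ | ⟨o, h1, h2⟩
      · exact .inl ⟨by simp only [D, h1, recorded_none], by rw [h3]; rfl⟩
      · simp only [D, h1]
        generalize ℓ i = l at h2
        cases h2 with
        | silent _ h3 => exact .inl ⟨h3, rfl⟩
        | eps _ h3 => exact .inl ⟨h3, rfl⟩
        | mark _ h3 => exact .inr (.inl ⟨_, h3, rfl⟩)
        | copy _ h3 h4 => exact .inr (.inr ⟨_, h3, rfl, h4⟩)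
    · have hle : ∀ i, N ≤ i → (g (i + 1)).copies ≤ (g i).copies ∧
          (letters (ℓ i) ≠ [] → (g (i + 1)).copies < (g i).copies) := by
        intro i hi
        rcases hℓ i with ⟨h1, h2, h3⟩ | ⟨o, h1, h2⟩
        · rw [h2, h3]; exact ⟨le_rfl, fun hne => absurd rfl hne⟩
        · have hDi : recorded ι (some o) = [] := by rw [← h1]; exact hN i hi
          generalize ℓ i = l at h2
          cases h2 with
          | silent _ _ _ h3 => exact ⟨h3, fun hne => absurd rfl hne⟩
          | eps _ _ h3 => exact ⟨h3, fun hne => absurd rfl hne⟩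
          | mark _ h3 => rw [hDi] at h3; cases h3
          | copy _ _ _ h3 => exact ⟨h3.le, fun _ => h3⟩
      obtain ⟨M, hNM, hM⟩ := eventually_not_lt (f := fun i => (g i).copies) N
        fun i hi => (hle i hi).1
      refine ⟨M, fun i hi => ?_⟩
      by_contra hne
      exact hM i hi ((hle i (hNM.trans hi)).2 hne)
  · have := hcof.pre_flatMap (B := Act m V) Option.toList
    exact this.lim hu

end OneReg
end ParamSys

namespace ParamSys
section OneReg
variable {m : ℕ} {V V' S T : Type*}

/-! ### From runs of the original system to runs with one register -/

/-- The configuration of the system with one register that stands for `c`, between two simulated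
steps, with register contents `x`. -/
def embed (ι : Msg m V → V') (c : Config m V S T) (x : Msg m V) :
    Config 1 V' (CState m V S) (LState m V T) :=
  ⟨c.pop.map .nrm, .run c.lead c.regs, fun _ => ι x⟩

/-- The labels of the steps that simulate a step. -/
def protocol (ι : Msg m V → V') : Option (Act m V) → List (Option (Act 1 V'))
  | none => [none]
  | some (.inl a) => [some (.inl (wr ι (.req a))), some (.inr (rd ι (.req a))),
      some (.inr (wr ι (.ack a))), some (.inl (rd ι (.ack a)))]
  | some (.inr b) => [some (.inr (wr ι (.exec b)))]

/-- The letters that the leader uses in runs that simulate runs of the original system. -/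
def Legal (ι : Msg m V → V') (y : RegOp 1 V') : Prop :=
  (∃ x, y = mark ι x) ∨ (∃ a, y = rd ι (.req a)) ∨ ∃ ρ, y = wr ι (.halt ρ)

/-- A step of a contributor is simulated by the request, its receipt by the leader, the answer and
the receipt of the answer; silent steps and steps of the leader are simulated by a single step. -/
theorem exists_path_protocol {ι : Msg m V → V'} (hι : Function.Injective ι)
    {sys : CDSystem m V S T} {c c' : Config m V S T} {o : Option (Act m V)}
    (h : sys.Step c o c') (x : Msg m V) :
    ∃ x', Path (oneReg ι sys).Step (embed ι c x) (protocol ι o) (embed ι c' x') := by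
  cases h with
  | @contrib s s' a M t ρ ρ' h1 h2 =>
    cases a with
    | none =>
      cases h2
      refine ⟨x, .single ?_⟩
      simp only [embed, Multiset.map_cons]
      exact .contrib (sys := oneReg ι sys) (a := none) (.eps h1) rfl
    | some a =>
      refine ⟨.ack a, ?_⟩
      simp only [embed, Multiset.map_cons]
      refine .cons (.contrib (sys := oneReg ι sys) (a := some _) (.ask h1)
        (regStep_const_wr.mpr rfl)) ?_
      refine .cons (.leader (sys := oneReg ι sys) (a := some _) (.hear h2)
        ((regStep_const_rd hι).mpr ⟨rfl, rfl⟩)) ?_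
      refine .cons (.leader (sys := oneReg ι sys) (a := some _) (.ack h2)
        (regStep_const_wr.mpr rfl)) ?_
      exact .single (.contrib (sys := oneReg ι sys) (a := some _) .done
        ((regStep_const_rd hι).mpr ⟨rfl, rfl⟩))
  | @leader t t' a M ρ ρ' h1 h2 =>
    cases a with
    | none =>
      cases h2
      exact ⟨x, .single (.leader (sys := oneReg ι sys) (a := none) (.eps h1) rfl)⟩
    | some b =>
      exact ⟨.exec b, .single (.leader (sys := oneReg ι sys) (a := some _) (.exec h1 h2)
        (regStep_const_wr.mpr rfl))⟩

open Classical in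
/-- After `halt ρ`, every contributor that has a transition moves to its control state. -/
theorem exists_path_chk {ι : Msg m V → V'} (hι : Function.Injective ι) (sys : CDSystem m V S T)
    (ρ : Fin m → V) (l : LState m V T) (M : Multiset S) :
    ∀ N : Multiset (CState m V S), ∃ k, Path (oneReg ι sys).Step
      ⟨M.map .nrm + N, l, fun _ => ι (.halt ρ)⟩
      (List.replicate k (some (.inl (rd ι (.halt ρ)))))
      ⟨M.map (fun s => if ∃ o s', sys.contrib.step s o s' then .chk s ρ else .nrm s) + N, l,
        fun _ => ι (.halt ρ)⟩ := by
  induction M using Multiset.induction with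
  | empty => intro N; exact ⟨0, .nil _⟩
  | cons s M ih =>
    intro N
    by_cases h : ∃ o s', sys.contrib.step s o s'
    · obtain ⟨k, hk⟩ := ih (.chk s ρ ::ₘ N)
      refine ⟨k + 1, ?_⟩
      rw [Multiset.map_cons, Multiset.map_cons, if_pos h, Multiset.cons_add, Multiset.cons_add,
        List.replicate_succ]
      rw [Multiset.add_cons, Multiset.add_cons] at hk
      obtain ⟨o, s', h⟩ := h
      exact .cons (.contrib (sys := oneReg ι sys) (a := some _) (.halt h)
        ((regStep_const_rd hι).mpr ⟨rfl, rfl⟩)) hk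
    · obtain ⟨k, hk⟩ := ih (.nrm s ::ₘ N)
      refine ⟨k, ?_⟩
      rw [Multiset.map_cons, Multiset.map_cons, if_neg h, Multiset.cons_add, Multiset.cons_add]
      rwa [Multiset.add_cons, Multiset.add_cons] at hk

/-- A deadlock of the original system can be turned into a deadlock of the system with one
register. -/
theorem exists_path_dead {ι : Msg m V → V'} (hι : Function.Injective ι)
    {sys : CDSystem m V S T} {c : Config m V S T} (h : Dead sys.Step c) (x : Msg m V) :
    ∃ k c', Path (oneReg ι sys).Step (embed ι c x) (some (.inr (wr ι (.halt c.regs))) ::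
      List.replicate k (some (.inl (rd ι (.halt c.regs))))) c' ∧ Dead (oneReg ι sys).Step c' := by
  classical
  obtain ⟨M, t, ρ⟩ := c
  obtain ⟨k, hk⟩ := exists_path_chk hι sys ρ (.ended t ρ) M 0
  rw [add_zero, add_zero] at hk
  refine ⟨k, _, .cons (.leader (sys := oneReg ι sys) (a := some _) .halt
    (regStep_const_wr.mpr rfl)) hk, ?_⟩
  intro o c' hs
  rw [CDSystem.step_iff] at hs
  rcases hs with ⟨s, s', a, N, ρ', hK, h1, h2, -, -⟩ | ⟨t', a, ρ', h1, h2, -, -⟩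
  · obtain ⟨s₀, hs₀, rfl⟩ := Multiset.mem_map.mp (hK ▸ Multiset.mem_cons_self s N)
    split_ifs at h1 with hm
    · cases h1 with
      | chk h3 h4 =>
        obtain ⟨M', rfl⟩ := Multiset.exists_cons_of_mem hs₀
        exact h _ _ (.contrib h3 h4)
    · push Not at hm
      cases h1 with
      | eps h3 => exact hm _ _ h3
      | ask h3 => exact hm _ _ h3
      | halt h3 => exact hm _ _ h3
  · cases h1 with
    | alive h3 h4 => exact h _ _ (.leader h3 h4)
    | hearReq => cases ((regStep_const_rd hι).mp h2).1
    | hearBad => cases ((regStep_const_rd hι).mp h2).1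

/-- A maximal trace of the original system in `P` gives a maximal trace with one register whose
leader part records it. -/
theorem oneReg_of_hasMaximalTraceIn {ι : Msg m V → V'} (hι : Function.Injective ι)
    (sys : CDSystem m V S T) {P : Set (Word (Act m V))} {Q : Set (Word (RegOp 1 V'))}
    (hQ : ∀ v d, Word.IsConcat (fun _ => unmark ι) v d → d ∈ P →
      (∀ k y, v.get? k = some y → Legal ι y) → ((∃ f, v = .inf f) → ∃ f, d = .inf f) → v ∈ Q)
    (h : sys.HasMaximalTraceIn P) : (oneReg ι sys).HasMaximalTraceWithLeaderProjIn Q := by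
  rw [hasMaximalTraceIn_iff] at h
  obtain ⟨n, γ, lab, h0, hrun, u, huP, hu⟩ := h
  let I : ℕ → Config 1 V' (CState m V S) (LState m V T) → Prop := fun i x => match i with
    | 0 => x = (oneReg ι sys).initConfig n
    | i + 1 => (∃ z, x = embed ι (γ i) z) ∨ (Dead (oneReg ι sys).Step x ∧ Dead sys.Step (γ i))
  let R : ℕ → List (Option (Act 1 V')) → Config 1 V' (CState m V S) (LState m V T) → Prop :=
    fun i l x => match i with
    | 0 => l = [none]
    | i + 1 => (∃ a, lab i = some a ∧ l = protocol ι a) ∨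
        (lab i = none ∧ Dead (oneReg ι sys).Step x ∧ (l = [] ∨ ∃ k ρ,
          l = some (.inr (wr ι (.halt ρ))) :: List.replicate k (some (.inl (rd ι (.halt ρ))))))
  obtain ⟨xs, hx0, hxs⟩ := exists_seq I
    (fun i x x' => ∃ l, Path (oneReg ι sys).Step x l x' ∧ R i l x')
    (g₀ := (oneReg ι sys).initConfig n) rfl (by
      intro i x hx
      cases i with
      | zero =>
        refine ⟨embed ι (γ 0) .init, .inl ⟨_, rfl⟩, _, .single ?_, rfl⟩
        rw [show x = _ from hx, h0, embed, CDSystem.initConfig, CDSystem.initConfig,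
          Multiset.map_replicate]
        exact .leader (sys := oneReg ι sys) (a := none) .boot rfl
      | succ i =>
        rcases hrun i with ⟨a, ha, hs⟩ | ⟨hn, hγ, hd⟩
        · rcases hx with ⟨z, rfl⟩ | ⟨_, hd⟩
          · obtain ⟨z', hz'⟩ := exists_path_protocol hι hs z
            exact ⟨_, .inl ⟨z', rfl⟩, _, hz', .inl ⟨a, ha, rfl⟩⟩
          · exact absurd hs (hd _ _)
        · rw [← hγ] at hd
          rcases hx with ⟨z, rfl⟩ | ⟨hd', _⟩
          · obtain ⟨k, c', hp, hd'⟩ := exists_path_dead hι (by rwa [hγ] at hd) z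
            exact ⟨c', .inr ⟨hd', hd⟩, _, hp, .inr ⟨hn, hd', .inr ⟨k, _, rfl⟩⟩⟩
          · exact ⟨x, .inr ⟨hd', hd⟩, [], .nil _, .inr ⟨hn, hd', .inl rfl⟩⟩)
  choose ls hpath hls using fun i => (hxs i).2
  have hstuck : ∀ i, lab i = none → ∀ j, i + 2 ≤ j → ls j = [] := by
    intro i hi j hj
    obtain ⟨j, rfl⟩ : ∃ k, j = k + 2 := ⟨j - 2, by omega⟩
    have hn := (hrun.none_mono (j := j) (by omega) hi).1
    have hd : Dead (oneReg ι sys).Step (xs (j + 2)) := by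
      rcases hls (j + 1) with ⟨a, ha, _⟩ | ⟨_, hd, _⟩
      · rw [hn] at ha; cases ha
      · exact hd
    have hp := hpath (j + 2)
    cases hl : ls (j + 2) with
    | nil => rfl
    | cons a l =>
      rw [hl] at hp
      cases hp with
      | cons h1 _ => exact absurd h1 (hd _ _)
  obtain ⟨δ, lab', hδ0, hδrun, hcof⟩ := exists_run_of_paths (oneReg ι sys).Step xs ls hpath (by
    by_cases hex : ∃ i, lab i = none
    · obtain ⟨i, hi⟩ := hex
      right
      rcases hls (i + 1) with ⟨a, ha, _⟩ | ⟨_, hd, _⟩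
      · rw [hi] at ha; cases ha
      · exact ⟨_, hd⟩
    · push Not at hex
      left
      intro N
      refine ⟨N, ?_⟩
      induction N with
      | zero => exact Nat.zero_le _
      | succ N ih =>
        rw [pre_succ, List.length_append]
        have : 0 < (ls N).length := by
          have := hls N
          cases N with
          | zero => rw [show ls 0 = [none] from this]; exact Nat.one_pos
          | succ N =>
            rcases this with ⟨a, _, h2⟩ | ⟨h1, _⟩
            · rw [h2]; rcases a with _ | a | a <;> simp [protocol]
            · exact absurd h1 (hex N)
        omega)
  let W : ℕ → List (RegOp 1 V') := fun i => (ls i).flatMap fun o => leaderLetters (some o)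
  obtain ⟨v, hv⟩ := exists_lim W
  have hrd : ∀ k (ρ : Fin m → V), ((List.replicate k (some (Sum.inl (rd ι (.halt ρ))))).flatMap
      fun o : Option (Act 1 V') => leaderLetters (some o)) = [] := by
    intro k ρ
    rw [List.flatMap_eq_nil_iff]
    intro o ho
    rw [List.eq_of_mem_replicate ho]
    rfl
  have hW0 : W 0 = [] := by
    have : ls 0 = [none] := hls 0
    simp only [W, this]; rfl
  have hunm : ∀ i, (W (i + 1)).flatMap (unmark ι) = letters (lab i) := by
    intro i
    simp only [W]
    rcases hls (i + 1) with ⟨a, h1, h2⟩ | ⟨h1, _, h2 | ⟨k, ρ, h2⟩⟩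
    · rw [h1, h2]
      rcases a with _ | a | b
      · rfl
      · simp only [protocol, List.flatMap_cons, List.flatMap_nil, List.flatMap_append]
        simp only [leaderLetters, Option.toList_some, List.flatMap_cons, List.flatMap_nil,
          Sum.getRight?_inl, Sum.getRight?_inr, Option.toList_none, List.append_nil,
          List.nil_append, unmark_rd]
        exact unmark_mark hι (.inl a)
      · simp only [protocol, List.flatMap_cons, List.flatMap_nil, List.flatMap_append]
        simp only [leaderLetters, Option.toList_some, List.flatMap_cons, List.flatMap_nil,
          Sum.getRight?_inr, List.append_nil]
        exact unmark_mark hι (.inr b)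
    · rw [h1, h2]; rfl
    · rw [h1, h2, List.flatMap_cons, hrd]
      simp only [leaderLetters, Option.toList_some, List.flatMap_cons, List.flatMap_nil,
          Sum.getRight?_inr, List.append_nil]
      exact unmark_wr hι (by simp) (by simp)
  have hlegal : ∀ i, ∀ y ∈ W i, Legal ι y := by
    intro i y hy
    cases i with
    | zero => rw [hW0] at hy; cases hy
    | succ i =>
      simp only [W] at hy
      rcases hls (i + 1) with ⟨a, h1, h2⟩ | ⟨h1, _, h2 | ⟨k, ρ, h2⟩⟩
      · rw [h2] at hy
        rcases a with _ | a | b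
        · simp [protocol, leaderLetters] at hy
        · simp [protocol, leaderLetters] at hy
          rcases hy with rfl | rfl
          · exact .inr (.inl ⟨a, rfl⟩)
          · exact .inl ⟨.inl a, rfl⟩
        · simp [protocol, leaderLetters] at hy
          subst hy
          exact .inl ⟨.inr b, rfl⟩
      · rw [h2] at hy; cases hy
      · rw [h2, List.flatMap_cons, hrd] at hy
        simp [leaderLetters] at hy
        exact .inr (.inr ⟨ρ, hy⟩)
  have hpre : ∀ k, pre (fun i => (W i).flatMap (unmark ι)) (k + 1) =
      pre (fun i => letters (lab i)) k := by
    intro k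
    induction k with
    | zero => simp [pre, hW0]
    | succ k ih => rw [pre_succ, ih, hunm, pre_succ]
  have hdec : Lim (pre fun i => (W i).flatMap (unmark ι)) u := by
    refine Cofinal.lim ⟨fun n => ⟨n + 1, by rw [hpre]⟩, fun n => ⟨n, ?_⟩⟩ hu
    rw [← hpre]
    exact pre_prefix _ (Nat.le_succ n)
  rw [hasMaximalTraceWithLeaderProjIn_iff]
  refine ⟨n, δ, lab', hδ0.trans hx0, hδrun, v, ?_, ?_⟩
  · refine hQ v u ((isConcat_iff_of_lim hv _ u).mpr hdec) huP (fun k y hk => ?_) ?_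
    · obtain ⟨i, hi⟩ := hv.mem_of_get? hk
      exact hlegal i y hi
    · rw [hv.infinite_iff, hu.infinite_iff]
      intro hinf N
      by_cases hex : ∃ i, lab i = none
      · obtain ⟨i, hi⟩ := hex
        obtain ⟨j, hj, hne⟩ := hinf (i + 2)
        simp only [W, hstuck i hi j hj] at hne
        exact absurd rfl hne
      · push Not at hex
        obtain ⟨j, hj, hne⟩ := hinf (N + 1)
        obtain ⟨j, rfl⟩ : ∃ k, j = k + 1 := ⟨j - 1, by omega⟩
        refine ⟨j, by omega, ?_⟩
        rcases hls (j + 1) with ⟨a, h1, h2⟩ | ⟨h1, _⟩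
        · rw [h1]
          rcases a with _ | a
          · simp [W, h2, protocol, leaderLetters] at hne
          · simp [letters]
        · exact absurd h1 (hex j)
  · exact (hcof.pre_flatMap fun o => leaderLetters (some o)).lim (v := v) hv |> fun h => by
      have he : (fun i => ((lab' i).toList).flatMap fun o => leaderLetters (some o)) =
          fun i => leaderLetters (lab' i) := by
        funext i; cases lab' i <;> simp [leaderLetters]
      rwa [he] at h

end OneReg
end ParamSys

namespace ParamSys

/-! ### Properties of the recorded words -/

section Properties

variable {A B : Type*}

/-- `Counts mk v d c`: the word `d` lists the letters `x` for which `mk x` occurs in `v`, and `c i`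
is the number of such occurrences before position `i`. -/
structure Counts (mk : A → B) (v : Word B) (d : Word A) (c : ℕ → ℕ) : Prop where
  zero : c 0 = 0
  mark : ∀ i x, v.get? i = some (mk x) → d.get? (c i) = some x ∧ c (i + 1) = c i + 1
  skip : ∀ i, (∀ x, v.get? i ≠ some (mk x)) → c (i + 1) = c i
  surj : ∀ k x, d.get? k = some x → ∃ i, c i = k ∧ v.get? i = some (mk x)

theorem exists_counts {mk : A → B} {um : B → List A} (h1 : ∀ x, um (mk x) = [x])
    (h2 : ∀ y, (∀ x, mk x ≠ y) → um y = []) {v : Word B} {d : Word A}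
    (h : Word.IsConcat (fun _ => um) v d) : ∃ c, Counts mk v d c := by
  rw [isConcat_iff] at h
  let U : ℕ → List A := fun i => (v.get? i).elim [] um
  have hU : ∀ i, (∃ x, v.get? i = some (mk x) ∧ U i = [x]) ∨
      ((∀ x, v.get? i ≠ some (mk x)) ∧ U i = []) := by
    intro i
    by_cases hx : ∃ x, v.get? i = some (mk x)
    · obtain ⟨x, hx⟩ := hx
      exact .inl ⟨x, hx, by simp [U, hx, h1]⟩
    · push Not at hx
      refine .inr ⟨hx, ?_⟩
      simp only [U]
      cases hv : v.get? i with
      | none => rfl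
      | some y => exact h2 y fun x hxy => hx x (by rw [hv, hxy])
  have hmark : ∀ i x, v.get? i = some (mk x) → U i = [x] := by
    intro i x hx
    simp [U, hx, h1]
  refine ⟨fun i => (pre U i).length, rfl, fun i x hx => ⟨?_, ?_⟩, fun i hi => ?_,
    fun k x hk => ?_⟩
  · rw [h]
    refine ⟨i + 1, ?_⟩
    change (pre U (i + 1))[_]? = _
    rw [pre_succ, hmark i x hx, List.getElem?_append_right le_rfl]
    simp
  · rw [pre_succ, hmark i x hx]; simp
  · rcases hU i with ⟨x, hx, _⟩ | ⟨_, h⟩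
    · exact absurd hx (hi x)
    · rw [pre_succ, h, List.append_nil]
  · obtain ⟨n, hn⟩ := (h k x).mp hk
    change (pre U n)[k]? = some x at hn
    induction n with
    | zero => simp at hn
    | succ n ih =>
      rcases lt_or_ge k (pre U n).length with hlt | hge
      · rw [pre_succ, List.getElem?_append_left hlt] at hn
        exact ih hn
      · rw [pre_succ, List.getElem?_append_right hge] at hn
        rcases hU n with ⟨z, hz, hUz⟩ | ⟨_, hU0⟩
        · rw [hUz] at hn
          have hlt := (List.getElem?_eq_some_iff.mp hn).1
          simp only [List.length_singleton] at hlt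
          have hk0 : k - (pre U n).length = 0 := by omega
          rw [hk0] at hn
          simp only [List.getElem?_cons_zero, Option.some.injEq] at hn
          exact ⟨n, by omega, by rw [hz, hn]⟩
        · rw [hU0] at hn; simp at hn

namespace Counts

variable {mk : A → B} {v : Word B} {d : Word A} {c : ℕ → ℕ}

theorem mono (h : Counts mk v d c) {i j : ℕ} (hij : i ≤ j) : c i ≤ c j := by
  induction j, hij using Nat.le_induction with
  | base => rfl
  | succ j _ ih =>
    by_cases hx : ∃ x, v.get? j = some (mk x)
    · obtain ⟨x, hx⟩ := hx
      rw [(h.mark j x hx).2]; omega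
    · push Not at hx
      rw [h.skip j hx]; exact ih

theorem lt_of_mark (h : Counts mk v d c) {i j : ℕ} {x : A} (hi : v.get? i = some (mk x))
    (hij : i < j) : c i < c j := by
  have := h.mono (i := i + 1) (j := j) hij
  rw [(h.mark i x hi).2] at this
  omega

theorem le_of_mark (h : Counts mk v d c) {i j : ℕ} {x : A} (hj : v.get? j = some (mk x))
    (hij : c i ≤ c j) : i ≤ j := by
  by_contra! hlt
  have := h.lt_of_mark hj hlt
  omega

/-- The next occurrence of a recorded letter. -/
theorem next (h : Counts mk v d c) {i : ℕ} {x : A} (hi : d.get? (c i) = some x) :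
    ∃ j, i ≤ j ∧ c j = c i ∧ v.get? j = some (mk x) ∧
      ∀ k, i ≤ k → k < j → ∀ z, v.get? k ≠ some (mk z) := by
  obtain ⟨j, hj, hx⟩ := h.surj _ _ hi
  refine ⟨j, h.le_of_mark hx hj.ge, hj, hx, fun k hk hkj z hz => ?_⟩
  have h1 := h.lt_of_mark hz hkj
  have h2 := h.mono hk
  omega

theorem eq_of_skip (h : Counts mk v d c) {i j : ℕ} (hij : i ≤ j)
    (hs : ∀ k, i ≤ k → k < j → ∀ z, v.get? k ≠ some (mk z)) : c j = c i := by
  induction j, hij using Nat.le_induction with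
  | base => rfl
  | succ j hj ih =>
    rw [h.skip j (hs j hj (Nat.lt_succ_self j))]
    exact ih fun k h1 h2 => hs k h1 (by omega)

theorem isSome_of_lt (h : Counts mk v d c) {i k : ℕ} (hk : k < c i) :
    ∃ x, d.get? k = some x := by
  induction i with
  | zero => rw [h.zero] at hk; omega
  | succ i ih =>
    by_cases hx : ∃ x, v.get? i = some (mk x)
    · obtain ⟨x, hx⟩ := hx
      obtain ⟨h1, h2⟩ := h.mark i x hx
      rcases Nat.lt_or_ge k (c i) with h3 | h3
      · exact ih h3
      · have : k = c i := by omega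
        exact ⟨x, this ▸ h1⟩
    · push Not at hx
      rw [h.skip i hx] at hk
      exact ih hk

end Counts

theorem Word.isSome_mono {w : Word A} {i j : ℕ} (hij : i ≤ j) (hj : (w.get? j).isSome) :
    (w.get? i).isSome := by
  by_contra hi
  rw [Option.not_isSome_iff_eq_none] at hi
  rw [Word.get?_eq_none_mono hij hi] at hj
  cases hj

namespace LTL

/-- The formula that says that the present letter is not one of those in the list. -/
def noneOf : List B → LTL B
  | [] => .tt
  | y :: l => .and (.neg (.atom y)) (noneOf l)

theorem sat_noneOf {v : Word B} {i : ℕ} {l : List B} :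
    LTL.Sat v (noneOf l) i ↔ ∀ y ∈ l, v.get? i ≠ some y := by
  induction l with
  | nil => simp [noneOf, LTL.Sat]
  | cons y l ih => simp [noneOf, LTL.Sat, ih]

/-- The translation of formulas about the recorded word; `s` is a formula that says that the present
letter records nothing. The translation holds at a position if the given formula holds in the
recorded word at the next recorded letter. -/
def translate (mk : A → B) (s : LTL B) : LTL A → LTL B
  | .tt => .tt
  | .atom x => .until s (.atom (mk x))
  | .neg φ => .neg (translate mk s φ)
  | .and φ ψ => .and (translate mk s φ) (translate mk s ψ)
  | .next φ => .until s (.and (.neg s) (.next (.until s (.and (.neg s) (translate mk s φ)))))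
  | .until φ ψ => .until (.neg (.and (.neg s) (.neg (translate mk s φ))))
      (.and (.neg s) (translate mk s ψ))

/-- If `s` holds exactly at the positions that record nothing, then a translated formula holds at a
position exactly if the formula holds at the corresponding position of the recorded word. This
includes positions after the last recorded letter, which correspond to the end of the recorded
word. -/
theorem sat_translate {mk : A → B} {v : Word B} {d : Word A} {c : ℕ → ℕ} (h : Counts mk v d c)
    {s : LTL B} (hs : ∀ i, LTL.Sat v s i ↔ ∀ x, v.get? i ≠ some (mk x)) (φ : LTL A) :
    ∀ i, LTL.Sat v (translate mk s φ) i ↔ LTL.Sat d φ (c i) := by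
  have hns : ∀ i, ¬ LTL.Sat v s i ↔ ∃ x, v.get? i = some (mk x) := by
    intro i; rw [hs]; push Not; rfl
  -- looking for the next recorded letter
  have hnext : ∀ (p : LTL B) i, LTL.Sat v (.until s (.and (.neg s) p)) i ↔
      ∃ j x, i ≤ j ∧ c j = c i ∧ v.get? j = some (mk x) ∧ LTL.Sat v p j := by
    intro p i
    constructor
    · rintro ⟨j, hij, _, ⟨h1, h2⟩, h3⟩
      obtain ⟨x, hx⟩ := (hns j).mp h1
      exact ⟨j, x, hij, h.eq_of_skip hij fun k hk hkj => (hs k).mp (h3 k hk hkj), hx, h2⟩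
    · rintro ⟨j, x, hij, hc, hx, hp⟩
      refine ⟨j, hij, by rw [hx]; rfl, ⟨(hns j).mpr ⟨x, hx⟩, hp⟩, fun k hk hkj => ?_⟩
      rw [hs]
      intro z hz
      have h1 := h.lt_of_mark hz hkj
      have h2 := h.mono hk
      omega
  induction φ with
  | tt => intro i; exact Iff.rfl
  | atom x =>
    intro i
    constructor
    · rintro ⟨j, hij, _, h2, h3⟩
      have hc := h.eq_of_skip hij fun k hk hkj => (hs k).mp (h3 k hk hkj)
      have := (h.mark j x h2).1
      rwa [hc] at this
    · intro hx
      obtain ⟨j, hij, _, hj, hk⟩ := h.next hx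
      exact ⟨j, hij, by rw [hj]; rfl, hj, fun k h1 h2 => (hs k).mpr (hk k h1 h2)⟩
  | neg φ ih => intro i; exact not_congr (ih i)
  | and φ ψ ih1 ih2 => intro i; exact and_congr (ih1 i) (ih2 i)
  | next φ ih =>
    intro i
    rw [translate, hnext]
    constructor
    · rintro ⟨j, x, _, hc, hx, _, hn⟩
      rw [hnext] at hn
      obtain ⟨j', x', _, hc', hx', hφ⟩ := hn
      have h1 := (h.mark j x hx).2
      have h2 := (h.mark j' x' hx').1
      rw [ih, hc', h1, hc] at hφ
      rw [hc', h1, hc] at h2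
      exact ⟨by rw [h2]; rfl, hφ⟩
    · rintro ⟨h1, h2⟩
      obtain ⟨x, hx⟩ := Option.isSome_iff_exists.mp (Word.isSome_mono (Nat.le_succ (c i)) h1)
      obtain ⟨j, hij, hc, hj, _⟩ := h.next hx
      have hcj := (h.mark j x hj).2
      rw [hc] at hcj
      obtain ⟨x', hx'⟩ := Option.isSome_iff_exists.mp h1
      rw [← hcj] at hx'
      obtain ⟨j', hij', hc', hj', _⟩ := h.next hx'
      refine ⟨j, x, hij, hc, hj, Word.isSome_mono hij' (by rw [hj']; rfl), ?_⟩
      rw [hnext]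
      exact ⟨j', x', hij', hc', hj', by rw [ih, hc', hcj]; exact h2⟩
  | _ φ ψ ih1 ih2 =>
    intro i
    constructor
    · rintro ⟨j, hij, _, ⟨h1, h2⟩, h3⟩
      obtain ⟨x, hx⟩ := (hns j).mp h1
      have hd := (h.mark j x hx).1
      refine ⟨c j, h.mono hij, by rw [hd]; rfl, (ih2 j).mp h2, fun k hk hkj => ?_⟩
      obtain ⟨z, hz⟩ := h.isSome_of_lt hkj
      obtain ⟨p, rfl, hp⟩ := h.surj k z hz
      have hip := h.le_of_mark hp hk
      have hpj : p < j := by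
        by_contra! hle
        have := h.mono hle
        omega
      have := h3 p hip hpj
      rw [← ih1]
      by_contra hcon
      exact this ⟨(hns p).mpr ⟨z, hp⟩, hcon⟩
    · rintro ⟨k, hk, hks, h2, h3⟩
      obtain ⟨z, hz⟩ := Option.isSome_iff_exists.mp hks
      obtain ⟨p, rfl, hp⟩ := h.surj k z hz
      refine ⟨p, h.le_of_mark hp hk, by rw [hp]; rfl, ⟨(hns p).mpr ⟨z, hp⟩, (ih2 p).mpr h2⟩, ?_⟩
      rintro q hq hqp ⟨h4, h5⟩
      obtain ⟨y, hy⟩ := (hns q).mp h4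
      exact h5 ((ih1 q).mpr (h3 (c q) (h.mono hq) (h.lt_of_mark hy hqp)))

/-- The recorded word satisfies `φ` and the letter `bad` does not occur. -/
def record (mk : A → B) (marks : List B) (bad : B) (φ : LTL A) : LTL B :=
  .and (translate mk (noneOf marks) φ) (.neg (.until .tt (.atom bad)))

theorem mem_lang_record {mk : A → B} {v : Word B} {d : Word A} {c : ℕ → ℕ}
    (h : Counts mk v d c) {marks : List B} (hm : ∀ y, y ∈ marks ↔ ∃ x, y = mk x) (bad : B)
    (φ : LTL A) : v ∈ (record mk marks bad φ).lang ↔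
      d ∈ φ.lang ∧ ∀ k, v.get? k ≠ some bad := by
  refine and_congr ?_ ?_
  · rw [sat_translate h (fun i => ?_), h.zero]
    · rfl
    · rw [sat_noneOf]
      constructor
      · intro h x; exact h _ ((hm _).mpr ⟨x, rfl⟩)
      · rintro h y hy
        obtain ⟨x, rfl⟩ := (hm y).mp hy
        exact h x
  · constructor
    · intro h k hk
      exact h ⟨k, Nat.zero_le k, by rw [hk]; rfl, hk, fun _ _ _ => trivial⟩
    · rintro h ⟨k, _, _, hk, _⟩
      exact h k hk

end LTL

namespace Buchi

/-- The state `q`, right after a recorded letter (or at the beginning). -/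
def fresh (q : Data) : Data := .cons .nil q

/-- The state `q`, after a letter that records nothing. -/
def stale (q : Data) : Data := .cons (.cons .nil .nil) q

/-- The automaton for the words that consist of letters from `ign` and of letters that record a word
accepted by the given automaton. Infinitely many recorded letters are required in infinite words:
only fresh states count for the Büchi condition. -/
def record (mk : A → B) (ign : List B) (ℬ : Buchi A) : Buchi B where
  init := fresh ℬ.init
  trans := (ℬ.trans.flatMap fun t =>
      [(fresh t.1, mk t.2.1, fresh t.2.2), (stale t.1, mk t.2.1, fresh t.2.2)]) ++
    (ℬ.init :: ℬ.trans.map fun t => t.2.2).flatMap fun q => ign.flatMap fun y =>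
      [(fresh q, y, stale q), (stale q, y, stale q)]
  final := ℬ.final.flatMap fun q => [fresh q, stale q]
  rep := ℬ.rep.map fresh

theorem mem_record_trans {mk : A → B} {ign : List B} {ℬ : Buchi A} {t : Data × B × Data} :
    t ∈ (ℬ.record mk ign).trans ↔
      (∃ p x q, (p, x, q) ∈ ℬ.trans ∧
        (t = (fresh p, mk x, fresh q) ∨ t = (stale p, mk x, fresh q))) ∨
      ∃ q, (q = ℬ.init ∨ ∃ p x, (p, x, q) ∈ ℬ.trans) ∧ ∃ y ∈ ign,
        (t = (fresh q, y, stale q) ∨ t = (stale q, y, stale q)) := by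
  simp only [record, List.mem_append, List.mem_flatMap, List.mem_cons, List.not_mem_nil, or_false,
    List.mem_map, Prod.exists]
  refine or_congr Iff.rfl (exists_congr fun q => and_congr (or_congr Iff.rfl ?_) Iff.rfl)
  constructor
  · rintro ⟨p, x, q', h, rfl⟩; exact ⟨p, x, h⟩
  · rintro ⟨p, x, h⟩; exact ⟨p, x, q, h, rfl⟩

/-- The states of an accepting run at the positions of recorded letters, with the tags removed, form
an accepting run on the recorded word. -/
theorem mem_lang_of_record {mk : A → B} (hmk : Function.Injective mk) {v : Word B} {d : Word A}
    {c : ℕ → ℕ} (h : Counts mk v d c) {ign : List B} (hign : ∀ y ∈ ign, ∀ x, mk x ≠ y)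
    {ℬ : Buchi A} (hv : v ∈ (ℬ.record mk ign).lang) :
    d ∈ ℬ.lang ∧ ∀ k y, v.get? k = some y → (∃ x, y = mk x) ∨ y ∈ ign := by
  classical
  obtain ⟨r, hr0, hr1, hr2, hr3⟩ := hv
  have hstep : ∀ i y, v.get? i = some y →
      (∃ x, y = mk x ∧ ((r i).snd, x, (r (i + 1)).snd) ∈ ℬ.trans) ∨
      (y ∈ ign ∧ (r (i + 1)).snd = (r i).snd ∧ ∀ q, r (i + 1) ≠ fresh q) := by
    intro i y hy
    have hm := hr1 i y hy
    rw [mem_record_trans] at hm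
    rcases hm with ⟨p, x, q, hpq, h4 | h4⟩ | ⟨q, _, y', hy', h4 | h4⟩ <;>
      simp only [Prod.mk.injEq] at h4 <;> obtain ⟨h5, rfl, h6⟩ := h4 <;> rw [h5, h6]
    · exact .inl ⟨x, rfl, hpq⟩
    · exact .inl ⟨x, rfl, hpq⟩
    · exact .inr ⟨hy', rfl, fun q => by simp [fresh, stale]⟩
    · exact .inr ⟨hy', rfl, fun q => by simp [fresh, stale]⟩
  have hlet : ∀ k y, v.get? k = some y → (∃ x, y = mk x) ∨ y ∈ ign := by
    intro k y hy
    rcases hstep k y hy with ⟨x, hx, _⟩ | ⟨hy, _⟩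
    · exact .inl ⟨x, hx⟩
    · exact .inr hy
  refine ⟨?_, hlet⟩
  -- positions up to the end of `v`
  let Valid : ℕ → Prop := fun i => ∀ j, j < i → (v.get? j).isSome
  have hskip : ∀ i j, i ≤ j → c i = c j → Valid j → (r j).snd = (r i).snd := by
    intro i j hij
    induction j, hij using Nat.le_induction with
    | base => intro _ _; rfl
    | succ j hj ih =>
      intro hc hval
      have h1 := h.mono hj
      have h2 : c j ≤ c (j + 1) := h.mono (Nat.le_succ j)
      obtain ⟨y, hy⟩ := Option.isSome_iff_exists.mp (hval j (Nat.lt_succ_self j))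
      rcases hstep j y hy with ⟨x, rfl, _⟩ | ⟨_, h3, _⟩
      · have := (h.mark j x hy).2; omega
      · rw [h3]; exact ih (by omega) fun k hk => hval k (by omega)
  have hsame : ∀ i j, c i = c j → Valid i → Valid j → (r j).snd = (r i).snd := by
    intro i j hc hi hj
    rcases le_total i j with hij | hij
    · exact hskip i j hij hc hj
    · exact (hskip j i hij hc.symm hi).symm
  let σ : ℕ → ℕ := fun k => if hk : ∃ i, c i = k ∧ Valid i then hk.choose else 0
  have hσ : ∀ i, Valid i → (r (σ (c i))).snd = (r i).snd := by
    intro i hi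
    have hk : ∃ j, c j = c i ∧ Valid j := ⟨i, rfl, hi⟩
    simp only [σ, dif_pos hk]
    exact hsame _ _ hk.choose_spec.1.symm hi hk.choose_spec.2
  have hval : ∀ {i y}, v.get? i = some y → Valid i ∧ Valid (i + 1) := by
    intro i y hy
    have hs : (v.get? i).isSome := by rw [hy]; rfl
    exact ⟨fun j hj => Word.isSome_mono hj.le hs,
      fun j hj => Word.isSome_mono (Nat.lt_succ_iff.mp hj) hs⟩
  -- infinite words contain infinitely many recorded letters
  have hvinf : ∀ f, v = .inf f → ∀ N, ∃ i, N ≤ i ∧ ∃ x, v.get? i = some (mk x) := by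
    intro f hf N
    obtain ⟨i, hi, hrep⟩ := hr3 f hf (N + 1)
    obtain ⟨j, rfl⟩ : ∃ j, i = j + 1 := ⟨i - 1, by omega⟩
    obtain ⟨q, _, hq⟩ := List.mem_map.mp hrep
    refine ⟨j, by omega, ?_⟩
    have hy : v.get? j = some (f j) := by rw [hf]; rfl
    rcases hstep j _ hy with ⟨x, hx, _⟩ | ⟨_, _, h3⟩
    · exact ⟨x, by rw [hy, hx]⟩
    · exact absurd hq.symm (h3 q)
  refine ⟨fun k => (r (σ k)).snd, ?_, fun k x hk => ?_, fun l hl => ?_, fun f hf N => ?_⟩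
  · have h0 := hσ 0 fun j hj => absurd hj (Nat.not_lt_zero j)
    rw [h.zero] at h0
    beta_reduce
    rw [h0, hr0]; rfl
  · obtain ⟨i, rfl, hi⟩ := h.surj k x hk
    obtain ⟨hv1, hv2⟩ := hval hi
    beta_reduce
    rw [← (h.mark i x hi).2, hσ i hv1, hσ (i + 1) hv2]
    rcases hstep i _ hi with ⟨x', hx', ht⟩ | ⟨hy, _⟩
    · rwa [hmk hx']
    · exact absurd rfl (hign _ hy x)
  · cases hv : v with
    | inf g =>
      exfalso
      have hbig : ∀ n, ∃ i, n ≤ c i := by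
        intro n
        induction n with
        | zero => exact ⟨0, Nat.zero_le _⟩
        | succ n ih =>
          obtain ⟨i, hi⟩ := ih
          obtain ⟨j, hj, x, hx⟩ := hvinf g hv i
          exact ⟨j + 1, by have := h.mono hj; rw [(h.mark j x hx).2]; omega⟩
      obtain ⟨i, hi⟩ := hbig (l.length + 1)
      obtain ⟨x, hx⟩ := h.isSome_of_lt (k := l.length) hi
      rw [hl] at hx
      simp [Word.get?] at hx
    | fin l' =>
      have hvl : Valid l'.length := fun j hj => by
        rw [hv]; simp [Word.get?, hj]
      have hc : c l'.length = l.length := by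
        apply le_antisymm
        · by_contra! hlt
          obtain ⟨x, hx⟩ := h.isSome_of_lt hlt
          rw [hl] at hx
          simp [Word.get?] at hx
        · by_contra! hlt
          have : d.get? (c l'.length) = some l[c l'.length] := by
            rw [hl]; exact List.getElem?_eq_getElem hlt
          obtain ⟨j, hj, _, hx, _⟩ := h.next this
          rw [hv] at hx
          have := (List.getElem?_eq_some_iff.mp hx).1
          omega
      beta_reduce
      rw [← hc, hσ _ hvl]
      have := hr2 l' hv
      simp only [record, List.mem_flatMap, List.mem_cons, List.not_mem_nil, or_false] at this
      obtain ⟨q, hq, h1 | h1⟩ := this <;> rw [h1] <;> exact hq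
  · cases hv : v with
    | fin l' =>
      exfalso
      obtain ⟨i, hi, hx⟩ := h.surj (c l'.length) (f (c l'.length)) (by rw [hf]; rfl)
      have hle : l'.length ≤ i := h.le_of_mark hx hi.ge
      rw [hv] at hx
      have := (List.getElem?_eq_some_iff.mp hx).1
      omega
    | inf g =>
      have hall : ∀ i, Valid i := fun i j _ => by rw [hv]; rfl
      obtain ⟨M, hM, _⟩ := h.surj N (f N) (by rw [hf]; rfl)
      obtain ⟨i, hi, hrep⟩ := hr3 g hv M
      obtain ⟨q, hq, hq'⟩ := List.mem_map.mp hrep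
      refine ⟨c i, by rw [← hM]; exact h.mono hi, ?_⟩
      beta_reduce
      rw [hσ i (hall i), ← hq']
      exact hq

/-- An accepting run on the recorded word yields one on `v`, which repeats states at the letters
that record nothing. If `v` is infinite then the recorded word has to be infinite, too. -/
theorem mem_lang_record {mk : A → B} {v : Word B} {d : Word A}
    {c : ℕ → ℕ} (h : Counts mk v d c) {ign : List B} (hign : ∀ y ∈ ign, ∀ x, mk x ≠ y)
    {ℬ : Buchi A} (hd : d ∈ ℬ.lang)
    (hv : ∀ k y, v.get? k = some y → (∃ x, y = mk x) ∨ y ∈ ign)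
    (hinf : (∃ f, v = .inf f) → ∃ f, d = .inf f) : v ∈ (ℬ.record mk ign).lang := by
  classical
  obtain ⟨r, hr0, hr1, hr2, hr3⟩ := hd
  let r' : ℕ → Data := fun i =>
    if ∀ j, i = j + 1 → ∃ x, v.get? j = some (mk x) then fresh (r (c i)) else stale (r (c i))
  have hr' : ∀ i, r' i = fresh (r (c i)) ∨ r' i = stale (r (c i)) := by
    intro i; simp only [r']; split_ifs <;> simp
  have hfresh : ∀ i x, v.get? i = some (mk x) → r' (i + 1) = fresh (r (c (i + 1))) := by
    intro i x hx
    simp only [r']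
    rw [if_pos]
    intro j hj
    cases hj
    exact ⟨x, hx⟩
  refine ⟨r', ?_, fun i y hy => ?_, fun l hl => ?_, fun f hf N => ?_⟩
  · simp only [r']
    rw [if_pos (fun j hj => by omega), h.zero, hr0]; rfl
  · rw [mem_record_trans]
    rcases hv i y hy with ⟨x, rfl⟩ | hyi
    · left
      obtain ⟨h1, h2⟩ := h.mark i x hy
      refine ⟨r (c i), x, r (c i + 1), hr1 _ _ h1, ?_⟩
      rw [hfresh i x hy, h2]
      rcases hr' i with h3 | h3 <;> rw [h3] <;> simp
    · right
      have hns : ∀ x, v.get? i ≠ some (mk x) := by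
        intro x hx
        rw [hy] at hx
        exact hign y hyi x (Option.some.inj hx).symm
      have h2 := h.skip i hns
      have h4 : r' (i + 1) = stale (r (c i)) := by
        simp only [r']
        rw [if_neg, h2]
        intro hcon
        obtain ⟨x, hx⟩ := hcon i rfl
        exact hns x hx
      refine ⟨r (c i), ?_, y, hyi, ?_⟩
      · rcases Nat.eq_zero_or_pos (c i) with h0 | h0
        · left; rw [h0, hr0]
        · right
          obtain ⟨x, hx⟩ := h.isSome_of_lt (i := i) (k := c i - 1) (by omega)
          have := hr1 _ _ hx
          rw [Nat.sub_add_cancel h0] at this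
          exact ⟨_, x, this⟩
      · rw [h4]
        rcases hr' i with h3 | h3 <;> rw [h3] <;> simp
  · have hnone : d.get? (c l.length) = none := by
      by_contra hne
      obtain ⟨x, hx⟩ := Option.ne_none_iff_exists'.mp hne
      obtain ⟨j, hj, _, hj', _⟩ := h.next hx
      rw [hl] at hj'
      have := (List.getElem?_eq_some_iff.mp hj').1
      omega
    cases hd : d with
    | inf g => rw [hd] at hnone; cases hnone
    | fin l' =>
      have hc : c l.length = l'.length := by
        apply le_antisymm
        · by_contra! hlt
          obtain ⟨x, hx⟩ := h.isSome_of_lt hlt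
          rw [hd] at hx
          simp [Word.get?] at hx
        · rw [hd] at hnone
          exact List.getElem?_eq_none_iff.mp hnone
      have hfin := hr2 l' hd
      rw [← hc] at hfin
      simp only [record, List.mem_flatMap, List.mem_cons, List.not_mem_nil, or_false]
      exact ⟨_, hfin, hr' _⟩
  · obtain ⟨g, hg⟩ := hinf ⟨f, hf⟩
    obtain ⟨k, hk, hrep⟩ := hr3 g hg (c N + 1)
    obtain ⟨k, rfl⟩ : ∃ j, k = j + 1 := ⟨k - 1, by omega⟩
    obtain ⟨i, rfl, hi⟩ := h.surj k (g k) (by rw [hg]; rfl)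
    have hNi : N ≤ i := h.le_of_mark hi (by omega)
    refine ⟨i + 1, by omega, ?_⟩
    rw [hfresh i _ hi, (h.mark i _ hi).2]
    exact List.mem_map.mpr ⟨_, hrep, rfl⟩

end Buchi

end Properties
end ParamSys

namespace ParamSys

/-! ### Correctness of the simulation -/

section Correctness

variable {m : ℕ} {V V' S T : Type*}

/-- The letters of the leader that record actions, for a list of all operations. -/
def markLetters (ι : Msg m V → V') (ops : List (RegOp m V)) : List (RegOp 1 V') :=
  ops.flatMap fun a => [wr ι (.ack a), wr ι (.exec a)]

/-- The letters of the leader that record nothing and are harmless, for lists of all operations and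
of all register contents. -/
def idleLetters (ι : Msg m V → V') (ops : List (RegOp m V)) (stops : List (Fin m → V)) :
    List (RegOp 1 V') :=
  (ops.map fun a => rd ι (.req a)) ++ stops.map fun ρ => wr ι (.halt ρ)

theorem mem_markLetters {ι : Msg m V → V'} {ops : List (RegOp m V)} (hops : ∀ a, a ∈ ops)
    (y : RegOp 1 V') : y ∈ markLetters ι ops ↔ ∃ x, y = mark ι x := by
  simp only [markLetters, List.mem_flatMap, List.mem_cons, List.not_mem_nil, or_false]
  constructor
  · rintro ⟨a, _, h | h⟩
    · exact ⟨.inl a, h⟩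
    · exact ⟨.inr a, h⟩
  · rintro ⟨a | a, h⟩
    · exact ⟨a, hops a, .inl h⟩
    · exact ⟨a, hops a, .inr h⟩

theorem mem_idleLetters {ι : Msg m V → V'} {ops : List (RegOp m V)} {stops : List (Fin m → V)}
    (hops : ∀ a, a ∈ ops) (hstops : ∀ ρ, ρ ∈ stops) (y : RegOp 1 V') :
    y ∈ idleLetters ι ops stops ↔ (∃ a, y = rd ι (.req a)) ∨ ∃ ρ, y = wr ι (.halt ρ) := by
  simp only [idleLetters, List.mem_append, List.mem_map, hops, hstops, true_and, eq_comm]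

theorem mark_ne_rd (ι : Msg m V → V') (x : Act m V) (z : Msg m V) : mark ι x ≠ rd ι z := by
  cases x <;> simp [mark]

theorem mark_ne_halt {ι : Msg m V → V'} (hι : Function.Injective ι) (x : Act m V)
    (ρ : Fin m → V) : mark ι x ≠ wr ι (.halt ρ) := by
  cases x <;> simp [mark, hι.eq_iff]

theorem mark_ne_bad {ι : Msg m V → V'} (hι : Function.Injective ι) (x : Act m V) :
    mark ι x ≠ wr ι .bad := by
  cases x <;> simp [mark, hι.eq_iff]

theorem exists_counts_mark {ι : Msg m V → V'} (hι : Function.Injective ι)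
    {v : Word (RegOp 1 V')} {d : Word (Act m V)}
    (h : Word.IsConcat (fun _ => unmark ι) v d) : ∃ c, Counts (mark ι) v d c :=
  exists_counts (unmark_mark hι) (fun _ => unmark_eq_nil) h

/-- The automaton `Buchi.record` need not exclude `bad` explicitly, since this letter neither
records an action nor belongs to the idle letters. -/
theorem hasMaximalTraceIn_iff_oneReg_buchi {ι : Msg m V → V'} (hι : Function.Injective ι)
    (sys : CDSystem m V S T) {ops : List (RegOp m V)} {stops : List (Fin m → V)}
    (hops : ∀ a, a ∈ ops) (hstops : ∀ ρ, ρ ∈ stops) (ℬ : Buchi (Act m V))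
    (hℬ : CExpanding ℬ.lang) :
    sys.HasMaximalTraceIn ℬ.lang ↔ (oneReg ι sys).HasMaximalTraceWithLeaderProjIn
      (ℬ.record (mark ι) (idleLetters ι ops stops)).lang := by
  have hign : ∀ y ∈ idleLetters ι ops stops, ∀ x, mark ι x ≠ y := by
    intro y hy x
    rcases (mem_idleLetters hops hstops y).mp hy with ⟨a, rfl⟩ | ⟨ρ, rfl⟩
    · exact mark_ne_rd ι x _
    · exact mark_ne_halt hι x ρ
  constructor
  · refine oneReg_of_hasMaximalTraceIn hι sys fun v d hvd hd hv hinf => ?_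
    obtain ⟨c, hc⟩ := exists_counts_mark hι hvd
    refine Buchi.mem_lang_record hc hign hd (fun k y hy => ?_) hinf
    rcases hv k y hy with h | h
    · exact .inl h
    · exact .inr ((mem_idleLetters hops hstops y).mpr h)
  · refine hasMaximalTraceIn_of_oneReg hι sys hℬ fun v hv d hvd => ?_
    obtain ⟨c, hc⟩ := exists_counts_mark hι hvd
    obtain ⟨h1, h2⟩ := Buchi.mem_lang_of_record (mark_injective hι) hc hign hv
    refine ⟨h1, fun k hk => ?_⟩
    rcases h2 k _ hk with ⟨x, hx⟩ | hx
    · exact mark_ne_bad hι x hx.symm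
    · rcases (mem_idleLetters hops hstops _).mp hx with ⟨a, ha⟩ | ⟨ρ, hρ⟩
      · cases ha
      · simp [hι.eq_iff] at hρ

theorem hasMaximalTraceIn_iff_oneReg_ltl {ι : Msg m V → V'} (hι : Function.Injective ι)
    (sys : CDSystem m V S T) {ops : List (RegOp m V)} (hops : ∀ a, a ∈ ops) (φ : LTL (Act m V))
    (hφ : CExpanding φ.lang) :
    sys.HasMaximalTraceIn φ.lang ↔ (oneReg ι sys).HasMaximalTraceWithLeaderProjIn
      (LTL.record (mark ι) (markLetters ι ops) (wr ι .bad) φ).lang := by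
  constructor
  · refine oneReg_of_hasMaximalTraceIn hι sys fun v d hvd hd hv _ => ?_
    obtain ⟨c, hc⟩ := exists_counts_mark hι hvd
    refine (LTL.mem_lang_record hc (mem_markLetters hops) _ φ).mpr ⟨hd, fun k hk => ?_⟩
    rcases hv k _ hk with ⟨x, hx⟩ | ⟨a, ha⟩ | ⟨ρ, hρ⟩
    · exact mark_ne_bad hι x hx.symm
    · cases ha
    · simp [hι.eq_iff] at hρ
  · refine hasMaximalTraceIn_of_oneReg hι sys hφ fun v hv d hvd => ?_
    obtain ⟨c, hc⟩ := exists_counts_mark hι hvd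
    exact (LTL.mem_lang_record hc (mem_markLetters hops) _ φ).mp hv

instance [Finite V] : Finite (RegOp m V) :=
  Finite.of_surjective (fun x : (Fin m × V) ⊕ (Fin m × V) => match x with
    | .inl p => RegOp.read p.1 p.2
    | .inr p => RegOp.write p.1 p.2) fun a => by
      cases a with
      | read i g => exact ⟨.inl (i, g), rfl⟩
      | write i g => exact ⟨.inr (i, g), rfl⟩

instance [Finite V] : Finite (Msg m V) :=
  Finite.of_surjective (fun x : Bool ⊕ RegOp m V ⊕ RegOp m V ⊕ RegOp m V ⊕ (Fin m → V) =>
    match x with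
    | .inl true => Msg.init
    | .inl false => Msg.bad
    | .inr (.inl a) => Msg.req a
    | .inr (.inr (.inl a)) => Msg.ack a
    | .inr (.inr (.inr (.inl a))) => Msg.exec a
    | .inr (.inr (.inr (.inr ρ))) => Msg.halt ρ) fun a => by
      cases a with
      | init => exact ⟨.inl true, rfl⟩
      | bad => exact ⟨.inl false, rfl⟩
      | req a => exact ⟨.inr (.inl a), rfl⟩
      | ack a => exact ⟨.inr (.inr (.inl a)), rfl⟩
      | exec a => exact ⟨.inr (.inr (.inr (.inl a))), rfl⟩
      | halt ρ => exact ⟨.inr (.inr (.inr (.inr ρ))), rfl⟩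

theorem exists_complete_list (α : Type*) [Finite α] : ∃ l : List α, ∀ a, a ∈ l := by
  have := Fintype.ofFinite α
  exact ⟨Finset.univ.toList, fun a => by simp⟩

end Correctness
end ParamSys

namespace ParamSys
open Enc

/-! ### Simulations between systems with one register -/

section Transfer

/-- The graph of `F` on the invariant set `W` is a bisimulation, so runs can be mapped along `F` and
lifted. -/
theorem exists_run_iff_of_bisim {X Y A : Type*} {step₁ : X → A → X → Prop}
    {step₂ : Y → A → Y → Prop} (F : X → Y) (W : X → Prop)
    (hF : ∀ x, W x → ∀ a y, step₂ (F x) a y ↔ ∃ x', step₁ x a x' ∧ y = F x')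
    (hW : ∀ x a x', W x → step₁ x a x' → W x') {x₀ : X} (h₀ : W x₀) (Q : (ℕ → Option A) → Prop) :
    (∃ γ lab, γ 0 = x₀ ∧ Run step₁ γ lab ∧ Q lab) ↔
      ∃ γ lab, γ 0 = F x₀ ∧ Run step₂ γ lab ∧ Q lab := by
  have hdead : ∀ x, W x → (Dead step₁ x ↔ Dead step₂ (F x)) := by
    intro x hx
    constructor
    · intro hd a y hs
      obtain ⟨x', hs', _⟩ := (hF x hx a y).mp hs
      exact hd a x' hs'
    · intro hd a x' hs
      exact hd a (F x') ((hF x hx a _).mpr ⟨x', hs, rfl⟩)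
  constructor
  · rintro ⟨γ, lab, h0, hrun, hQ⟩
    have hWγ : ∀ i, W (γ i) := by
      intro i
      induction i with
      | zero => rw [h0]; exact h₀
      | succ i ih =>
        rcases hrun i with ⟨a, _, hs⟩ | ⟨_, hs, _⟩
        · exact hW _ _ _ ih hs
        · rw [hs]; exact ih
    refine ⟨fun i => F (γ i), lab, by beta_reduce; rw [h0], fun i => ?_, hQ⟩
    rcases hrun i with ⟨a, ha, hs⟩ | ⟨hn, hs, hd⟩
    · exact .inl ⟨a, ha, (hF _ (hWγ i) _ _).mpr ⟨_, hs, rfl⟩⟩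
    · exact .inr ⟨hn, congrArg F hs, (hdead _ (hWγ i)).mp hd⟩
  · rintro ⟨γ, lab, h0, hrun, hQ⟩
    obtain ⟨δ, hδ0, hδ⟩ := exists_seq (fun i x => γ i = F x ∧ W x)
      (fun i x x' => (∃ a, lab i = some a ∧ step₁ x a x') ∨
        (lab i = none ∧ x' = x ∧ Dead step₁ x)) (g₀ := x₀) ⟨h0, h₀⟩ (by
        rintro i x ⟨hx, hWx⟩
        rcases hrun i with ⟨a, ha, hs⟩ | ⟨hn, hs, hd⟩
        · rw [hx] at hs
          obtain ⟨x', hs', hx'⟩ := (hF x hWx _ _).mp hs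
          exact ⟨x', ⟨hx', hW _ _ _ hWx hs'⟩, .inl ⟨a, ha, hs'⟩⟩
        · rw [hx] at hd
          exact ⟨x, ⟨hs.trans hx, hWx⟩, .inr ⟨hn, rfl, (hdead x hWx).mpr hd⟩⟩)
    exact ⟨δ, lab, hδ0, fun i => (hδ i).2, hQ⟩

/-- A functional bisimulation between the processes of two systems preserves their traces. -/
theorem hasMaximalTraceWithLeaderProjIn_iff_of_bisim {m : ℕ} {V S₁ S₂ T₁ T₂ : Type*}
    (sys₁ : CDSystem m V S₁ T₁) (sys₂ : CDSystem m V S₂ T₂) (f : S₁ → S₂) (g : T₁ → T₂)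
    (WS : S₁ → Prop) (WT : T₁ → Prop)
    (hf : ∀ s, WS s → ∀ a y, sys₂.contrib.step (f s) a y ↔
      ∃ s', sys₁.contrib.step s a s' ∧ y = f s')
    (hg : ∀ t, WT t → ∀ a y, sys₂.leader.step (g t) a y ↔
      ∃ t', sys₁.leader.step t a t' ∧ y = g t')
    (hWS : ∀ s a s', WS s → sys₁.contrib.step s a s' → WS s')
    (hWT : ∀ t a t', WT t → sys₁.leader.step t a t' → WT t')
    (hS₀ : WS sys₁.contrib.init) (hT₀ : WT sys₁.leader.init)
    (hS : sys₂.contrib.init = f sys₁.contrib.init) (hT : sys₂.leader.init = g sys₁.leader.init)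
    (hR : sys₂.regInit = sys₁.regInit) (Q : Set (Word (RegOp m V))) :
    sys₁.HasMaximalTraceWithLeaderProjIn Q ↔ sys₂.HasMaximalTraceWithLeaderProjIn Q := by
  rw [hasMaximalTraceWithLeaderProjIn_iff, hasMaximalTraceWithLeaderProjIn_iff]
  refine exists_congr fun n => ?_
  let F : Config m V S₁ T₁ → Config m V S₂ T₂ := fun c => ⟨c.pop.map f, g c.lead, c.regs⟩
  have h0 : sys₂.initConfig n = F (sys₁.initConfig n) := by
    simp [F, CDSystem.initConfig, hS, hT, hR]
  rw [h0]
  refine exists_run_iff_of_bisim (step₁ := sys₁.Step) (step₂ := sys₂.Step) F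
    (fun c => (∀ s ∈ c.pop, WS s) ∧ WT c.lead) ?_ ?_ ?_
    (fun lab => ∃ v ∈ Q, Lim (pre fun i => leaderLetters (lab i)) v)
  · rintro ⟨M, t, ρ⟩ ⟨hM, ht⟩ o c
    simp only at hM ht
    rw [CDSystem.step_iff]
    constructor
    · rintro (⟨s, s', a, N, ρ', hK, h1, h2, rfl, rfl⟩ | ⟨t', a, ρ', h1, h2, rfl, rfl⟩)
      · classical
        obtain ⟨s₀, hs₀, rfl, rfl⟩ := (Multiset.map_eq_cons _ _ _ _).mpr hK
        obtain ⟨s₁, h3, rfl⟩ := (hf s₀ (hM s₀ hs₀) _ _).mp h1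
        refine ⟨⟨s₁ ::ₘ M.erase s₀, t, ρ'⟩, ?_, by simp [F]⟩
        rw [CDSystem.step_iff]
        exact .inl ⟨s₀, s₁, a, _, ρ', (Multiset.cons_erase hs₀).symm, h3, h2, rfl, rfl⟩
      · obtain ⟨t₁, h3, rfl⟩ := (hg t ht _ _).mp h1
        exact ⟨⟨M, t₁, ρ'⟩, .leader h3 h2, rfl⟩
    · rintro ⟨c', h1, rfl⟩
      rw [CDSystem.step_iff] at h1
      rcases h1 with ⟨s, s', a, N, ρ', rfl, h1, h2, rfl, rfl⟩ | ⟨t', a, ρ', h1, h2, rfl, rfl⟩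
      · exact .inl ⟨f s, f s', a, N.map f, ρ', by simp,
          (hf s (hM s (Multiset.mem_cons_self _ _)) _ _).mpr ⟨s', h1, rfl⟩, h2, rfl, by simp [F]⟩
      · exact .inr ⟨g t', a, ρ', (hg t ht _ _).mpr ⟨t', h1, rfl⟩, h2, rfl, rfl⟩
  · rintro ⟨M, t, ρ⟩ o c ⟨hM, ht⟩ hs
    simp only at hM ht
    rw [CDSystem.step_iff] at hs
    rcases hs with ⟨s, s', a, N, ρ', rfl, h1, h2, rfl, rfl⟩ | ⟨t', a, ρ', h1, h2, rfl, rfl⟩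
    · refine ⟨fun x hx => ?_, ht⟩
      rcases Multiset.mem_cons.mp hx with rfl | hx
      · exact hWS _ _ _ (hM s (Multiset.mem_cons_self _ _)) h1
      · exact hM x (Multiset.mem_cons_of_mem hx)
    · exact ⟨hM, hWT _ _ _ ht h1⟩
  · refine ⟨fun s hs => ?_, hT₀⟩
    rw [Multiset.eq_of_mem_replicate hs]
    exact hS₀

end Transfer

/-! ### Injectivity of encodings -/

theorem encNat_injective : Function.Injective encNat := by
  intro i j h
  induction i generalizing j with
  | zero => cases j with
    | zero => rfl
    | succ j => cases h
  | succ i ih => cases j with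
    | zero => cases h
    | succ j => simp only [encNat, Data.cons.injEq, true_and] at h; rw [ih h]

theorem encList_injective {α : Type*} [Enc α] (h : Function.Injective (enc : α → Data)) :
    Function.Injective (encList : List α → Data) := by
  intro l l' hl
  induction l generalizing l' with
  | nil => cases l' with
    | nil => rfl
    | cons => cases hl
  | cons a l ih => cases l' with
    | nil => cases hl
    | cons b l' =>
      simp only [encList, Data.cons.injEq] at hl
      rw [h hl.1, ih hl.2]

theorem enc_val_injective {G : List Data} : Function.Injective (enc : Val G → Data) :=
  Subtype.val_injective

theorem enc_regOp_injective {m : ℕ} {V : Type*} [Enc V]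
    (h : Function.Injective (enc : V → Data)) : Function.Injective (enc : RegOp m V → Data) := by
  intro a b hab
  change encRegOp a = encRegOp b at hab
  cases a <;> cases b <;> simp only [encRegOp, Data.cons.injEq, reduceCtorEq, false_and] at hab
  all_goals
    obtain ⟨-, hab⟩ := hab
    change Data.cons (encNat _) (enc _) = Data.cons (encNat _) (enc _) at hab
    simp only [Data.cons.injEq] at hab
    rw [Fin.ext (encNat_injective hab.1), h hab.2]

/-- The register contents after an operation, as a list of length at most one. -/
def regNext {m : ℕ} {V : Type*} [DecidableEq V] :
    Option (RegOp m V) → (Fin m → V) → List (Fin m → V)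
  | none, ρ => [ρ]
  | some (.read i g), ρ => if ρ i = g then [ρ] else []
  | some (.write i g), ρ => [Function.update ρ i g]

theorem mem_regNext {m : ℕ} {V : Type*} [DecidableEq V] {o : Option (RegOp m V)}
    {ρ ρ' : Fin m → V} : ρ' ∈ regNext o ρ ↔ RegStep o ρ ρ' := by
  rcases o with _ | ⟨i, g⟩ | ⟨i, g⟩
  · simp [regNext, RegStep]
  · by_cases h : ρ i = g <;> simp [regNext, RegStep, h]
  · simp [regNext, RegStep]

section PD

variable {m : ℕ} {V : Type*} [Enc V]

/-- Register contents as a list. -/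
def encTuple (ρ : Fin m → V) : Data := enc (List.ofFn ρ)

theorem encTuple_injective (h : Function.Injective (enc : V → Data)) :
    Function.Injective (encTuple : (Fin m → V) → Data) := fun _ _ hab =>
  List.ofFn_injective (encList_injective h hab)

/-- Messages as a tag and the data of the message. -/
def encMsg : Msg m V → Data
  | .init => .cons (encNat 0) .nil
  | .bad => .cons (encNat 1) .nil
  | .req a => .cons (encNat 2) (enc a)
  | .ack a => .cons (encNat 3) (enc a)
  | .exec a => .cons (encNat 4) (enc a)
  | .halt ρ => .cons (encNat 5) (encTuple ρ)

theorem encMsg_injective (h : Function.Injective (enc : V → Data)) :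
    Function.Injective (encMsg : Msg m V → Data) := by
  intro x y hxy
  cases x <;> cases y <;>
    simp only [encMsg, encNat, Data.cons.injEq, reduceCtorEq, false_and, and_false, true_and] at hxy
  all_goals first
    | rfl
    | rw [enc_regOp_injective h hxy]
    | rw [encTuple_injective h hxy]

/-- All functions from `Fin k` to the elements of a list. For fixed `k` their number is polynomial
in the length of the list. -/
def tuples {α : Type*} (l : List α) : (k : ℕ) → List (Fin k → α)
  | 0 => [Fin.elim0]
  | k + 1 => l.flatMap fun g => (tuples l k).map fun ρ => Fin.cons g ρ

theorem mem_tuples {α : Type*} {l : List α} (hl : ∀ a, a ∈ l) :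
    ∀ (k : ℕ) (ρ : Fin k → α), ρ ∈ tuples l k
  | 0, ρ => by simp [tuples, Subsingleton.elim ρ Fin.elim0]
  | k + 1, ρ => by
    simp only [tuples, List.mem_flatMap, List.mem_map]
    exact ⟨ρ 0, hl _, Fin.tail ρ, mem_tuples hl k _, Fin.cons_self_tail ρ⟩

/-- All operations on `m` registers with values in a list. -/
def allOps (m : ℕ) {α : Type*} (l : List α) : List (RegOp m α) :=
  (List.finRange m).flatMap fun i => l.flatMap fun g => [.read i g, .write i g]

theorem mem_allOps {α : Type*} {l : List α} (hl : ∀ a, a ∈ l) (a : RegOp m α) :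
    a ∈ allOps m l := by
  simp only [allOps, List.mem_flatMap, List.mem_finRange, true_and]
  cases a with
  | read i g => exact ⟨i, g, hl g, by simp⟩
  | write i g => exact ⟨i, g, hl g, by simp⟩

/-- All messages, for lists of all operations and of all register contents. -/
def allMsgs {α : Type*} (ops : List (RegOp m α)) (stops : List (Fin m → α)) : List (Msg m α) :=
  .init :: .bad :: ((ops.flatMap fun a => [.req a, .ack a, .exec a]) ++ stops.map .halt)

theorem mem_allMsgs {α : Type*} {ops : List (RegOp m α)} {stops : List (Fin m → α)}
    (hops : ∀ a, a ∈ ops) (hstops : ∀ ρ, ρ ∈ stops) (x : Msg m α) : x ∈ allMsgs ops stops := by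
  cases x <;> simp [allMsgs, hops, hstops]

/-! ### The pushdown system with one register -/

/-- The name `x` with the numerical tag `k`; the control states of different kinds get different
tags. -/
abbrev named (k : ℕ) (x : Data) : Data := .cons (encNat k) x

/-- The control state that stands for `CState.nrm`. -/
def ctlNrm (q : Data) : Data := named 0 q
/-- The control state that stands for `CState.wait`; the transition that is waited for is performed
on the stack only when it is permitted, so its result is part of the name. -/
def ctlWait (a : RegOp m V) (tgt : Data) (push : List Data) : Data := named 1 (enc (a, tgt, push))
/-- The control state that stands for `CState.chk`. -/
def ctlChk (q : Data) (ρ : Fin m → V) : Data := named 2 (.cons q (encTuple ρ))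
/-- The control state that stands for `CState.err`. -/
def ctlErr : Data := named 3 .nil
/-- The control state that stands for `CState.sink` and for `LState.sink`. -/
def ctlSink : Data := named 4 .nil
/-- The control state that stands for `LState.boot`. -/
def ctlBoot : Data := named 5 .nil
/-- The control state that stands for `LState.run`. -/
def ctlRun (q : Data) (ρ : Fin m → V) : Data := named 6 (.cons q (encTuple ρ))
/-- The control state that stands for `LState.ackp`. -/
def ctlAckp (q : Data) (ρ : Fin m → V) (a : RegOp m V) : Data :=
  named 7 (.cons q (.cons (encTuple ρ) (enc a)))
/-- The control state that stands for `LState.ended`. -/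
def ctlEnded (q : Data) (ρ : Fin m → V) : Data := named 8 (.cons q (encTuple ρ))
/-- The control state that stands for `LState.loud`. -/
def ctlLoud : Data := named 9 .nil

variable {V' : Type*} [DecidableEq V]

/-- The transitions of the simulating contributors that come from one transition. -/
def contribRules (ι : Msg m V → V') (stops : List (Fin m → V)) (r : PDRule (RegOp m V)) :
    List (PDRule (RegOp 1 V')) :=
  r.lab.elim [⟨ctlNrm r.src, r.pop, none, ctlNrm r.tgt, r.push⟩] (fun a =>
    ⟨ctlNrm r.src, r.pop, some (wr ι (.req a)), ctlWait a r.tgt r.push, [r.pop]⟩ ::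
    ⟨ctlWait a r.tgt r.push, r.pop, some (rd ι (.ack a)), ctlNrm r.tgt, r.push⟩ ::
    stops.map fun ρ =>
      ⟨ctlWait a r.tgt r.push, r.pop, some (rd ι (.halt ρ)), ctlErr, [r.pop]⟩) ++
  (⟨ctlErr, r.pop, some (wr ι .bad), ctlSink, [r.pop]⟩ ::
    stops.flatMap fun ρ =>
      ⟨ctlNrm r.src, r.pop, some (rd ι (.halt ρ)), ctlChk r.src ρ, [r.pop]⟩ ::
      (regNext r.lab ρ).map fun _ =>
        ⟨ctlChk r.src ρ, r.pop, some (wr ι .bad), ctlSink, [r.pop]⟩)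

/-- The simulating contributor as a pushdown system. -/
def contribPD (ι : Msg m V → V') (stops : List (Fin m → V)) (𝒞 : Pushdown (RegOp m V)) :
    Pushdown (RegOp 1 V') :=
  ⟨ctlNrm 𝒞.init, 𝒞.stackInit, 𝒞.rules.flatMap (contribRules ι stops)⟩

/-- The pushdown state that represents a state of a simulating contributor. For `wait s a s'` the
string that the awaited transition pushes is recovered from the two stacks: it is what `s'` has
above the stack of `s` without its top symbol. -/
def contribState : CState m V (Data × List Data) → Data × List Data
  | .nrm s => (ctlNrm s.1, s.2)
  | .wait s a s' => (ctlWait a s'.1 (s'.2.take (s'.2.length - (s.2.length - 1))), s.2)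
  | .chk s ρ => (ctlChk s.1 ρ, s.2)
  | .err s => (ctlErr, s.2)
  | .sink s => (ctlSink, s.2)

/-- Reachable states of simulating contributors are waiting for transitions that exist. -/
def ContribWF (C : TransSys (RegOp m V) (Data × List Data)) :
    CState m V (Data × List Data) → Prop
  | .wait s a s' => C.step s (some a) s'
  | .err s => ∃ o s', C.step s o s'
  | _ => True

/-- Stack symbols of the simulated leader get a tag that distinguishes them from the bottom symbol
`nil`, which is never removed, so that the leader can serve requests even if the simulated stack is
empty. -/
def stackTag (A : Data) : Data := .cons .nil A

/-- The transitions of the simulating leader, for the lists `ctls` and `syms` of control states and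
stack symbols. -/
def leaderRules (ι : Msg m V → V') (ops : List (RegOp m V)) (stops : List (Fin m → V))
    (ρ₀ : Fin m → V) (init stackInit : Data) (rules : List (PDRule (RegOp m V)))
    (ctls syms : List Data) : List (PDRule (RegOp 1 V')) :=
  [⟨ctlBoot, .nil, none, ctlRun init ρ₀, [stackTag stackInit, .nil]⟩] ++
  (rules.flatMap fun r => stops.flatMap fun ρ => (regNext r.lab ρ).flatMap fun ρ' =>
    [⟨ctlRun r.src ρ, stackTag r.pop, r.lab.map fun b => wr ι (.exec b), ctlRun r.tgt ρ',
        r.push.map stackTag⟩,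
      ⟨ctlEnded r.src ρ, stackTag r.pop, none, ctlLoud, [stackTag r.pop]⟩]) ++
  (stops.flatMap fun ρ => ops.flatMap fun a => (regNext (some a) ρ).flatMap fun ρ' =>
    ctls.flatMap fun q => syms.flatMap fun A =>
      [⟨ctlRun q ρ, A, some (rd ι (.req a)), ctlAckp q ρ a, [A]⟩,
        ⟨ctlAckp q ρ a, A, some (wr ι (.ack a)), ctlRun q ρ', [A]⟩]) ++
  (stops.flatMap fun ρ => ctls.flatMap fun q => syms.flatMap fun A =>
    ⟨ctlRun q ρ, A, some (wr ι (.halt ρ)), ctlEnded q ρ, [A]⟩ ::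
    ⟨ctlEnded q ρ, A, some (rd ι .bad), ctlLoud, [A]⟩ ::
    ops.map fun a => ⟨ctlEnded q ρ, A, some (rd ι (.req a)), ctlLoud, [A]⟩) ++
  (syms.map fun A => ⟨ctlLoud, A, some (wr ι .bad), ctlSink, [A]⟩)

/-- A list that contains all reachable control states of a pushdown system. -/
def ctlList (𝒟 : Pushdown (RegOp m V)) : List Data := 𝒟.init :: 𝒟.rules.map fun r => r.tgt

/-- The stack symbols of the simulating leader. -/
def symList (𝒟 : Pushdown (RegOp m V)) : List Data :=
  .nil :: stackTag 𝒟.stackInit :: 𝒟.rules.flatMap fun r => r.push.map stackTag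

/-- The simulating leader as a pushdown system. -/
def leaderPD (ι : Msg m V → V') (ops : List (RegOp m V)) (stops : List (Fin m → V))
    (ρ₀ : Fin m → V) (𝒟 : Pushdown (RegOp m V)) : Pushdown (RegOp 1 V') :=
  ⟨ctlBoot, .nil,
    leaderRules ι ops stops ρ₀ 𝒟.init 𝒟.stackInit 𝒟.rules (ctlList 𝒟) (symList 𝒟)⟩

/-- The stack of the simulating leader. -/
def leaderStack (α : List Data) : List Data := α.map stackTag ++ [.nil]

/-- The pushdown state that represents a state of the simulating leader. -/
def leaderState : LState m V (Data × List Data) → Data × List Data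
  | .boot => (ctlBoot, [.nil])
  | .run t ρ => (ctlRun t.1 ρ, leaderStack t.2)
  | .ackp t ρ a => (ctlAckp t.1 ρ a, leaderStack t.2)
  | .ended t ρ => (ctlEnded t.1 ρ, leaderStack t.2)
  | .loud t _ => (ctlLoud, leaderStack t.2)
  | .sink t _ => (ctlSink, leaderStack t.2)

/-- States of the leader whose control state and stack symbols are listed. -/
def StackWF (𝒟 : Pushdown (RegOp m V)) (t : Data × List Data) : Prop :=
  t.1 ∈ ctlList 𝒟 ∧ ∀ A ∈ t.2, stackTag A ∈ symList 𝒟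

/-- Reachable states of the simulating leader. -/
def LeaderWF (𝒟 : Pushdown (RegOp m V)) : LState m V (Data × List Data) → Prop
  | .boot => True
  | .run t _ => StackWF 𝒟 t
  | .ackp t _ _ => StackWF 𝒟 t
  | .ended t _ => StackWF 𝒟 t
  | .loud t _ => StackWF 𝒟 t
  | .sink t _ => StackWF 𝒟 t

end PD
end ParamSys

namespace ParamSys
open Enc

/-! ### Bisimilarity of the pushdown system and the system with one register -/

section PD

theorem ContribWF.step {m : ℕ} {V V' : Type*} {ι : Msg m V → V'}
    {C : TransSys (RegOp m V) (Data × List Data)}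
    {x x' : CState m V (Data × List Data)} {o : Option (RegOp 1 V')} (hx : ContribWF C x)
    (hs : CStep ι C x o x') : ContribWF C x' := by
  cases hs with
  | ask h1 => exact h1
  | waitHalt => exact ⟨_, _, hx⟩
  | _ => trivial

theorem StackWF.step {m : ℕ} {V : Type*} {𝒟 : Pushdown (RegOp m V)} {t t' : Data × List Data}
    {o : Option (RegOp m V)} (ht : StackWF 𝒟 t) (hs : 𝒟.toTransSys.step t o t') :
    StackWF 𝒟 t' := by
  obtain ⟨r, hr, α, rfl, -, rfl⟩ := hs
  refine ⟨List.mem_cons_of_mem _ (List.mem_map_of_mem hr), fun A hA => ?_⟩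
  rcases List.mem_append.mp hA with hA | hA
  · exact List.mem_cons_of_mem _ (List.mem_cons_of_mem _
      (List.mem_flatMap.mpr ⟨r, hr, List.mem_map_of_mem hA⟩))
  · exact ht.2 A (List.mem_cons_of_mem _ hA)

theorem LeaderWF.step {m : ℕ} {V V' : Type*} {ι : Msg m V → V'} {𝒟 : Pushdown (RegOp m V)}
    {ρ₀ : Fin m → V} {x x' : LState m V (Data × List Data)} {o : Option (RegOp 1 V')}
    (hx : LeaderWF 𝒟 x) (hs : LStep ι 𝒟.toTransSys ρ₀ x o x') : LeaderWF 𝒟 x' := by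
  cases hs with
  | boot =>
    refine ⟨List.mem_cons_self, fun A hA => ?_⟩
    obtain rfl : A = 𝒟.stackInit := List.mem_singleton.mp hA
    simp [symList]
  | eps h1 => exact StackWF.step hx h1
  | exec h1 => exact StackWF.step hx h1
  | _ => exact hx

variable {m : ℕ} {V V' : Type*} [Enc V] [DecidableEq V]

theorem mem_contribRules {ι : Msg m V → V'} {stops : List (Fin m → V)} {r : PDRule (RegOp m V)}
    (hstops : ∀ ρ, ρ ∈ stops) (x : PDRule (RegOp 1 V')) :
    x ∈ contribRules ι stops r ↔
      (r.lab = none ∧ x = ⟨ctlNrm r.src, r.pop, none, ctlNrm r.tgt, r.push⟩) ∨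
      (∃ a, r.lab = some a ∧ x = ⟨ctlNrm r.src, r.pop, some (wr ι (.req a)),
        ctlWait a r.tgt r.push, [r.pop]⟩) ∨
      (∃ a, r.lab = some a ∧ x = ⟨ctlWait a r.tgt r.push, r.pop, some (rd ι (.ack a)),
        ctlNrm r.tgt, r.push⟩) ∨
      (∃ a ρ, r.lab = some a ∧ x = ⟨ctlWait a r.tgt r.push, r.pop, some (rd ι (.halt ρ)),
        ctlErr, [r.pop]⟩) ∨
      (x = ⟨ctlErr, r.pop, some (wr ι .bad), ctlSink, [r.pop]⟩) ∨
      (∃ ρ, x = ⟨ctlNrm r.src, r.pop, some (rd ι (.halt ρ)), ctlChk r.src ρ, [r.pop]⟩) ∨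
      (∃ ρ ρ', RegStep r.lab ρ ρ' ∧
        x = ⟨ctlChk r.src ρ, r.pop, some (wr ι .bad), ctlSink, [r.pop]⟩) := by
  rcases r with ⟨src, pop, _ | a, tgt, push⟩ <;>
    simp only [contribRules, Option.elim_none, Option.elim_some, List.mem_append, List.mem_cons,
      List.mem_flatMap, List.mem_map, hstops, true_and, mem_regNext, List.not_mem_nil, or_false,
      reduceCtorEq, false_and, exists_false, false_or, Option.some.injEq, exists_eq_left',
      exists_or, exists_and_left, exists_and_right, or_assoc, @eq_comm _ _ x]

theorem ctlWait_injective {m : ℕ} {V : Type*} [Enc V]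
    (h : Function.Injective (enc : V → Data)) {a a' : RegOp m V}
    {q q' : Data} {β β' : List Data} (he : ctlWait a q β = ctlWait a' q' β') :
    a = a' ∧ q = q' ∧ β = β' := by
  have he' : Data.cons (enc a) (.cons q (encList β)) = .cons (enc a') (.cons q' (encList β')) := by
    exact (Data.cons.inj he).2
  simp only [Data.cons.injEq] at he'
  exact ⟨enc_regOp_injective h he'.1, he'.2.1,
    encList_injective (α := Data) (fun _ _ h => h) he'.2.2⟩

/-- On well-formed states, `contribState` is a functional bisimulation. -/
theorem contribPD_step_iff (h : Function.Injective (enc : V → Data)) (ι : Msg m V → V')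
    {stops : List (Fin m → V)} (hstops : ∀ ρ, ρ ∈ stops) (𝒞 : Pushdown (RegOp m V))
    (x : CState m V (Data × List Data)) (hx : ContribWF 𝒞.toTransSys x)
    (o : Option (RegOp 1 V')) (y : Data × List Data) :
    (contribPD ι stops 𝒞).toTransSys.step (contribState x) o y ↔
      ∃ x', CStep ι 𝒞.toTransSys x o x' ∧ y = contribState x' := by
  have htake : ∀ (β α : List Data), (β ++ α).take ((β ++ α).length - α.length) = β := by
    intro β α; simp
  have hmk : ∀ r ∈ 𝒞.rules, ∀ α, 𝒞.toTransSys.step (r.src, r.pop :: α) r.lab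
      (r.tgt, r.push ++ α) := fun r hr α => ⟨r, hr, α, rfl, rfl, rfl⟩
  constructor
  · rintro ⟨r', hr', α, hs, rfl, rfl⟩
    simp only [contribPD, List.mem_flatMap, mem_contribRules hstops] at hr'
    obtain ⟨r, hr, hr'⟩ := hr'
    have hst := hmk r hr α
    rcases hr' with ⟨hl, rfl⟩ | ⟨a, hl, rfl⟩ | ⟨a, hl, rfl⟩ | ⟨a, ρ, hl, rfl⟩ | rfl | ⟨ρ, rfl⟩ |
        ⟨ρ, ρ', hρ, rfl⟩ <;>
      rcases x with ⟨s, st⟩ | ⟨⟨s, st⟩, b, ⟨t, st'⟩⟩ | ⟨⟨s, st⟩, ρ₁⟩ | ⟨s, st⟩ | ⟨s, st⟩ <;>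
      simp only [contribState, Prod.mk.injEq] at hs <;>
      first
      | (exfalso
         simp only [ctlNrm, ctlWait, ctlChk, ctlErr, ctlSink, named, encNat, Data.cons.injEq,
           reduceCtorEq, false_and, and_false] at hs
         done)
      | skip
    · obtain ⟨hs, rfl⟩ := hs
      simp only [ctlNrm, Data.cons.injEq, true_and] at hs
      subst hs
      rw [hl] at hst
      exact ⟨_, .eps hst, rfl⟩
    · obtain ⟨hs, rfl⟩ := hs
      simp only [ctlNrm, Data.cons.injEq, true_and] at hs
      subst hs
      rw [hl] at hst
      exact ⟨_, .ask hst, by simp [contribState]⟩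
    · obtain ⟨hs, rfl⟩ := hs
      obtain ⟨rfl, rfl, hβ⟩ := ctlWait_injective h hs
      obtain ⟨r₂, hr₂, α₂, he, hl₂, hs₂⟩ := hx
      simp only [Prod.mk.injEq, List.cons.injEq] at he hs₂
      obtain ⟨-, hp, rfl⟩ := he
      obtain ⟨-, rfl⟩ := hs₂
      simp only [List.length_cons, Nat.add_sub_cancel, htake] at hβ
      exact ⟨_, .done, by simp [contribState, hβ]⟩
    · obtain ⟨hs, rfl⟩ := hs
      obtain ⟨rfl, rfl, hβ⟩ := ctlWait_injective h hs
      exact ⟨_, .waitHalt, by simp [contribState]⟩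
    · obtain ⟨-, rfl⟩ := hs
      exact ⟨_, .err, by simp [contribState]⟩
    · obtain ⟨hs, rfl⟩ := hs
      simp only [ctlNrm, Data.cons.injEq, true_and] at hs
      subst hs
      exact ⟨_, .halt hst, by simp [contribState]⟩
    · obtain ⟨hs, rfl⟩ := hs
      simp only [ctlChk, Data.cons.injEq, true_and] at hs
      obtain ⟨rfl, hρ₁⟩ := hs
      rw [encTuple_injective h hρ₁]
      exact ⟨_, .chk hst hρ, by simp [contribState]⟩
  · rintro ⟨x', hs, rfl⟩
    have key : ∀ r ∈ 𝒞.rules, ∀ r' ∈ contribRules ι stops r, ∀ α,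
        (contribPD ι stops 𝒞).toTransSys.step (r'.src, r'.pop :: α) r'.lab
          (r'.tgt, r'.push ++ α) := fun r hr r' hr' α =>
      ⟨r', List.mem_flatMap.mpr ⟨r, hr, hr'⟩, α, rfl, rfl, rfl⟩
    cases hs with
    | eps h1 =>
      obtain ⟨r, hr, α, rfl, hl, rfl⟩ := h1
      exact key r hr _ ((mem_contribRules hstops _).mpr (.inl ⟨hl, rfl⟩)) α
    | @ask _ _ a h1 =>
      obtain ⟨r, hr, α, rfl, hl, rfl⟩ := h1
      have := key r hr _ ((mem_contribRules hstops _).mpr (.inr (.inl ⟨a, hl, rfl⟩))) α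
      simpa [contribState] using this
    | @done _ _ a =>
      obtain ⟨r, hr, α, rfl, hl, rfl⟩ := hx
      have := key r hr _ ((mem_contribRules hstops _).mpr (.inr (.inr (.inl ⟨a, hl, rfl⟩)))) α
      simpa [contribState] using this
    | @waitHalt _ _ a ρ =>
      obtain ⟨r, hr, α, rfl, hl, rfl⟩ := hx
      have := key r hr _ ((mem_contribRules hstops _).mpr
        (.inr (.inr (.inr (.inl ⟨a, ρ, hl, rfl⟩))))) α
      simpa [contribState] using this
    | err =>
      obtain ⟨o, s', r, hr, α, rfl, hl, rfl⟩ := hx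
      have := key r hr _ ((mem_contribRules hstops _).mpr
        (.inr (.inr (.inr (.inr (.inl rfl)))))) α
      simpa [contribState] using this
    | @halt _ _ _ ρ h1 =>
      obtain ⟨r, hr, α, rfl, hl, rfl⟩ := h1
      have := key r hr _ ((mem_contribRules hstops _).mpr
        (.inr (.inr (.inr (.inr (.inr (.inl ⟨ρ, rfl⟩))))))) α
      simpa [contribState] using this
    | @chk _ _ _ ρ ρ' h1 h2 =>
      obtain ⟨r, hr, α, rfl, rfl, rfl⟩ := h1
      have := key r hr _ ((mem_contribRules hstops _).mpr
        (.inr (.inr (.inr (.inr (.inr (.inr ⟨ρ, ρ', h2, rfl⟩))))))) α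
      simpa [contribState] using this

theorem mem_leaderRules {ι : Msg m V → V'} {ops : List (RegOp m V)} {stops : List (Fin m → V)}
    (hops : ∀ a, a ∈ ops) (hstops : ∀ ρ, ρ ∈ stops) (ρ₀ : Fin m → V) (init stackInit : Data)
    (rules : List (PDRule (RegOp m V))) (ctls syms : List Data) (x : PDRule (RegOp 1 V')) :
    x ∈ leaderRules ι ops stops ρ₀ init stackInit rules ctls syms ↔
      x = ⟨ctlBoot, .nil, none, ctlRun init ρ₀, [stackTag stackInit, .nil]⟩ ∨
      (∃ r ∈ rules, ∃ ρ ρ', RegStep r.lab ρ ρ' ∧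
        x = ⟨ctlRun r.src ρ, stackTag r.pop, r.lab.map fun b => wr ι (.exec b), ctlRun r.tgt ρ',
          r.push.map stackTag⟩) ∨
      (∃ r ∈ rules, ∃ ρ ρ', RegStep r.lab ρ ρ' ∧
        x = ⟨ctlEnded r.src ρ, stackTag r.pop, none, ctlLoud, [stackTag r.pop]⟩) ∨
      (∃ ρ a ρ', RegStep (some a) ρ ρ' ∧ ∃ q ∈ ctls, ∃ A ∈ syms,
        x = ⟨ctlRun q ρ, A, some (rd ι (.req a)), ctlAckp q ρ a, [A]⟩) ∨
      (∃ ρ a ρ', RegStep (some a) ρ ρ' ∧ ∃ q ∈ ctls, ∃ A ∈ syms,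
        x = ⟨ctlAckp (V := V) q ρ a, A, some (wr ι (.ack a)), ctlRun q ρ', [A]⟩) ∨
      (∃ ρ : Fin m → V, ∃ q ∈ ctls, ∃ A ∈ syms,
        x = ⟨ctlRun q ρ, A, some (wr ι (.halt ρ)), ctlEnded q ρ, [A]⟩) ∨
      (∃ ρ : Fin m → V, ∃ q ∈ ctls, ∃ A ∈ syms,
        x = ⟨ctlEnded q ρ, A, some (rd ι .bad), ctlLoud, [A]⟩) ∨
      (∃ ρ : Fin m → V, ∃ q ∈ ctls, ∃ A ∈ syms, ∃ a,
        x = ⟨ctlEnded q ρ, A, some (rd ι (.req a)), ctlLoud, [A]⟩) ∨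
      (∃ A ∈ syms, x = ⟨ctlLoud, A, some (wr ι .bad), ctlSink, [A]⟩) := by
  simp only [leaderRules, List.mem_append, List.mem_cons, List.mem_flatMap, List.mem_map, hstops,
    hops, true_and, mem_regNext, List.not_mem_nil, or_false, exists_or, and_or_left, or_assoc,
    @eq_comm _ _ x]

/-- On well-formed states, `leaderState` is a functional bisimulation. -/
theorem leaderPD_step_iff (h : Function.Injective (enc : V → Data)) (ι : Msg m V → V')
    {ops : List (RegOp m V)} {stops : List (Fin m → V)}
    (hops : ∀ a, a ∈ ops) (hstops : ∀ ρ, ρ ∈ stops) (ρ₀ : Fin m → V) (𝒟 : Pushdown (RegOp m V))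
    (x : LState m V (Data × List Data)) (hx : LeaderWF 𝒟 x)
    (o : Option (RegOp 1 V')) (y : Data × List Data) :
    (leaderPD ι ops stops ρ₀ 𝒟).toTransSys.step (leaderState x) o y ↔
      ∃ x', LStep ι 𝒟.toTransSys ρ₀ x o x' ∧ y = leaderState x' := by
  have htag : ∀ {A : Data} {α α' : List Data}, leaderStack α = stackTag A :: α' →
      ∃ β, α = A :: β ∧ α' = leaderStack β := by
    rintro A (_ | ⟨B, β⟩) α' hα
    · simp [leaderStack, stackTag] at hα
    · simp only [leaderStack, List.map_cons, List.cons_append, List.cons.injEq, stackTag,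
        Data.cons.injEq, true_and] at hα
      exact ⟨β, by rw [hα.1], hα.2.symm⟩
  have htop : ∀ {α : List Data}, (∀ A ∈ α, stackTag A ∈ symList 𝒟) →
      ∃ A ∈ symList 𝒟, ∃ α', leaderStack α = A :: α' := by
    rintro (_ | ⟨B, β⟩) hα
    · exact ⟨.nil, by simp [symList], [], rfl⟩
    · exact ⟨_, hα B (by simp), leaderStack β, rfl⟩
  have hinj : ∀ {k : ℕ} {a b : Data}, named k a = named k b → a = b := fun h =>
    (Data.cons.inj h).2
  have hinj₂ : ∀ {k : ℕ} {a b : Data} {ρ ρ' : Fin m → V},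
      named k (.cons a (encTuple ρ)) = named k (.cons b (encTuple ρ')) → a = b ∧ ρ = ρ' := by
    intro k a b ρ ρ' he
    have := Data.cons.inj (hinj he)
    exact ⟨this.1, encTuple_injective h this.2⟩
  constructor
  · rintro ⟨r', hr', α, hs, rfl, rfl⟩
    simp only [leaderPD, mem_leaderRules hops hstops] at hr'
    rcases hr' with rfl | ⟨r, hr, ρ, ρ', hρ, rfl⟩ | ⟨r, hr, ρ, ρ', hρ, rfl⟩ |
        ⟨ρ, a, ρ', hρ, q, hq, A, hA, rfl⟩ | ⟨ρ, a, ρ', hρ, q, hq, A, hA, rfl⟩ |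
        ⟨ρ, q, hq, A, hA, rfl⟩ | ⟨ρ, q, hq, A, hA, rfl⟩ | ⟨ρ, q, hq, A, hA, a, rfl⟩ |
        ⟨A, hA, rfl⟩ <;>
      rcases x with _ | ⟨⟨s, st⟩, ρ₁⟩ | ⟨⟨s, st⟩, ρ₁, b⟩ | ⟨⟨s, st⟩, ρ₁⟩ | ⟨⟨s, st⟩, ρ₁⟩ |
        ⟨⟨s, st⟩, ρ₁⟩ <;>
      simp only [leaderState, Prod.mk.injEq] at hs <;>
      first
      | (exfalso
         simp only [ctlBoot, ctlRun, ctlAckp, ctlEnded, ctlLoud, ctlSink, named, encNat,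
           Data.cons.injEq, reduceCtorEq, false_and, and_false] at hs
         done)
      | skip
    · obtain ⟨-, hs⟩ := hs
      obtain rfl : [] = α := (List.cons.inj hs).2
      exact ⟨_, .boot, rfl⟩
    · obtain ⟨hs, hst⟩ := hs
      obtain ⟨rfl, rfl⟩ := hinj₂ hs
      obtain ⟨β, rfl, rfl⟩ := htag hst
      rcases r with ⟨src, pop, _ | a, tgt, push⟩
      · obtain rfl := hρ
        exact ⟨_, .eps ⟨_, hr, β, rfl, rfl, rfl⟩, by simp [leaderState, leaderStack]⟩
      · exact ⟨_, .exec ⟨_, hr, β, rfl, rfl, rfl⟩ hρ, by simp [leaderState, leaderStack]⟩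
    · obtain ⟨hs, hst⟩ := hs
      obtain ⟨rfl, rfl⟩ := hinj₂ hs
      obtain ⟨β, rfl, rfl⟩ := htag hst
      exact ⟨_, .alive ⟨_, hr, β, rfl, rfl, rfl⟩ hρ, by simp [leaderState, leaderStack]⟩
    · obtain ⟨hs, hst⟩ := hs
      obtain ⟨rfl, rfl⟩ := hinj₂ hs
      exact ⟨_, .hear hρ, by simp [leaderState, hst]⟩
    · obtain ⟨hs, hst⟩ := hs
      have hs := Data.cons.inj (hinj hs)
      have hs₂ := Data.cons.inj hs.2
      obtain rfl := hs.1
      obtain rfl := encTuple_injective h hs₂.1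
      obtain rfl := enc_regOp_injective h hs₂.2
      exact ⟨_, .ack hρ, by simp [leaderState, hst]⟩
    · obtain ⟨hs, hst⟩ := hs
      obtain ⟨rfl, rfl⟩ := hinj₂ hs
      exact ⟨_, .halt, by simp [leaderState, hst]⟩
    · obtain ⟨hs, hst⟩ := hs
      obtain ⟨rfl, rfl⟩ := hinj₂ hs
      exact ⟨_, .hearBad, by simp [leaderState, hst]⟩
    · obtain ⟨hs, hst⟩ := hs
      obtain ⟨rfl, rfl⟩ := hinj₂ hs
      exact ⟨_, .hearReq, by simp [leaderState, hst]⟩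
    · obtain ⟨-, hst⟩ := hs
      exact ⟨_, .bad, by simp [leaderState, hst]⟩
  · rintro ⟨x', hs, rfl⟩
    have key : ∀ r' ∈ leaderRules ι ops stops ρ₀ 𝒟.init 𝒟.stackInit 𝒟.rules (ctlList 𝒟)
        (symList 𝒟), ∀ α,
        (leaderPD ι ops stops ρ₀ 𝒟).toTransSys.step (r'.src, r'.pop :: α) r'.lab
          (r'.tgt, r'.push ++ α) := fun r' hr' α => ⟨r', hr', α, rfl, rfl, rfl⟩
    simp only [mem_leaderRules hops hstops] at key
    cases hs with
    | boot => exact key _ (.inl rfl) []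
    | @eps _ _ ρ h1 =>
      obtain ⟨r, hr, α, rfl, hl, rfl⟩ := h1
      have := key _ (.inr (.inl ⟨r, hr, ρ, ρ, by rw [hl]; rfl, rfl⟩)) (leaderStack α)
      simpa [leaderState, leaderStack, hl] using this
    | @exec _ _ b ρ ρ' h1 h2 =>
      obtain ⟨r, hr, α, rfl, hl, rfl⟩ := h1
      have := key _ (.inr (.inl ⟨r, hr, ρ, ρ', by rw [hl]; exact h2, rfl⟩)) (leaderStack α)
      simpa [leaderState, leaderStack, hl] using this
    | @hear t a ρ ρ' h1 =>
      obtain ⟨A, hA, α, hα⟩ := htop hx.2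
      have := key _ (.inr (.inr (.inr (.inl ⟨ρ, a, ρ', h1, t.1, hx.1, A, hA, rfl⟩)))) α
      simpa [leaderState, hα] using this
    | @ack t a ρ ρ' h1 =>
      obtain ⟨A, hA, α, hα⟩ := htop hx.2
      have := key _ (.inr (.inr (.inr (.inr (.inl ⟨ρ, a, ρ', h1, t.1, hx.1, A, hA, rfl⟩))))) α
      simpa [leaderState, hα] using this
    | @halt t ρ =>
      obtain ⟨A, hA, α, hα⟩ := htop hx.2
      have := key _ (.inr (.inr (.inr (.inr (.inr (.inl ⟨ρ, t.1, hx.1, A, hA, rfl⟩)))))) α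
      simpa [leaderState, hα] using this
    | @alive _ _ _ ρ ρ' h1 h2 =>
      obtain ⟨r, hr, α, rfl, rfl, rfl⟩ := h1
      have := key _ (.inr (.inr (.inl ⟨r, hr, ρ, ρ', h2, rfl⟩))) (leaderStack α)
      simpa [leaderState, leaderStack] using this
    | @hearReq t a ρ =>
      obtain ⟨A, hA, α, hα⟩ := htop hx.2
      have := key _ (.inr (.inr (.inr (.inr (.inr (.inr (.inr (.inl
        ⟨ρ, t.1, hx.1, A, hA, a, rfl⟩)))))))) α
      simpa [leaderState, hα] using this
    | @hearBad t ρ =>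
      obtain ⟨A, hA, α, hα⟩ := htop hx.2
      have := key _ (.inr (.inr (.inr (.inr (.inr (.inr (.inl ⟨ρ, t.1, hx.1, A, hA, rfl⟩))))))) α
      simpa [leaderState, hα] using this
    | @bad t ρ =>
      obtain ⟨A, hA, α, hα⟩ := htop hx.2
      have := key _ (.inr (.inr (.inr (.inr (.inr (.inr (.inr (.inr ⟨A, hA, rfl⟩)))))))) α
      simpa [leaderState, hα] using this

/-- Simulating pushdown systems have the same traces as the systems `oneReg ι sys`. -/
theorem oneReg_iff_pushdown (h : Function.Injective (enc : V → Data)) (ι : Msg m V → V')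
    {ops : List (RegOp m V)} {stops : List (Fin m → V)}
    (hops : ∀ a, a ∈ ops) (hstops : ∀ ρ, ρ ∈ stops) (ρ₀ : Fin m → V)
    (𝒞 𝒟 : Pushdown (RegOp m V)) (Q : Set (Word (RegOp 1 V'))) :
    (oneReg ι ⟨𝒞.toTransSys, 𝒟.toTransSys, ρ₀⟩).HasMaximalTraceWithLeaderProjIn Q ↔
      CDSystem.HasMaximalTraceWithLeaderProjIn ⟨(contribPD ι stops 𝒞).toTransSys,
        (leaderPD ι ops stops ρ₀ 𝒟).toTransSys, fun _ => ι .init⟩ Q :=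
  hasMaximalTraceWithLeaderProjIn_iff_of_bisim _ _ contribState leaderState
    (ContribWF 𝒞.toTransSys) (LeaderWF 𝒟)
    (fun x hx => contribPD_step_iff h ι hstops 𝒞 x hx)
    (fun x hx => leaderPD_step_iff h ι hops hstops ρ₀ 𝒟 x hx)
    (fun _ _ _ hx hs => hx.step hs) (fun _ _ _ hx hs => hx.step hs)
    (by simp only [oneReg, ContribWF]) (by simp only [oneReg, LeaderWF]) rfl rfl rfl Q

end PD
end ParamSys

namespace ParamSys
open Enc

/-! ### Functions computable in polynomial time -/

section PolyBound

variable {γ δ : Type*} {e : γ → Data}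

theorem Data.size_pos (x : Data) : 0 < x.size := by cases x <;> simp [Data.size]

/-- `g` is bounded by a polynomial in the size of `e`. Since sizes are positive, powers of the size
plus one suffice as bounds. -/
def PolyBound (e : γ → Data) (g : γ → ℕ) : Prop := ∃ k, ∀ c, g c ≤ ((e c).size + 1) ^ k

namespace PolyBound

theorem mono {g h : γ → ℕ} (hg : PolyBound e g) (hh : ∀ c, h c ≤ g c) : PolyBound e h :=
  hg.imp fun _ hk c => (hh c).trans (hk c)

theorem const (n : ℕ) : PolyBound e fun _ => n := by
  refine ⟨n, fun c => (Nat.lt_two_pow_self (n := n)).le.trans (Nat.pow_le_pow_left ?_ n)⟩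
  have := (e c).size_pos
  omega

theorem size : PolyBound e fun c => (e c).size := ⟨1, fun c => by simp⟩

theorem mul {g h : γ → ℕ} (hg : PolyBound e g) (hh : PolyBound e h) :
    PolyBound e fun c => g c * h c := by
  obtain ⟨k, hk⟩ := hg
  obtain ⟨l, hl⟩ := hh
  exact ⟨k + l, fun c => by rw [pow_add]; exact Nat.mul_le_mul (hk c) (hl c)⟩

theorem add {g h : γ → ℕ} (hg : PolyBound e g) (hh : PolyBound e h) :
    PolyBound e fun c => g c + h c := by
  obtain ⟨k, hk⟩ := hg
  obtain ⟨l, hl⟩ := hh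
  refine ⟨k + l + 1, fun c => ?_⟩
  have h2 : 2 ≤ (e c).size + 1 := by have := (e c).size_pos; omega
  have h3 : ((e c).size + 1) ^ k ≤ ((e c).size + 1) ^ (k + l) :=
    Nat.pow_le_pow_right (by omega) (by omega)
  have h4 : ((e c).size + 1) ^ l ≤ ((e c).size + 1) ^ (k + l) :=
    Nat.pow_le_pow_right (by omega) (by omega)
  calc g c + h c ≤ ((e c).size + 1) ^ (k + l) * 2 := by linarith [hk c, hl c]
    _ ≤ ((e c).size + 1) ^ (k + l + 1) := by
      rw [pow_succ]; exact Nat.mul_le_mul_left _ h2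

theorem pow {g : γ → ℕ} (hg : PolyBound e g) (l : ℕ) : PolyBound e fun c => g c ^ l := by
  obtain ⟨k, hk⟩ := hg
  exact ⟨k * l, fun c => by rw [pow_mul]; exact Nat.pow_le_pow_left (hk c) l⟩

/-- If `g` is bounded in terms of `e'`, and `e'` is bounded in terms of `e`, then `g` is bounded in
terms of `e`. -/
theorem comp {e' : δ → Data} {g : δ → ℕ} (hg : PolyBound e' g) (r : γ → δ)
    (hr : PolyBound e fun c => (e' (r c)).size) : PolyBound e fun c => g (r c) := by
  obtain ⟨k, hk⟩ := hg
  exact ((hr.add (const 1)).pow k).mono fun c => hk (r c)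

end PolyBound
end PolyBound

/-- A program needs time to build its output, so values computed in polynomial time have polynomial
size. -/
theorem Prog.Eval.size_le {p : Prog} {x y : Data} {n : ℕ} (h : p.Eval x y n) : y.size ≤ 3 * n := by
  induction h with
  | id x => omega
  | nil x => have := x.size_pos; simp only [Data.size]; omega
  | fst x => cases x <;> simp only [Data.fst, Data.size] <;> omega
  | snd x => cases x <;> simp only [Data.snd, Data.size] <;> omega
  | eq x => have := x.size_pos; split_ifs <;> simp only [Data.size] <;> omega
  | @pair _ _ x => have := x.size_pos; simp only [Data.size]; omega
  | _ => omega

/-- Some program computes `f c` from `e c` in time polynomial in the size of `e c`. Here `e c` is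
thought of as an encoding of an environment `c` which provides the values of variables. -/
def FP {γ : Type*} (e f : γ → Data) : Prop :=
  ∃ (p : Prog) (t : γ → ℕ), PolyBound e t ∧ ∀ c, p.Eval (e c) (f c) (t c)

theorem FP.polyTime {α β : Type*} [Enc α] [Enc β] {f : α → β}
    (h : FP (enc : α → Data) fun a => enc (f a)) : PolyTime f := by
  obtain ⟨p, t, ⟨k, hk⟩, hp⟩ := h
  exact ⟨p, (Polynomial.X + 1) ^ k, fun a => ⟨t a, by simpa using hk a, hp a⟩⟩

namespace FP

variable {γ δ : Type*} {e f g : γ → Data}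

theorem size (h : FP e f) : PolyBound e fun c => (f c).size := by
  obtain ⟨p, t, ht, hp⟩ := h
  exact ((PolyBound.const 3).mul ht).mono fun c => (hp c).size_le

theorem self : FP e e := ⟨.id, _, .size, fun _ => .id _⟩

/-- Composition: `r c` is the environment in which `f` is evaluated. -/
theorem comp {e' f : δ → Data} (r : γ → δ) (hr : FP e fun c => e' (r c)) (hf : FP e' f) :
    FP e fun c => f (r c) := by
  have hs := hr.size
  obtain ⟨p, t, ht, hp⟩ := hr
  obtain ⟨q, u, hu, hq⟩ := hf
  exact ⟨.seq p q, _, (PolyBound.size.add ht).add (hu.comp r hs), fun c => .seq (hp c) (hq (r c))⟩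

theorem pair (hf : FP e f) (hg : FP e g) : FP e fun c => .cons (f c) (g c) := by
  obtain ⟨p, t, ht, hp⟩ := hf
  obtain ⟨q, u, hu, hq⟩ := hg
  exact ⟨.pair p q, _, (PolyBound.size.add ht).add hu, fun c => .pair (hp c) (hq c)⟩

theorem fst (hf : FP e f) : FP e fun c => (f c).fst :=
  comp (e' := fun x : Data => x) f hf ⟨.fst, _, .size, fun _ => .fst _⟩

theorem snd (hf : FP e f) : FP e fun c => (f c).snd :=
  comp (e' := fun x : Data => x) f hf ⟨.snd, _, .size, fun _ => .snd _⟩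

theorem const (d : Data) : FP e fun _ => d := by
  induction d with
  | nil => exact ⟨.nil, _, .size, fun _ => .nil _⟩
  | cons x y hx hy => exact hx.pair hy

/-- Case distinction, where the programs for the two cases may rely on the condition. -/
theorem ite' {b : γ → Data} {P : γ → Prop} [DecidablePred P] (hb : FP e b)
    (hP : ∀ c, P c ↔ b c ≠ .nil)
    (hf : FP (fun c : {c // P c} => e c) fun c => f c)
    (hg : FP (fun c : {c // ¬ P c} => e c) fun c => g c) :
    FP e fun c => if P c then f c else g c := by
  obtain ⟨r, s, hs, hr⟩ := hb
  obtain ⟨p, t, ⟨k, hk⟩, hp⟩ := hf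
  obtain ⟨q, u, ⟨l, hl⟩, hq⟩ := hg
  refine ⟨.ite r p q, fun c => (e c).size + s c + if h : P c then t ⟨c, h⟩ else u ⟨c, h⟩, ?_, ?_⟩
  · refine (PolyBound.size.add hs).add (PolyBound.mono
      (g := fun c => ((e c).size + 1) ^ k + ((e c).size + 1) ^ l) (.add ⟨k, fun _ => le_rfl⟩
        ⟨l, fun _ => le_rfl⟩) fun c => ?_)
    split_ifs with h
    · exact (hk ⟨c, h⟩).trans (Nat.le_add_right _ _)
    · exact (hl ⟨c, h⟩).trans (Nat.le_add_left _ _)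
  · intro c
    by_cases h : P c
    · simp only [h, if_true, dif_pos]
      exact .ite_true (hr c) ((hP c).mp h) (hp ⟨c, h⟩)
    · have hn : b c = .nil := by by_contra hn; exact h ((hP c).mpr hn)
      have hrc := hr c
      rw [hn] at hrc
      simp only [h, if_false]
      exact .ite_false hrc (hq ⟨c, h⟩)

/-- Restriction to a subset of the environments or, more generally, reindexing. -/
theorem reindex (h : FP e f) (r : δ → γ) : FP (fun d => e (r d)) fun d => f (r d) :=
  comp r self h

theorem ite {b : γ → Data} {P : γ → Prop} [DecidablePred P] (hb : FP e b)
    (hP : ∀ c, P c ↔ b c ≠ .nil) (hf : FP e f) (hg : FP e g) :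
    FP e fun c => if P c then f c else g c :=
  ite' hb hP (hf.reindex _) (hg.reindex _)

theorem eqTest {a b : γ → Data} (ha : FP e a) (hb : FP e b) :
    FP e fun c => if a c = b c then Data.cons .nil .nil else .nil :=
  comp (e' := fun x : Data => x) (fun c => Data.cons (a c) (b c)) (ha.pair hb)
    ⟨.eq, _, .size, fun _ => .eq _⟩

theorem iteEq {a b : γ → Data} (ha : FP e a) (hb : FP e b) (hf : FP e f) (hg : FP e g) :
    FP e fun c => if a c = b c then f c else g c :=
  ite (ha.eqTest hb) (fun c => by split_ifs with h <;> simp [h]) hf hg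

theorem congr (h : FP e f) (hfg : ∀ c, f c = g c) : FP e g := by
  rwa [show g = f from funext fun c => (hfg c).symm]

/-- Loops: `T c i` is the state after `i` iterations; there are `n c` iterations. The body only has
to work on states that are reached. Besides the number of iterations, the sizes of all states have
to be bounded by a polynomial. -/
theorem iterate {T : γ → ℕ → Data} {n : γ → ℕ} {C : Data → Data} (hC : FP (fun x : Data => x) C)
    (hT : FP (fun p : {p : γ × ℕ // p.2 < n p.1} => T p.1.1 p.1.2) fun p => T p.1.1 (p.1.2 + 1))
    (h0 : FP e fun c => T c 0) (hlt : ∀ c i, i < n c → C (T c i) ≠ .nil)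
    (hn : ∀ c, C (T c (n c)) = .nil) (hbn : PolyBound e n) {b : γ → ℕ} (hb : PolyBound e b)
    (hbT : ∀ c i, i ≤ n c → (T c i).size ≤ b c) : FP e fun c => T c (n c) := by
  obtain ⟨q, u, ⟨k, hk⟩, hq⟩ := hC
  obtain ⟨p, t, ⟨l, hl⟩, hp⟩ := hT
  have key : ∀ c j i, i + j = n c → ∃ N ≤ (j + 1) * (b c + (b c + 1) ^ k + (b c + 1) ^ l),
      (Prog.while q p).Eval (T c i) (T c (n c)) N := by
    intro c j
    induction j with
    | zero =>
      intro i hi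
      obtain rfl : i = n c := hi
      have hqc := hq (T c (n c))
      rw [hn] at hqc
      refine ⟨_, ?_, .while_false hqc⟩
      have h1 := hbT c _ le_rfl
      have h2 := (hk (T c (n c))).trans (Nat.pow_le_pow_left (Nat.add_le_add_right h1 1) k)
      rw [zero_add, one_mul]
      omega
    | succ j ih =>
      intro i hi
      obtain ⟨N, hN, hev⟩ := ih (i + 1) (by omega)
      have hi' : i < n c := by omega
      refine ⟨_, ?_, .while_true (hq (T c i)) (hlt c i hi') (hp ⟨(c, i), hi'⟩) hev⟩
      have h1 := hbT c i hi'.le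
      have h2 := (hk (T c i)).trans (Nat.pow_le_pow_left (Nat.add_le_add_right h1 1) k)
      have h3 := (hl ⟨(c, i), hi'⟩).trans (Nat.pow_le_pow_left (Nat.add_le_add_right h1 1) l)
      rw [add_mul (j + 1) 1, one_mul]
      omega
  choose N hN hev using fun c => key c (n c) 0 (by omega)
  obtain ⟨p₀, t₀, ht₀, hp₀⟩ := h0
  exact ⟨.seq p₀ (.while q p), _, (PolyBound.size.add ht₀).add (((hbn.add (.const 1)).mul
    ((hb.add ((hb.add (.const 1)).pow k)).add ((hb.add (.const 1)).pow l))).mono hN),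
    fun c => .seq (hp₀ c) (hev c)⟩

end FP
end ParamSys

namespace ParamSys
open Enc

/-! ### Lists in polynomial time -/

theorem size_enc_append {α : Type*} [Enc α] (l l' : List α) :
    (enc (l ++ l')).size + 1 = (enc l).size + (enc l').size := by
  induction l with
  | nil => exact Nat.add_comm _ _
  | cons a l ih =>
    change (enc a).size + (enc (l ++ l')).size + 1 + 1 = (enc a).size + (enc l).size + 1 + _
    omega

theorem size_enc_le_of_mem {α : Type*} [Enc α] {l : List α} {a : α} (h : a ∈ l) :
    (enc a).size ≤ (enc l).size := by
  induction h with
  | head l => change _ ≤ (enc a).size + (enc l).size + 1; omega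
  | @tail b l _ ih => change _ ≤ (enc b).size + (enc l).size + 1; omega

theorem length_le_size {α : Type*} [Enc α] (l : List α) : l.length ≤ (enc l).size := by
  induction l with
  | nil => exact Nat.zero_le _
  | cons a l ih => change l.length + 1 ≤ (enc a).size + (enc l).size + 1; omega

theorem size_enc_drop_le {α : Type*} [Enc α] (l : List α) (i : ℕ) :
    (enc (l.drop i)).size ≤ (enc l).size := by
  have h := size_enc_append (l.take i) (l.drop i)
  rw [List.take_append_drop] at h
  have := (enc (l.take i)).size_pos
  omega

/-- The environment `e` extended by a variable. -/
def ext {γ : Type*} {α : γ → Type*} [∀ c, Enc (α c)] (e : γ → Data) (p : Σ c, α c) : Data :=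
  .cons (e p.1) (enc p.2)

namespace FP

section

variable {γ : Type*} {α β σ : γ → Type*} [∀ c, Enc (α c)] [∀ c, Enc (β c)] [∀ c, Enc (σ c)]
  {e f : γ → Data}

/-- Weakening: what is computable is still computable when a variable has been added. -/
theorem lift (h : FP e f) : FP (ext (α := α) e) fun p => f p.1 :=
  comp (e := ext e) Sigma.fst self.fst h

/-- The variable that was added last. -/
theorem var : FP (ext (α := α) e) fun p => enc p.2 := self.snd

/-- A fold is computable in polynomial time if each step is, and if each step increases the size of
the accumulator at most by an amount `d c` that does not depend on the accumulator. -/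
theorem foldl {l : ∀ c, List (α c)} {f : ∀ c, σ c → α c → σ c} {s : ∀ c, σ c} {d : γ → ℕ}
    (hl : FP e fun c => enc (l c)) (hs : FP e fun c => enc (s c))
    (hf : FP (ext (α := fun p : Σ c, σ c => α p.1) (ext e)) fun p => enc (f p.1.1 p.1.2 p.2))
    (hd : PolyBound e d)
    (hfd : ∀ c s, ∀ a ∈ l c, (enc (f c s a)).size ≤ (enc s).size + d c) :
    FP e fun c => enc ((l c).foldl (f c) (s c)) := by
  let T : γ → ℕ → Data := fun c i => .cons (.cons (e c) (enc (((l c).take i).foldl (f c) (s c))))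
    (enc ((l c).drop i))
  have hsize : ∀ c i, (enc (((l c).take i).foldl (f c) (s c))).size ≤
      (enc (s c)).size + (l c).length * d c := by
    intro c i
    have h : ∀ (l' : List (α c)) (x : σ c), (∀ a ∈ l', a ∈ l c) →
        (enc (l'.foldl (f c) x)).size ≤ (enc x).size + l'.length * d c := by
      intro l'
      induction l' with
      | nil => intro x _; simp
      | cons a l' ih =>
        intro x h
        have h1 := ih (f c x a) fun b hb => h b (List.mem_cons_of_mem a hb)
        have h2 := hfd c x a (h a List.mem_cons_self)
        simp only [List.foldl_cons, List.length_cons, add_mul, one_mul]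
        omega
    refine (h _ _ fun a ha => List.mem_of_mem_take ha).trans (Nat.add_le_add_left
      (Nat.mul_le_mul_right _ ?_) _)
    simp
  have hT : FP e fun c => T c (l c).length := by
    refine iterate (T := T) (C := Data.snd) (b := fun c => (e c).size +
      ((enc (s c)).size + (enc (l c)).size * d c) + 1 + (enc (l c)).size + 1) (snd self) ?_
      ((self.pair hs).pair hl) ?_ ?_ (hl.size.mono fun c => length_le_size _)
      ((((PolyBound.size.add (hs.size.add (hl.size.mul hd))).add (.const 1)).add hl.size).add
        (.const 1)) ?_
    · let r : {p : γ × ℕ // p.2 < (l p.1).length} → Σ p : Σ c, σ c, α p.1 := fun p =>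
        ⟨⟨p.1.1, ((l p.1.1).take p.1.2).foldl (f p.1.1) (s p.1.1)⟩, (l p.1.1)[p.1.2]'p.2⟩
      have hdrop : ∀ p : {p : γ × ℕ // p.2 < (l p.1).length}, (l p.1.1).drop p.1.2 =
          (l p.1.1)[p.1.2]'p.2 :: (l p.1.1).drop (p.1.2 + 1) := fun p =>
        List.drop_eq_getElem_cons p.2
      have h1 := comp (e := fun p : {p : γ × ℕ // p.2 < (l p.1).length} => T p.1.1 p.1.2) r
        ((self.fst.pair self.snd.fst).congr fun p => by
          simp only [T, hdrop]; rfl) hf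
      refine ((self.fst.fst.pair h1).pair self.snd.snd).congr fun p => ?_
      simp only [T, hdrop, List.take_succ_eq_append_getElem p.2, List.foldl_append,
        List.foldl_cons, List.foldl_nil]
      rfl
    · intro c i hi
      simp only [T, List.drop_eq_getElem_cons hi]
      exact fun h => by cases h
    · intro c
      simp only [T, List.drop_length]
      rfl
    · intro c i _
      have h1 := hsize c i
      have h2 := size_enc_drop_le (l c) i
      have h3 := Nat.mul_le_mul_right (d c) (length_le_size (l c))
      simp only [T, Data.size]
      omega
  exact hT.fst.snd.congr fun c => by simp only [T, List.take_length]; rfl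

theorem nil : FP e fun c => enc ([] : List (α c)) := const .nil

theorem cons {x : ∀ c, α c} {l : ∀ c, List (α c)} (hx : FP e fun c => enc (x c))
    (hl : FP e fun c => enc (l c)) : FP e fun c => enc (x c :: l c) := hx.pair hl

theorem reverse {l : ∀ c, List (α c)} (hl : FP e fun c => enc (l c)) :
    FP e fun c => enc (l c).reverse := by
  refine (foldl (σ := fun c => List (α c)) (f := fun c s a => a :: s) (s := fun c => [])
    (d := fun c => (enc (l c)).size + 1) hl nil (cons var var.lift) (hl.size.add (.const 1))
    fun c s a ha => ?_).congr fun c => ?_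
  · have := size_enc_le_of_mem ha
    change (enc a).size + (enc s).size + 1 ≤ _
    omega
  · rw [List.foldl_flip_cons_eq_append', List.append_nil]

theorem append {l l' : ∀ c, List (α c)} (hl : FP e fun c => enc (l c))
    (hl' : FP e fun c => enc (l' c)) : FP e fun c => enc (l c ++ l' c) := by
  refine (foldl (σ := fun c => List (α c)) (f := fun c s a => a :: s)
    (d := fun c => (enc (l c).reverse).size + 1) hl.reverse hl' (cons var var.lift)
    (hl.reverse.size.add (.const 1)) fun c s a ha => ?_).congr fun c => ?_
  · have := size_enc_le_of_mem ha
    change (enc a).size + (enc s).size + 1 ≤ _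
    omega
  · rw [List.foldl_flip_cons_eq_append', List.reverse_reverse]

theorem flatMap {l : ∀ c, List (α c)} {g : ∀ c, α c → List (β c)}
    (hl : FP e fun c => enc (l c)) (hg : FP (ext e) fun p => enc (g p.1 p.2)) :
    FP e fun c => enc ((l c).flatMap (g c)) := by
  obtain ⟨k, hk⟩ := hg.size
  refine (foldl (σ := fun c => List (β c)) (f := fun c s a => g c a ++ s) (s := fun c => [])
    (d := fun c => ((e c).size + (enc (l c)).size + 2) ^ k) hl.reverse nil
    (append (comp (e' := ext e)
      (fun p : Σ q : (Σ c, List (β c)), α q.1 => (⟨p.1.1, p.2⟩ : Σ c, α c))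
      (self.fst.fst.pair self.snd) hg) var.lift)
    (((PolyBound.size.add hl.size).add (.const 2)).pow k) fun c s a ha => ?_).congr fun c => ?_
  · have h1 := size_enc_append (g c a) s
    have h2 := hk ⟨c, a⟩
    have h3 := size_enc_le_of_mem (List.mem_reverse.mp ha)
    have h4 : ((ext e (⟨c, a⟩ : Σ c, α c)).size + 1) ^ k ≤
        ((e c).size + (enc (l c)).size + 2) ^ k := by
      refine Nat.pow_le_pow_left ?_ k
      change (e c).size + (enc a).size + 1 + 1 ≤ _
      omega
    simp only at h2
    omega
  · rw [List.foldl_reverse]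
    congr 1
    induction l c with
    | nil => rfl
    | cons a l ih => simp [ih]

theorem map {l : ∀ c, List (α c)} {g : ∀ c, α c → β c} (hl : FP e fun c => enc (l c))
    (hg : FP (ext e) fun p => enc (g p.1 p.2)) : FP e fun c => enc ((l c).map (g c)) :=
  (hl.flatMap (cons hg nil)).congr fun c => by rw [List.map_eq_flatMap]

theorem optionElim {o : ∀ c, Option (α c)} {b : ∀ c, β c} {g : ∀ c, α c → β c}
    (ho : FP e fun c => enc (o c)) (hb : FP e fun c => enc (b c))
    (hg : FP (ext e) fun p => enc (g p.1 p.2)) :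
    FP e fun c => enc ((o c).elim (b c) (g c)) := by
  refine (ite' (P := fun c => (o c).isSome) (f := fun c => enc ((o c).elim (b c) (g c)))
    (g := fun c => enc (b c)) ho
    (fun c => ?_) ?_ (hb.reindex _)).congr fun c => ?_
  · cases h : o c with
    | none => simp only [Option.isSome_none, Bool.false_eq_true, false_iff, not_not]; rfl
    | some a => simp only [Option.isSome_some, true_iff]; exact fun h => by cases h
  · refine (comp (fun c : {c // (o c).isSome} => (⟨c.1, (o c.1).get c.2⟩ : Σ c, α c))
      ((self.pair (ho.reindex _).snd).congr fun c => ?_) hg).congr fun c => ?_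
    · obtain ⟨c, hc⟩ := c
      obtain ⟨a, ha⟩ := Option.isSome_iff_exists.mp hc
      simp only [ha, ext, Option.get_some]
      rfl
    · obtain ⟨c, hc⟩ := c
      obtain ⟨a, ha⟩ := Option.isSome_iff_exists.mp hc
      simp only [ha, Option.elim_some, Option.get_some]
  · cases o c <;> rfl

theorem some {x : ∀ c, α c} (hx : FP e fun c => enc (x c)) :
    FP e fun c => enc (Option.some (x c)) := (const .nil).pair hx

theorem optionMap {o : ∀ c, Option (α c)} {g : ∀ c, α c → β c} (ho : FP e fun c => enc (o c))
    (hg : FP (ext e) fun p => enc (g p.1 p.2)) : FP e fun c => enc ((o c).map (g c)) :=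
  (optionElim (β := fun c => Option (β c)) (b := fun _ => none) (g := fun c a => .some (g c a)) ho
    (const .nil) hg.some).congr fun c => by cases o c <;> rfl

end

end FP
end ParamSys

namespace ParamSys
open Enc

/-! ### The pushdown construction in polynomial time -/

/-- Tuples are encoded as lists. -/
instance {n : ℕ} {α : Type*} [Enc α] : Enc (Fin n → α) := ⟨encTuple⟩

instance {m : ℕ} {V : Type*} [Enc V] : Enc (Msg m V) := ⟨encMsg⟩

/-- The entry with the unary number `i` of a list of length `k`. -/
def lookup : ℕ → Data → Data → Data
  | 0, _, _ => .nil
  | k + 1, i, l => if i = .nil then l.fst else lookup k i.snd l.snd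

/-- The list of length `k` with the entry with the unary number `i` replaced by `g`. -/
def replace : ℕ → Data → Data → Data → Data
  | 0, _, _, _ => .nil
  | k + 1, i, g, l =>
    if i = .nil then .cons g l.snd else .cons l.fst (replace k i.snd g l.snd)

theorem enc_tuple_succ {k : ℕ} {α : Type*} [Enc α] (ρ : Fin (k + 1) → α) :
    enc ρ = .cons (enc (ρ 0)) (enc (Fin.tail ρ)) := by
  change encList (List.ofFn ρ) = _
  rw [List.ofFn_succ]
  rfl

theorem lookup_enc {α : Type*} [Enc α] :
    ∀ {k : ℕ} (i : Fin k) (ρ : Fin k → α), lookup k (enc i) (enc ρ) = enc (ρ i)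
  | k + 1, i, ρ => by
    rw [enc_tuple_succ]
    refine Fin.cases ?_ (fun i => ?_) i
    · exact if_pos rfl
    · exact (if_neg fun h => by cases h).trans (lookup_enc i (Fin.tail ρ))

theorem replace_enc {α : Type*} [Enc α] : ∀ {k : ℕ} (i : Fin k) (g : α) (ρ : Fin k → α),
    replace k (enc i) (enc g) (enc ρ) = enc (Function.update ρ i g)
  | k + 1, i, g, ρ => by
    rw [enc_tuple_succ, enc_tuple_succ]
    refine Fin.cases ?_ (fun i => ?_) i
    · refine (if_pos rfl).trans ?_
      rw [Function.update_self, Fin.tail_update_zero]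
      rfl
    · refine (if_neg fun h => by cases h).trans ?_
      rw [Function.update_of_ne (Fin.succ_ne_zero i).symm, Fin.tail_update_succ, ← replace_enc]
      rfl

namespace FP

section

variable {γ : Type*} {e : γ → Data}

theorem lookup {i l : γ → Data} (hi : FP e i) (hl : FP e l) (k : ℕ) :
    FP e fun c => ParamSys.lookup k (i c) (l c) := by
  induction k generalizing i l with
  | zero => exact const .nil
  | succ k ih => exact iteEq hi (const .nil) hl.fst (ih hi.snd hl.snd)

theorem replace {i g l : γ → Data} (hi : FP e i) (hg : FP e g) (hl : FP e l) (k : ℕ) :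
    FP e fun c => ParamSys.replace k (i c) (g c) (l c) := by
  induction k generalizing i l with
  | zero => exact const .nil
  | succ k ih =>
    exact iteEq hi (const .nil) (hg.pair hl.snd) (hl.fst.pair (ih hi.snd hl.snd))

theorem tuples {α : γ → Type*} [∀ c, Enc (α c)] {l : ∀ c, List (α c)}
    (hl : FP e fun c => enc (l c)) (k : ℕ) : FP e fun c => enc (ParamSys.tuples (l c) k) := by
  induction k with
  | zero => exact (const (.cons .nil .nil)).congr fun c => rfl
  | succ k ih =>
    simp only [ParamSys.tuples]
    refine flatMap hl (map ih.lift ?_)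
    refine (var.lift.pair var).congr fun p => ?_
    rw [enc_tuple_succ]
    rfl

theorem allOps {α : γ → Type*} [∀ c, Enc (α c)] {l : ∀ c, List (α c)}
    (hl : FP e fun c => enc (l c)) (m : ℕ) : FP e fun c => enc (ParamSys.allOps m (l c)) := by
  refine flatMap (l := fun _ => List.finRange m) (const _) (flatMap hl.lift ?_)
  exact cons ((const .nil).pair (var.lift.pair var))
    (cons ((const (.cons .nil .nil)).pair (var.lift.pair var)) nil)

end

section

variable {γ : Type*} {e : γ → Data} {m : ℕ} {V : γ → Type*} [∀ c, Enc (V c)]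

theorem req {a : ∀ c, RegOp m (V c)} (ha : FP e fun c => enc (a c)) :
    FP e fun c => enc (Msg.req (a c)) := (const (encNat 2)).pair ha

theorem ack {a : ∀ c, RegOp m (V c)} (ha : FP e fun c => enc (a c)) :
    FP e fun c => enc (Msg.ack (a c)) := (const (encNat 3)).pair ha

theorem exec {a : ∀ c, RegOp m (V c)} (ha : FP e fun c => enc (a c)) :
    FP e fun c => enc (Msg.exec (a c)) := (const (encNat 4)).pair ha

theorem halt {ρ : ∀ c, Fin m → V c} (hρ : FP e fun c => enc (ρ c)) :
    FP e fun c => enc (Msg.halt (ρ c)) := (const (encNat 5)).pair hρ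

theorem allMsgs {ops : ∀ c, List (RegOp m (V c))} {stops : ∀ c, List (Fin m → V c)}
    (hops : FP e fun c => enc (ops c)) (hstops : FP e fun c => enc (stops c)) :
    FP e fun c => enc (ParamSys.allMsgs (ops c) (stops c)) := by
  refine cons (const (enc (Msg.init : Msg 0 Data))) (cons (const (enc (Msg.bad : Msg 0 Data)))
    (append (flatMap hops ?_) (map hstops (halt var))))
  exact cons (req var) (cons (ack var) (cons (exec var) nil))

theorem regNext [∀ c, DecidableEq (V c)] (h : ∀ c, Function.Injective (enc : V c → Data))
    {o : ∀ c, Option (RegOp m (V c))} {ρ : ∀ c, Fin m → V c} (ho : FP e fun c => enc (o c))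
    (hρ : FP e fun c => enc (ρ c)) : FP e fun c => enc (ParamSys.regNext (o c) (ρ c)) := by
  have h1 : FP (ext (α := fun c => RegOp m (V c)) e)
      fun p => enc (ParamSys.regNext (.some p.2) (ρ p.1)) := by
    have hv : FP (ext (α := fun c => RegOp m (V c)) e) fun p => enc p.2 := var
    refine (iteEq hv.fst (const .nil) (iteEq (lookup hv.snd.fst hρ.lift m) hv.snd.snd
      (hρ.lift.pair (const .nil)) (const .nil))
      ((replace hv.snd.fst hv.snd.snd hρ.lift m).pair (const .nil))).congr ?_
    rintro ⟨c, ⟨i, g⟩ | ⟨i, g⟩⟩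
    · refine (if_pos rfl).trans ?_
      have h2 : (ParamSys.lookup m (enc i) (enc (ρ c)) = enc g) ↔ ρ c i = g := by
        rw [lookup_enc, (h c).eq_iff]
      simp only [ParamSys.regNext]
      by_cases h3 : ρ c i = g
      · rw [if_pos h3]
        exact if_pos (h2.mpr h3)
      · rw [if_neg h3]
        exact if_neg fun h => h3 (h2.mp h)
    · refine (if_neg fun h => by cases h).trans ?_
      simp only [ParamSys.regNext]
      change Data.cons (ParamSys.replace m (enc i) (enc g) (enc (ρ c))) .nil = _
      rw [replace_enc]
      rfl
  refine (optionElim (b := fun c => [ρ c]) (g := fun c a => ParamSys.regNext (.some a) (ρ c)) ho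
    (cons hρ nil) h1).congr fun c => ?_
  cases o c <;> rfl

end

section

variable {γ : Type*} {e : γ → Data} {m : ℕ} {V V' : γ → Type*} [∀ c, Enc (V c)]
  [∀ c, Enc (V' c)] {ι : ∀ c, Msg m (V c) → V' c}

theorem rd (hι : ∀ c x, enc (ι c x) = enc x) {x : ∀ c, Msg m (V c)}
    (hx : FP e fun c => enc (x c)) : FP e fun c => enc (ParamSys.rd (ι c) (x c)) :=
  ((const .nil).pair ((const .nil).pair hx)).congr fun c => by rw [← hι]; rfl

theorem wr (hι : ∀ c x, enc (ι c x) = enc x) {x : ∀ c, Msg m (V c)}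
    (hx : FP e fun c => enc (x c)) : FP e fun c => enc (ParamSys.wr (ι c) (x c)) :=
  ((const (.cons .nil .nil)).pair ((const .nil).pair hx)).congr fun c => by rw [← hι]; rfl

theorem wrBad (hι : ∀ c x, enc (ι c x) = enc x) :
    FP e fun c => enc (ParamSys.wr (ι c) .bad) := wr hι (const (enc (Msg.bad : Msg 0 Data)))

theorem rdBad (hι : ∀ c x, enc (ι c x) = enc x) :
    FP e fun c => enc (ParamSys.rd (ι c) .bad) := rd hι (const (enc (Msg.bad : Msg 0 Data)))

theorem rule {A : γ → Type*} [∀ c, Enc (A c)] {src pop tgt : γ → Data} {lab : ∀ c, Option (A c)}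
    {push : γ → List Data} (h1 : FP e src) (h2 : FP e pop) (h3 : FP e fun c => enc (lab c))
    (h4 : FP e tgt) (h5 : FP e fun c => enc (push c)) :
    FP e fun c => enc (⟨src c, pop c, lab c, tgt c, push c⟩ : PDRule (A c)) :=
  h1.pair (h2.pair (h3.pair (h4.pair h5)))

theorem single {x : γ → Data} (hx : FP e x) : FP e fun c => enc [x c] :=
  cons (α := fun _ => Data) hx nil

theorem contribRules [∀ c, DecidableEq (V c)] (h : ∀ c, Function.Injective (enc : V c → Data))
    (hι : ∀ c x, enc (ι c x) = enc x)
    {stops : ∀ c, List (Fin m → V c)} (hstops : FP e fun c => enc (stops c))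
    {r : ∀ c, PDRule (RegOp m (V c))} (hr : FP e fun c => enc (r c)) :
    FP e fun c => enc (ParamSys.contribRules (ι c) (stops c) (r c)) := by
  have hsrc : FP e fun c => (r c).src := hr.fst
  have hpop : FP e fun c => (r c).pop := hr.snd.fst
  have hlab : FP e fun c => enc (r c).lab := hr.snd.snd.fst
  have htgt : FP e fun c => (r c).tgt := hr.snd.snd.snd.fst
  have hpush : FP e fun c => enc (r c).push := hr.snd.snd.snd.snd
  have hnrm : FP e fun c => ctlNrm (r c).src := (const (encNat 0)).pair hsrc
  have hnrm' : FP e fun c => ctlNrm (r c).tgt := (const (encNat 0)).pair htgt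
  have hwait : FP (ext (α := fun c => RegOp m (V c)) e)
      fun p => ctlWait p.2 (r p.1).tgt (r p.1).push :=
    (const (encNat 1)).pair (var.pair (htgt.lift.pair hpush.lift))
  have hchk : FP (ext (α := fun c => Fin m → V c) e) fun p => ctlChk (r p.1).src p.2 :=
    (const (encNat 2)).pair (hsrc.lift.pair var)
  have herr : FP e fun _ => ctlErr := const _
  have hsink : FP e fun _ => ctlSink := const _
  simp only [ParamSys.contribRules]
  refine append (optionElim hlab (cons ?_ nil) (cons ?_ (cons ?_ (map hstops.lift ?_))))
    (cons ?_ (flatMap hstops (cons ?_ (map ?_ ?_))))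
  · exact rule hnrm hpop (const .nil) hnrm' hpush
  · exact rule hnrm.lift hpop.lift (some (wr (fun p => hι p.1) (req var))) hwait
      (single hpop.lift)
  · exact rule hwait hpop.lift (some (rd (fun p => hι p.1) (ack var))) hnrm'.lift hpush.lift
  · exact rule hwait.lift hpop.lift.lift (some (rd (fun p => hι p.1.1) (halt var)))
      herr.lift.lift (single hpop.lift.lift)
  · exact rule herr hpop (some (wrBad hι)) hsink (single hpop)
  · exact rule hnrm.lift hpop.lift (some (rd (fun p => hι p.1) (halt var))) hchk
      (single hpop.lift)
  · exact regNext (fun p => h p.1) hlab.lift var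
  · exact rule hchk.lift hpop.lift.lift (some (wrBad fun p => hι p.1.1)) hsink.lift.lift
      (single hpop.lift.lift)

theorem contribPD [∀ c, DecidableEq (V c)] (h : ∀ c, Function.Injective (enc : V c → Data))
    (hι : ∀ c x, enc (ι c x) = enc x)
    {stops : ∀ c, List (Fin m → V c)} (hstops : FP e fun c => enc (stops c))
    {𝒞 : ∀ c, Pushdown (RegOp m (V c))} (h𝒞 : FP e fun c => enc (𝒞 c)) :
    FP e fun c => enc (ParamSys.contribPD (ι c) (stops c) (𝒞 c)) := by
  have hrules : FP e fun c => enc (𝒞 c).rules := h𝒞.snd.snd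
  exact ((const (encNat 0)).pair h𝒞.fst).pair (h𝒞.snd.fst.pair
    (flatMap hrules (contribRules (fun p => h p.1) (fun p => hι p.1) hstops.lift var)))

end

end FP
end ParamSys

namespace ParamSys
open Enc
namespace FP

section

variable {γ : Type*} {e : γ → Data} {m : ℕ} {V V' : γ → Type*} [∀ c, Enc (V c)]
  [∀ c, Enc (V' c)] {ι : ∀ c, Msg m (V c) → V' c}

theorem stackTag {A : γ → Data} (hA : FP e A) : FP e fun c => ParamSys.stackTag (A c) :=
  (const .nil).pair hA

theorem ctlList {𝒟 : ∀ c, Pushdown (RegOp m (V c))} (h𝒟 : FP e fun c => enc (𝒟 c)) :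
    FP e fun c => enc (ParamSys.ctlList (𝒟 c)) := by
  have hrules : FP e fun c => enc (𝒟 c).rules := h𝒟.snd.snd
  refine cons (α := fun _ => Data) h𝒟.fst (map hrules ?_)
  exact (var (α := fun c => PDRule (RegOp m (V c)))).snd.snd.snd.fst

theorem symList {𝒟 : ∀ c, Pushdown (RegOp m (V c))} (h𝒟 : FP e fun c => enc (𝒟 c)) :
    FP e fun c => enc (ParamSys.symList (𝒟 c)) := by
  have hrules : FP e fun c => enc (𝒟 c).rules := h𝒟.snd.snd
  have hinit : FP e fun c => (𝒟 c).stackInit := h𝒟.snd.fst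
  refine cons (α := fun _ => Data) (const .nil) (cons (α := fun _ => Data) (stackTag hinit)
    (flatMap hrules (map (α := fun _ => Data) ?_ (stackTag (var (α := fun _ => Data))))))
  exact (var (α := fun c => PDRule (RegOp m (V c)))).snd.snd.snd.snd

theorem leaderRules [∀ c, DecidableEq (V c)] (h : ∀ c, Function.Injective (enc : V c → Data))
    (hι : ∀ c x, enc (ι c x) = enc x)
    {ops : ∀ c, List (RegOp m (V c))} (hops : FP e fun c => enc (ops c))
    {stops : ∀ c, List (Fin m → V c)} (hstops : FP e fun c => enc (stops c))
    {ρ₀ : ∀ c, Fin m → V c} (hρ₀ : FP e fun c => enc (ρ₀ c))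
    {init stackInit : γ → Data} (hinit : FP e init) (hstackInit : FP e stackInit)
    {rules : ∀ c, List (PDRule (RegOp m (V c)))} (hrules : FP e fun c => enc (rules c))
    {ctls syms : γ → List Data} (hctls : FP e fun c => enc (ctls c))
    (hsyms : FP e fun c => enc (syms c)) :
    FP e fun c => enc (ParamSys.leaderRules (ι c) (ops c) (stops c) (ρ₀ c) (init c) (stackInit c)
      (rules c) (ctls c) (syms c)) := by
  simp only [ParamSys.leaderRules]
  refine append (append (append (append ?_ ?_) ?_) ?_) ?_
  · exact cons (rule (const ctlBoot) (const .nil) (const .nil)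
      ((const (encNat 6)).pair (hinit.pair hρ₀))
      (cons (α := fun _ => Data) (stackTag hstackInit) (const (enc [Data.nil])))) nil
  · refine flatMap hrules (flatMap hstops.lift (flatMap ?_ (cons ?_ (cons ?_ nil))))
    · exact regNext (fun p => h p.1.1)
        (var (α := fun c => PDRule (RegOp m (V c)))).lift.snd.snd.fst var
    · have hr := (var (e := e) (α := fun c => PDRule (RegOp m (V c)))).lift
        (α := fun p => Fin m → V p.1) |>.lift (α := fun p => Fin m → V p.1.1)
      have hlab : FP _ fun p : Σ p : Σ p : Σ c, PDRule (RegOp m (V c)), Fin m → V p.1,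
          Fin m → V p.1.1 => enc p.1.1.2.lab := hr.snd.snd.fst
      exact rule ((const (encNat 6)).pair (hr.fst.pair var.lift)) (stackTag hr.snd.fst)
        (optionMap hlab (wr (fun p => hι p.1.1.1.1) (exec var)))
        ((const (encNat 6)).pair (hr.snd.snd.snd.fst.pair var))
        (map (α := fun _ => Data) (β := fun _ => Data) hr.snd.snd.snd.snd
          (stackTag (var (α := fun _ => Data))))
    · have hr := (var (e := e) (α := fun c => PDRule (RegOp m (V c)))).lift
        (α := fun p => Fin m → V p.1) |>.lift (α := fun p => Fin m → V p.1.1)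
      exact rule ((const (encNat 8)).pair (hr.fst.pair var.lift)) (stackTag hr.snd.fst)
        (const .nil) (const ctlLoud) (single (stackTag hr.snd.fst))
  · refine flatMap hstops (flatMap hops.lift (flatMap (regNext (fun p => h p.1.1) (some var)
      var.lift) (flatMap hctls.lift.lift.lift (flatMap hsyms.lift.lift.lift.lift
        (cons ?_ (cons ?_ nil))))))
    · exact rule ((const (encNat 6)).pair (var.lift.pair var.lift.lift.lift.lift)) var
        (some (rd (fun p => hι p.1.1.1.1.1) (req var.lift.lift.lift)))
        ((const (encNat 7)).pair (var.lift.pair (var.lift.lift.lift.lift.pair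
          var.lift.lift.lift))) (single var)
    · exact rule ((const (encNat 7)).pair (var.lift.pair (var.lift.lift.lift.lift.pair
          var.lift.lift.lift))) var
        (some (wr (fun p => hι p.1.1.1.1.1) (ack var.lift.lift.lift)))
        ((const (encNat 6)).pair (var.lift.pair var.lift.lift)) (single var)
  · refine flatMap hstops (flatMap hctls.lift (flatMap hsyms.lift.lift
      (cons ?_ (cons ?_ (map hops.lift.lift.lift ?_)))))
    · exact rule ((const (encNat 6)).pair (var.lift.pair var.lift.lift)) var
        (some (wr (fun p => hι p.1.1.1) (halt var.lift.lift)))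
        ((const (encNat 8)).pair (var.lift.pair var.lift.lift)) (single var)
    · exact rule ((const (encNat 8)).pair (var.lift.pair var.lift.lift)) var
        (some (rdBad fun p => hι p.1.1.1)) (const ctlLoud) (single var)
    · exact rule ((const (encNat 8)).pair (var.lift.lift.pair var.lift.lift.lift)) var.lift
        (some (rd (fun p => hι p.1.1.1.1) (req var))) (const ctlLoud) (single var.lift)
  · exact map hsyms (rule (const ctlLoud) var (some (wrBad fun p => hι p.1)) (const ctlSink)
      (single var))

theorem leaderPD [∀ c, DecidableEq (V c)] (h : ∀ c, Function.Injective (enc : V c → Data))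
    (hι : ∀ c x, enc (ι c x) = enc x)
    {ops : ∀ c, List (RegOp m (V c))} (hops : FP e fun c => enc (ops c))
    {stops : ∀ c, List (Fin m → V c)} (hstops : FP e fun c => enc (stops c))
    {ρ₀ : ∀ c, Fin m → V c} (hρ₀ : FP e fun c => enc (ρ₀ c))
    {𝒟 : ∀ c, Pushdown (RegOp m (V c))} (h𝒟 : FP e fun c => enc (𝒟 c)) :
    FP e fun c => enc (ParamSys.leaderPD (ι c) (ops c) (stops c) (ρ₀ c) (𝒟 c)) :=
  (const ctlBoot).pair ((const .nil).pair (leaderRules h hι hops hstops hρ₀ h𝒟.fst h𝒟.snd.fst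
    (rules := fun c => (𝒟 c).rules) h𝒟.snd.snd h𝒟.ctlList h𝒟.symList))

/-! ### The translation of properties in polynomial time -/

theorem markLetters (hι : ∀ c x, enc (ι c x) = enc x) {ops : ∀ c, List (RegOp m (V c))}
    (hops : FP e fun c => enc (ops c)) : FP e fun c => enc (ParamSys.markLetters (ι c) (ops c)) :=
  flatMap hops (cons (wr (fun p => hι p.1) (ack var)) (cons (wr (fun p => hι p.1) (exec var)) nil))

theorem idleLetters (hι : ∀ c x, enc (ι c x) = enc x) {ops : ∀ c, List (RegOp m (V c))}
    (hops : FP e fun c => enc (ops c)) {stops : ∀ c, List (Fin m → V c)}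
    (hstops : FP e fun c => enc (stops c)) :
    FP e fun c => enc (ParamSys.idleLetters (ι c) (ops c) (stops c)) :=
  append (map hops (rd (fun p => hι p.1) (req var)))
    (map hstops (wr (fun p => hι p.1) (halt var)))

theorem mark (hι : ∀ c x, enc (ι c x) = enc x) {x : ∀ c, Act m (V c)}
    (hx : FP e fun c => enc (x c)) : FP e fun c => enc (ParamSys.mark (ι c) (x c)) := by
  refine (iteEq hx.fst (const .nil)
    ((const (.cons .nil .nil)).pair ((const .nil).pair ((const (encNat 3)).pair hx.snd)))
    ((const (.cons .nil .nil)).pair ((const .nil).pair ((const (encNat 4)).pair hx.snd)))).congr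
    fun c => ?_
  rcases x c with a | a
  · refine (if_pos rfl).trans ?_
    change _ = Data.cons (.cons .nil .nil) (.cons .nil (enc (ι c (.ack a))))
    rw [hι]
    rfl
  · refine (if_neg fun h => by cases h).trans ?_
    change _ = Data.cons (.cons .nil .nil) (.cons .nil (enc (ι c (.exec a))))
    rw [hι]
    rfl

theorem fresh {q : γ → Data} (hq : FP e q) : FP e fun c => Buchi.fresh (q c) :=
  (const .nil).pair hq

theorem stale {q : γ → Data} (hq : FP e q) : FP e fun c => Buchi.stale (q c) :=
  (const (.cons .nil .nil)).pair hq

theorem record {A B : γ → Type*} [∀ c, Enc (A c)] [∀ c, Enc (B c)] {mk : ∀ c, A c → B c}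
    (hmk : FP (ext e) fun p => enc (mk p.1 p.2)) {ign : ∀ c, List (B c)}
    (hign : FP e fun c => enc (ign c)) {ℬ : ∀ c, Buchi (A c)} (hℬ : FP e fun c => enc (ℬ c)) :
    FP e fun c => enc ((ℬ c).record (mk c) (ign c)) := by
  have hinit : FP e fun c => (ℬ c).init := hℬ.fst
  have htrans : FP e fun c => enc (ℬ c).trans := hℬ.snd.fst
  have hfinal : FP e fun c => enc (ℬ c).final := hℬ.snd.snd.fst
  have hrep : FP e fun c => enc (ℬ c).rep := hℬ.snd.snd.snd
  refine (fresh hinit).pair (pair (f := fun c => enc ((ℬ c).record (mk c) (ign c)).trans) ?_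
    (pair (f := fun c => enc ((ℬ c).record (mk c) (ign c)).final)
      (g := fun c => enc ((ℬ c).record (mk c) (ign c)).rep) ?_ ?_))
  · refine append (flatMap htrans ?_) (flatMap (cons (α := fun _ => Data) hinit (map htrans ?_))
      (flatMap hign.lift ?_))
    · have ht := var (e := e) (α := fun c => Data × A c × Data)
      have hm : FP (ext (α := fun c => Data × A c × Data) e) fun p => enc (mk p.1 p.2.2.1) :=
        comp (e' := ext e) (fun p : Σ c, Data × A c × Data => (⟨p.1, p.2.2.1⟩ : Σ c, A c))
          (self.fst.pair ht.snd.fst) hmk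
      exact cons ((fresh ht.fst).pair (hm.pair (fresh ht.snd.snd)))
        (cons ((stale ht.fst).pair (hm.pair (fresh ht.snd.snd))) nil)
    · exact (var (α := fun c => Data × A c × Data)).snd.snd
    · have hq := (var (e := e) (α := fun c => Data)).lift (α := fun p => B p.1)
      exact cons ((fresh hq).pair (var.pair (stale hq)))
        (cons ((stale hq).pair (var.pair (stale hq))) nil)
  · exact flatMap hfinal (cons (α := fun _ => Data) (fresh (var (α := fun _ => Data)))
      (cons (α := fun _ => Data) (stale (var (α := fun _ => Data))) nil))
  · exact map hrep (fresh (var (α := fun _ => Data)))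

end
end FP
end ParamSys

namespace ParamSys
open Enc

/-! ### The translation of formulas in polynomial time -/

namespace LTL

variable {A B : Type*}

/-- The immediate subformulas. -/
def children : LTL A → List (LTL A)
  | .tt => []
  | .atom _ => []
  | .neg φ => [φ]
  | .and φ ψ => [φ, ψ]
  | .next φ => [φ]
  | .until φ ψ => [φ, ψ]

/-- The occurrences of subformulas in preorder. -/
def preorder : LTL A → List (LTL A)
  | .tt => [.tt]
  | .atom x => [.atom x]
  | .neg φ => .neg φ :: preorder φ
  | .and φ ψ => .and φ ψ :: (preorder φ ++ preorder ψ)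
  | .next φ => .next φ :: preorder φ
  | .until φ ψ => .until φ ψ :: (preorder φ ++ preorder ψ)

theorem preorder_eq (φ : LTL A) : preorder φ = φ :: (children φ).flatMap preorder := by
  cases φ <;> simp [preorder, children]

/-- One step of the enumeration of subformulas: the first formula that is left to do is moved to the
output, and its immediate subformulas are left to do. -/
def visit : List (LTL A) × List (LTL A) → List (LTL A) × List (LTL A)
  | ([], acc) => ([], acc)
  | (φ :: w, acc) => (children φ ++ w, φ :: acc)

/-- The atom, if the formula is an atom. -/
def atom? : LTL A → Option A
  | .atom x => some x
  | _ => none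

variable [Enc A] [Enc B]

theorem size_children_append_le (φ : LTL A) (w : List (LTL A)) :
    (enc (children φ ++ w)).size ≤ (enc (φ :: w)).size := by
  have h0 : ∀ (φ : LTL A) (w : List (LTL A)),
      (enc (φ :: w)).size = (encLTL φ).size + (enc w).size + 1 := fun _ _ => rfl
  have := (enc w).size_pos
  cases φ <;> simp only [children, List.nil_append, List.cons_append, h0, encLTL, Data.size,
    encNat] <;> omega

theorem size_le_of_mem_preorder {φ ψ : LTL A} (h : ψ ∈ preorder φ) :
    (enc ψ).size ≤ (enc φ).size := by
  change (encLTL ψ).size ≤ (encLTL φ).size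
  induction φ with
  | tt => rw [List.mem_singleton.mp h]
  | atom x => rw [List.mem_singleton.mp h]
  | neg φ ih | next φ ih =>
    rcases List.mem_cons.mp h with rfl | h
    · exact le_rfl
    · have := ih h
      simp only [encLTL, Data.size]
      omega
  | _ φ χ ih ih' =>
    rcases List.mem_cons.mp h with rfl | h
    · exact le_rfl
    · rcases List.mem_append.mp h with h | h
      · have := ih h
        simp only [encLTL, Data.size]
        omega
      · have := ih' h
        simp only [encLTL, Data.size]
        omega

theorem length_preorder_le (φ : LTL A) : (preorder φ).length ≤ (enc φ).size := by
  change _ ≤ (encLTL φ).size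
  induction φ <;> simp only [preorder, List.length_cons, List.length_append, List.length_nil,
    encLTL, Data.size] <;> omega

/-- After `i` steps the first `i` formulas of the preorder have been output. -/
theorem visit_iterate (φ : LTL A) : ∀ i ≤ (preorder φ).length, ∃ w acc,
    visit^[i] ([φ], []) = (w, acc) ∧ acc.length = i ∧
      acc.reverse ++ w.flatMap preorder = preorder φ ∧ (enc w).size ≤ (enc [φ]).size := by
  intro i
  induction i with
  | zero => exact fun _ => ⟨[φ], [], rfl, rfl, by simp, le_rfl⟩
  | succ i ih =>
    intro hi
    obtain ⟨w, acc, h1, h2, h3, h4⟩ := ih (by omega)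
    rw [Function.iterate_succ_apply', h1]
    rcases w with _ | ⟨ψ, w⟩
    · rw [← h3] at hi
      simp only [List.flatMap_nil, List.append_nil, List.length_reverse, h2] at hi
      omega
    · refine ⟨_, _, rfl, by simp [h2], ?_, (size_children_append_le ψ w).trans h4⟩
      rw [← h3, List.flatMap_cons, preorder_eq ψ]
      simp

end LTL

theorem size_enc_le_of_forall {α : Type*} [Enc α] {l : List α} {b : ℕ}
    (h : ∀ a ∈ l, (enc a).size ≤ b) : (enc l).size ≤ l.length * (b + 1) + 1 := by
  induction l with
  | nil => exact le_add_self
  | cons a l ih =>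
    have h1 := ih fun x hx => h x (List.mem_cons_of_mem a hx)
    have h2 := h a List.mem_cons_self
    change (enc a).size + (enc l).size + 1 ≤ (l.length + 1) * (b + 1) + 1
    rw [add_mul l.length 1]
    omega

namespace FP

variable {γ : Type*} {e : γ → Data} {A B : γ → Type*} [∀ c, Enc (A c)] [∀ c, Enc (B c)]

/-- The preorder is computed by a loop that ends when nothing is left to do. -/
theorem preorder {φ : ∀ c, LTL (A c)} (hφ : FP e fun c => enc (φ c)) :
    FP e fun c => enc (LTL.preorder (φ c)).reverse := by
  let T : γ → ℕ → Data := fun c i => enc (LTL.visit^[i] ([φ c], []))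
  have hlen : ∀ c, ∃ acc, LTL.visit^[(LTL.preorder (φ c)).length] ([φ c], []) = ([], acc) ∧
      acc.reverse = LTL.preorder (φ c) := by
    intro c
    obtain ⟨w, acc, h1, h2, h3, -⟩ := LTL.visit_iterate (φ c) _ le_rfl
    rcases w with _ | ⟨ψ, w⟩
    · exact ⟨acc, h1, by simpa using h3⟩
    · rw [← h3, List.flatMap_cons, LTL.preorder_eq] at h2
      simp at h2
  have hlt : ∀ c i, i < (LTL.preorder (φ c)).length →
      ∃ ψ w acc, LTL.visit^[i] ([φ c], []) = (ψ :: w, acc) := by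
    intro c i hi
    obtain ⟨w, acc, h1, h2, h3, -⟩ := LTL.visit_iterate (φ c) i hi.le
    rcases w with _ | ⟨ψ, w⟩
    · rw [← h3] at hi
      simp [h2] at hi
    · exact ⟨ψ, w, acc, h1⟩
  have hT : FP e fun c => T c (LTL.preorder (φ c)).length := by
    refine iterate (T := T) (C := Data.fst) (b := fun c => (enc [φ c]).size +
      ((enc (φ c)).size * ((enc (φ c)).size + 1) + 1) + 1) (fst self) ?_
      ((cons hφ nil).pair (const .nil)) ?_ ?_
      (hφ.size.mono fun c => LTL.length_preorder_le _)
      (((cons hφ nil).size.add ((hφ.size.mul (hφ.size.add (.const 1))).add (.const 1))).add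
        (.const 1)) ?_
    · have hs : FP (fun p : {p : γ × ℕ // p.2 < (LTL.preorder (φ p.1)).length} =>
          T p.1.1 p.1.2) _ := self
      have hψ := hs.fst.fst
      have hw := hs.fst.snd
      refine ((iteEq hψ.fst (const (encNat 0)) hw (iteEq hψ.fst (const (encNat 1)) hw
        (iteEq hψ.fst (const (encNat 2)) (hψ.snd.pair hw)
        (iteEq hψ.fst (const (encNat 4)) (hψ.snd.pair hw)
          (hψ.snd.fst.pair (hψ.snd.snd.pair hw)))))).pair (hψ.pair hs.snd)).congr ?_
      rintro ⟨⟨c, i⟩, hi⟩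
      obtain ⟨ψ, w, acc, h⟩ := hlt c i hi
      simp only [T, Function.iterate_succ_apply', h]
      cases ψ <;> rfl
    · intro c i hi
      obtain ⟨ψ, w, acc, h⟩ := hlt c i hi
      simp only [T, h]
      exact fun h => by cases h
    · intro c
      obtain ⟨acc, h, -⟩ := hlen c
      simp only [T, h]
      rfl
    · intro c i hi
      obtain ⟨w, acc, h1, h2, h3, h4⟩ := LTL.visit_iterate (φ c) i hi
      have h5 : (enc acc).size ≤ acc.length * ((enc (φ c)).size + 1) + 1 :=
        size_enc_le_of_forall fun ψ hψ => LTL.size_le_of_mem_preorder (by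
          rw [← h3]; exact List.mem_append_left _ (List.mem_reverse.mpr hψ))
      have h6 : acc.length * ((enc (φ c)).size + 1) ≤ (enc (φ c)).size * ((enc (φ c)).size + 1) :=
        Nat.mul_le_mul_right _ (by rw [h2]; exact hi.trans (LTL.length_preorder_le _))
      simp only [T, h1]
      change (enc w).size + (enc acc).size + 1 ≤ _
      omega
  refine hT.snd.congr fun c => ?_
  obtain ⟨acc, h, h'⟩ := hlen c
  simp only [T, h]
  rw [← h', List.reverse_reverse]
  rfl

theorem neg {x : γ → Data} (hx : FP e x) : FP e fun c => .cons (encNat 2) (x c) :=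
  (const _).pair hx

theorem and {x y : γ → Data} (hx : FP e x) (hy : FP e y) :
    FP e fun c => .cons (encNat 3) (.cons (x c) (y c)) := (const _).pair (hx.pair hy)

theorem next {x : γ → Data} (hx : FP e x) : FP e fun c => .cons (encNat 4) (x c) :=
  (const _).pair hx

theorem untl {x y : γ → Data} (hx : FP e x) (hy : FP e y) :
    FP e fun c => .cons (encNat 5) (.cons (x c) (y c)) := (const _).pair (hx.pair hy)

theorem noneOf {l : ∀ c, List (B c)} (hl : FP e fun c => enc (l c)) :
    FP e fun c => enc (LTL.noneOf (l c)) := by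
  refine (foldl (σ := fun c => LTL (B c)) (f := fun c s y => .and (.neg (.atom y)) s)
    (s := fun c => .tt) (d := fun c => (enc (l c)).size + 20) hl.reverse
    (const (enc (LTL.tt : LTL Data))) (and (neg ((const (encNat 1)).pair var)) var.lift)
    (hl.size.add (.const 20)) fun c s y hy => ?_).congr fun c => ?_
  · have := size_enc_le_of_mem (List.mem_reverse.mp hy)
    change (Data.cons (encNat 3) (.cons (.cons (encNat 2) (.cons (encNat 1) (enc y)))
      (enc s))).size ≤ _
    simp only [encNat, Data.size]
    omega
  · rw [List.foldl_reverse]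
    congr 1
    induction l c with
    | nil => rfl
    | cons a l ih => simp only [List.foldr_cons, ih]; rfl

end FP

namespace LTL

/-- The operation on a stack `d` of translated formulas that is performed for a formula with the
encoding `x` that is not an atom; the translations of its immediate subformulas are on top of the
stack. The encoding of the formula that holds if nothing is recorded is `s`. -/
def build (s d x : Data) : Data :=
  if x.fst = encNat 0 then .cons x d
  else if x.fst = encNat 2 then .cons (.cons (encNat 2) d.fst) d.snd
  else if x.fst = encNat 3 then
    .cons (.cons (encNat 3) (.cons d.fst d.snd.fst)) d.snd.snd
  else if x.fst = encNat 4 then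
    .cons (.cons (encNat 5) (.cons s (.cons (encNat 3) (.cons (.cons (encNat 2) s)
      (.cons (encNat 4) (.cons (encNat 5) (.cons s (.cons (encNat 3)
        (.cons (.cons (encNat 2) s) d.fst)))))))))
      d.snd
  else
    .cons (.cons (encNat 5) (.cons (.cons (encNat 2) (.cons (encNat 3)
      (.cons (.cons (encNat 2) s) (.cons (encNat 2) d.fst))))
      (.cons (encNat 3) (.cons (.cons (encNat 2) s) d.snd.fst)))) d.snd.snd

/-- The operation on a stack of translated formulas that is performed for a formula. -/
def evalStep {A B : Type*} [Enc A] [Enc B] (mk : A → B) (s : LTL B) (d : Data) (φ : LTL A) : Data :=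
  φ.atom?.elim (build (enc s) d (enc φ)) fun x => .cons (enc (LTL.until s (.atom (mk x)))) d

/-- In reversed preorder the immediate subformulas of a formula come before it, so a single pass
with a stack evaluates the translation. This replaces recursion, which programs do not have. -/
theorem foldl_evalStep {A B : Type*} [Enc A] [Enc B] (mk : A → B) (s : LTL B) (φ : LTL A) :
    ∀ d, (preorder φ).reverse.foldl (evalStep mk s) d = .cons (enc (translate mk s φ)) d := by
  induction φ with
  | tt => intro d; rfl
  | atom x => intro d; rfl
  | neg φ ih | next φ ih =>
    intro d
    simp only [preorder, List.reverse_cons, List.foldl_append, ih, List.foldl_cons, List.foldl_nil]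
    rfl
  | _ φ ψ ih ih' =>
    intro d
    simp only [preorder, List.reverse_cons, List.reverse_append, List.foldl_append, ih, ih',
      List.foldl_cons, List.foldl_nil]
    rfl

/-- Translations are duplicated nowhere except for `s`, so the size of the stack grows by a bounded
amount. -/
theorem size_build_le (s d x : Data) :
    (build s d x).size ≤ d.size + (4 * s.size + x.size + 200) := by
  have h : ∀ y : Data, y.fst.size + y.snd.size ≤ y.size + 1 := by
    intro y; cases y <;> simp only [Data.fst, Data.snd, Data.size] <;> omega
  have h1 := h d
  have h2 := h d.snd
  unfold build
  split_ifs <;> simp only [Data.size, encNat] <;> omega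

end LTL

namespace FP

variable {γ : Type*} {e : γ → Data} {A B : γ → Type*} [∀ c, Enc (A c)] [∀ c, Enc (B c)]

theorem atom? {φ : ∀ c, LTL (A c)} (hφ : FP e fun c => enc (φ c)) :
    FP e fun c => enc (φ c).atom? :=
  (iteEq hφ.fst (const (encNat 1)) ((const .nil).pair hφ.snd) (const .nil)).congr fun c => by
    cases φ c <;> rfl

theorem build {s d x : γ → Data} (hs : FP e s) (hd : FP e d) (hx : FP e x) :
    FP e fun c => LTL.build (s c) (d c) (x c) :=
  iteEq hx.fst (const _) (hx.pair hd) <|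
  iteEq hx.fst (const _) (hd.fst.neg.pair hd.snd) <|
  iteEq hx.fst (const _) ((hd.fst.and hd.snd.fst).pair hd.snd.snd) <|
  iteEq hx.fst (const _)
    ((hs.untl (hs.neg.and (hs.untl (hs.neg.and hd.fst)).next)).pair hd.snd)
    (((hs.neg.and hd.fst.neg).neg.untl (hs.neg.and hd.snd.fst)).pair hd.snd.snd)

theorem translate {mk : ∀ c, A c → B c} (hmk : FP (ext e) fun p => enc (mk p.1 p.2))
    {s : ∀ c, LTL (B c)} (hs : FP e fun c => enc (s c)) {φ : ∀ c, LTL (A c)}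
    (hφ : FP e fun c => enc (φ c)) : FP e fun c => enc (LTL.translate (mk c) (s c) (φ c)) := by
  obtain ⟨k, hk⟩ := hmk.size
  have h1 : FP (ext (α := fun p : Σ _ : γ, Data => LTL (A p.1)) (ext (α := fun _ => Data) e))
      fun p => enc (LTL.evalStep (mk p.1.1) (s p.1.1) p.1.2 p.2) := by
    refine optionElim (β := fun _ => Data)
      (o := fun p : Σ p : Σ _ : γ, Data, LTL (A p.1) => p.2.atom?)
      (b := fun p : Σ p : Σ _ : γ, Data, LTL (A p.1) => LTL.build (enc (s p.1.1)) p.1.2 (enc p.2))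
      (g := fun (p : Σ p : Σ _ : γ, Data, LTL (A p.1)) x =>
        .cons (enc (LTL.until (s p.1.1) (.atom (mk p.1.1 x)))) p.1.2)
      (atom? var) (build hs.lift.lift (var (α := fun _ => Data)).lift var) (pair ?_ ?_)
    · exact untl hs.lift.lift.lift ((const (encNat 1)).pair
        (comp (e' := ext e) (fun p : Σ p : Σ p : Σ _ : γ, Data, LTL (A p.1), A p.1.1 =>
          (⟨p.1.1.1, p.2⟩ : Σ c, A c)) (self.fst.fst.fst.pair var) hmk))
    · exact (var (α := fun _ => Data)).lift.lift
  refine (foldl (σ := fun _ => Data) (s := fun _ => .nil)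
    (f := fun c => LTL.evalStep (mk c) (s c))
    (d := fun c => ((e c).size + (enc (φ c)).size + 2) ^ k + 4 * (enc (s c)).size +
      (enc (φ c)).size + 200)
    hφ.preorder (const .nil) h1 ?_ ?_).fst.congr fun c => ?_
  · exact (((((PolyBound.size.add hφ.size).add (.const 2)).pow k).add
      ((PolyBound.const 4).mul hs.size)).add hφ.size).add (.const 200)
  · intro c d ψ hψ
    have h2 := LTL.size_le_of_mem_preorder (List.mem_reverse.mp hψ)
    cases hx : ψ.atom? with
    | none =>
      have h3 := LTL.size_build_le (enc (s c)) d (enc ψ)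
      simp only [LTL.evalStep, hx, Option.elim_none]
      change (LTL.build (enc (s c)) d (enc ψ)).size ≤ d.size + _
      omega
    | some x =>
      have h3 := hk ⟨c, x⟩
      obtain rfl : ψ = .atom x := by cases ψ <;> simp_all [LTL.atom?]
      have h4 : (enc x).size ≤ (enc (φ c)).size := by
        refine le_trans ?_ h2
        change _ ≤ (Data.cons (encNat 1) (enc x)).size
        simp only [Data.size]
        omega
      have h5 : ((ext e (⟨c, x⟩ : Σ c, A c)).size + 1) ^ k ≤
          ((e c).size + (enc (φ c)).size + 2) ^ k := by
        refine Nat.pow_le_pow_left ?_ k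
        change (e c).size + (enc x).size + 1 + 1 ≤ _
        omega
      simp only [LTL.evalStep, hx, Option.elim_some]
      change (Data.cons (.cons (encNat 5) (.cons (enc (s c)) (.cons (encNat 1)
        (enc (mk c x))))) d).size ≤ d.size + _
      simp only [Data.size, encNat] at h3 ⊢
      omega
  · rw [LTL.foldl_evalStep]
    rfl

theorem recordLTL {mk : ∀ c, A c → B c} (hmk : FP (ext e) fun p => enc (mk p.1 p.2))
    {marks : ∀ c, List (B c)} (hmarks : FP e fun c => enc (marks c)) {bad : ∀ c, B c}
    (hbad : FP e fun c => enc (bad c)) {φ : ∀ c, LTL (A c)} (hφ : FP e fun c => enc (φ c)) :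
    FP e fun c => enc (LTL.record (mk c) (marks c) (bad c) (φ c)) :=
  (translate hmk hmarks.noneOf hφ).and
    ((const (enc (LTL.tt : LTL Data))).untl ((const (encNat 1)).pair hbad)).neg

end FP
end ParamSys

namespace ParamSys
open Enc

/-! ### The transformation of pushdown systems -/

namespace PDSystem

variable {m : ℕ}

/-- All operations on the registers. -/
def ops (sys : PDSystem m) : List (RegOp m (Val sys.vals)) := allOps m sys.vals.attach

/-- All register contents. -/
def contents (sys : PDSystem m) : List (Fin m → Val sys.vals) := tuples sys.vals.attach m

theorem mem_ops (sys : PDSystem m) (a : RegOp m (Val sys.vals)) : a ∈ sys.ops :=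
  mem_allOps (List.mem_attach _) a

theorem mem_contents (sys : PDSystem m) (ρ : Fin m → Val sys.vals) : ρ ∈ sys.contents :=
  mem_tuples (List.mem_attach _) m ρ

/-- The values of the single register of the simulating system. -/
def msgVals (sys : PDSystem m) : List Data := (allMsgs sys.ops sys.contents).map encMsg

/-- Messages as values of the single register. -/
def msgVal (sys : PDSystem m) (x : Msg m (Val sys.vals)) : Val sys.msgVals :=
  ⟨encMsg x, List.mem_map_of_mem (mem_allMsgs sys.mem_ops sys.mem_contents x)⟩

theorem msgVal_injective (sys : PDSystem m) : Function.Injective sys.msgVal := fun _ _ h =>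
  encMsg_injective enc_val_injective (congrArg Subtype.val h)

/-- The pushdown system with one register that simulates `sys`. -/
def simulate (sys : PDSystem m) : PDSystem 1 where
  vals := sys.msgVals
  regInit := fun _ => sys.msgVal .init
  contrib := contribPD sys.msgVal sys.contents sys.contrib
  leader := leaderPD sys.msgVal sys.ops sys.contents sys.regInit sys.leader

theorem simulate_iff (sys : PDSystem m) (Q : Set (Word (RegOp 1 (Val sys.msgVals)))) :
    (oneReg sys.msgVal sys.toCD).HasMaximalTraceWithLeaderProjIn Q ↔
      sys.simulate.toCD.HasMaximalTraceWithLeaderProjIn Q :=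
  oneReg_iff_pushdown enc_val_injective sys.msgVal sys.mem_ops sys.mem_contents sys.regInit
    sys.contrib sys.leader Q

/-- The automaton for the traces of `simulate` that record words accepted by `ℬ`. -/
def simulateBuchi (sys : PDSystem m) (ℬ : Buchi (Act m (Val sys.vals))) :
    Buchi (RegOp 1 (Val sys.simulate.vals)) :=
  ℬ.record (mark sys.msgVal) (idleLetters sys.msgVal sys.ops sys.contents)

/-- The formula for the traces of `simulate` that record words satisfying `φ`. -/
def simulateLTL (sys : PDSystem m) (φ : LTL (Act m (Val sys.vals))) :
    LTL (RegOp 1 (Val sys.simulate.vals)) :=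
  LTL.record (mark sys.msgVal) (markLetters sys.msgVal sys.ops) (wr sys.msgVal .bad) φ

end PDSystem

namespace FP

variable {γ : Type*} {e : γ → Data} {m : ℕ} {sys : γ → PDSystem m}

theorem attach (hsys : FP e fun c => enc (sys c)) : FP e fun c => enc (sys c).vals.attach := by
  refine hsys.fst.congr fun c => ?_
  have h : ∀ (G : List Data) (l : List (Val G)), enc (l.map Subtype.val) = enc l := by
    intro G l
    induction l with
    | nil => rfl
    | cons a l ih => exact congrArg (Data.cons _) ih
  rw [← h, List.attach_map_subtype_val]
  rfl

theorem ops (hsys : FP e fun c => enc (sys c)) : FP e fun c => enc (sys c).ops :=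
  allOps hsys.attach m

theorem contents (hsys : FP e fun c => enc (sys c)) : FP e fun c => enc (sys c).contents :=
  tuples hsys.attach m

theorem simulate (hsys : FP e fun c => enc (sys c)) : FP e fun c => enc (sys c).simulate := by
  have hvals : FP e fun c => enc (sys c).msgVals :=
    map (allMsgs hsys.ops hsys.contents) (β := fun _ => Data) var
  have hinit : FP e fun c => enc (List.ofFn fun _ : Fin 1 => (sys c).msgVal .init) :=
    const (enc [encMsg (Msg.init : Msg 0 Data)])
  have hC : FP e fun c => enc (sys c).contrib := hsys.snd.snd.fst
  have hD : FP e fun c => enc (sys c).leader := hsys.snd.snd.snd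
  exact hvals.pair (hinit.pair (pair
    (contribPD (ι := fun c => (sys c).msgVal) (fun _ => enc_val_injective) (fun _ _ => rfl)
      hsys.contents hC)
    (leaderPD (ι := fun c => (sys c).msgVal) (fun _ => enc_val_injective) (fun _ _ => rfl)
      hsys.ops hsys.contents (ρ₀ := fun c => (sys c).regInit) hsys.snd.fst hD)))

theorem simulateBuchi (hsys : FP e fun c => enc (sys c))
    {ℬ : ∀ c, Buchi (Act m (Val (sys c).vals))} (hℬ : FP e fun c => enc (ℬ c)) :
    FP e fun c => enc ((sys c).simulateBuchi (ℬ c)) := by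
  have hmk : FP (ext (α := fun c => Act m (Val (sys c).vals)) e)
      fun p => enc (ParamSys.mark (sys p.1).msgVal p.2) :=
    mark (V' := fun p : Σ c, Act m (Val (sys c).vals) => Val (sys p.1).msgVals) (fun _ _ => rfl) var
  have hidle : FP e fun c =>
      enc (ParamSys.idleLetters (sys c).msgVal (sys c).ops (sys c).contents) :=
    idleLetters (V' := fun c => Val (sys c).msgVals) (fun _ _ => rfl) hsys.ops hsys.contents
  exact record (mk := fun c => ParamSys.mark (sys c).msgVal) hmk hidle hℬ

theorem simulateLTL (hsys : FP e fun c => enc (sys c))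
    {φ : ∀ c, LTL (Act m (Val (sys c).vals))} (hφ : FP e fun c => enc (φ c)) :
    FP e fun c => enc ((sys c).simulateLTL (φ c)) := by
  have hmk : FP (ext (α := fun c => Act m (Val (sys c).vals)) e)
      fun p => enc (ParamSys.mark (sys p.1).msgVal p.2) :=
    mark (V' := fun p : Σ c, Act m (Val (sys c).vals) => Val (sys p.1).msgVals) (fun _ _ => rfl) var
  have hmarks : FP e fun c => enc (ParamSys.markLetters (sys c).msgVal (sys c).ops) :=
    markLetters (V' := fun c => Val (sys c).msgVals) (fun _ _ => rfl) hsys.ops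
  have hbad : FP e fun c => enc (ParamSys.wr (sys c).msgVal .bad) :=
    wrBad (V' := fun c => Val (sys c).msgVals) fun _ _ => rfl
  exact recordLTL (mk := fun c => ParamSys.mark (sys c).msgVal) hmk hmarks hbad hφ

end FP

theorem polyTime_simulateBuchi (m : ℕ) :
    PolyTime fun p : Σ sys : PDSystem m, Buchi (Act m (Val sys.vals)) =>
      (⟨p.1.simulate, p.1.simulateBuchi p.2⟩ :
        Σ sys' : PDSystem 1, Buchi (RegOp 1 (Val sys'.vals))) := by
  have hsys : FP enc fun p : Σ sys : PDSystem m, Buchi (Act m (Val sys.vals)) => enc p.1 :=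
    FP.self.fst
  exact FP.polyTime (hsys.simulate.pair (hsys.simulateBuchi FP.self.snd))

theorem polyTime_simulateLTL (m : ℕ) :
    PolyTime fun p : Σ sys : PDSystem m, LTL (Act m (Val sys.vals)) =>
      (⟨p.1.simulate, p.1.simulateLTL p.2⟩ :
        Σ sys' : PDSystem 1, LTL (RegOp 1 (Val sys'.vals))) := by
  have hsys : FP enc fun p : Σ sys : PDSystem m, LTL (Act m (Val sys.vals)) => enc p.1 :=
    FP.self.fst
  exact FP.polyTime (hsys.simulate.pair (hsys.simulateLTL FP.self.snd))

end ParamSys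

theorem mainTheorem9 (m : ℕ) :
    -- arbitrary systems, regular properties
    (∀ (V : Type) [Finite V] (S T : Type u) (sys : CDSystem m V S T) (P : Buchi (Act m V)),
      CExpanding P.lang →
      ∃ (V' : Type) (_ : Finite V') (S' T' : Type u) (sys' : CDSystem 1 V' S' T')
        (P' : Buchi (RegOp 1 V')),
        sys.HasMaximalTraceIn P.lang ↔ sys'.HasMaximalTraceWithLeaderProjIn P'.lang) ∧
    -- arbitrary systems, LTL properties
    (∀ (V : Type) [Finite V] (S T : Type u) (sys : CDSystem m V S T) (φ : LTL (Act m V)),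
      CExpanding φ.lang →
      ∃ (V' : Type) (_ : Finite V') (S' T' : Type u) (sys' : CDSystem 1 V' S' T')
        (φ' : LTL (RegOp 1 V')),
        sys.HasMaximalTraceIn φ.lang ↔ sys'.HasMaximalTraceWithLeaderProjIn φ'.lang) ∧
    -- pushdown systems, regular properties: one polynomial-time transformation
    (∃ F : (Σ sys : PDSystem m, Buchi (Act m (Val sys.vals))) →
          (Σ sys' : PDSystem 1, Buchi (RegOp 1 (Val sys'.vals))),
      PolyTime F ∧
      ∀ (sys : PDSystem m) (P : Buchi (Act m (Val sys.vals))), CExpanding P.lang →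
        (sys.toCD.HasMaximalTraceIn P.lang ↔
          (F ⟨sys, P⟩).1.toCD.HasMaximalTraceWithLeaderProjIn (F ⟨sys, P⟩).2.lang)) ∧
    -- pushdown systems, LTL properties: one polynomial-time transformation
    (∃ F : (Σ sys : PDSystem m, LTL (Act m (Val sys.vals))) →
          (Σ sys' : PDSystem 1, LTL (RegOp 1 (Val sys'.vals))),
      PolyTime F ∧
      ∀ (sys : PDSystem m) (φ : LTL (Act m (Val sys.vals))), CExpanding φ.lang →
        (sys.toCD.HasMaximalTraceIn φ.lang ↔
          (F ⟨sys, φ⟩).1.toCD.HasMaximalTraceWithLeaderProjIn (F ⟨sys, φ⟩).2.lang)) := by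
  refine ⟨fun V _ S T sys P hP => ?_, fun V _ S T sys φ hφ => ?_,
    ⟨_, polyTime_simulateBuchi m, fun sys P hP => ?_⟩,
    ⟨_, polyTime_simulateLTL m, fun sys φ hφ => ?_⟩⟩
  · obtain ⟨ops, hops⟩ := exists_complete_list (RegOp m V)
    obtain ⟨stops, hstops⟩ := exists_complete_list (Fin m → V)
    exact ⟨Msg m V, inferInstance, _, _, oneReg _root_.id sys, _,
      hasMaximalTraceIn_iff_oneReg_buchi Function.injective_id sys hops hstops P hP⟩
  · obtain ⟨ops, hops⟩ := exists_complete_list (RegOp m V)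
    exact ⟨Msg m V, inferInstance, _, _, oneReg _root_.id sys, _,
      hasMaximalTraceIn_iff_oneReg_ltl Function.injective_id sys hops φ hφ⟩
  · exact (hasMaximalTraceIn_iff_oneReg_buchi sys.msgVal_injective sys.toCD sys.mem_ops
      sys.mem_contents P hP).trans (sys.simulate_iff _)
  · exact (hasMaximalTraceIn_iff_oneReg_ltl sys.msgVal_injective sys.toCD sys.mem_ops φ hφ).trans
      (sys.simulate_iff _)
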